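/- **Theorem A.** Let $\mathbf{CGH}$ be the category of compactly generated Hausdorff spaces; products and fibre products below are formed in $\mathbf{CGH}$. A *topological category* $C$ is a category internal to $\mathbf{CGH}$, with space of objects $C_0$, space of arrows $C_1$, and source and target maps $s,t\colon C_1\to C_0$; functors between topological categories are internal functors. $C$ is called *well-pointed* if $(C_1,C_0)$, with $C_0\subseteq C_1$ via the identity arrows, is an NDR-pair over $C_0\times C_0$, that is, if there are continuous maps $u\colon C_1\to[0,1]$ and $h\colon C_1\times[0,1]\to C_1$ with $(s,t)\circ h(-,\tau)=(s,t)$ for all $\tau$, such that $C_0=u^{-1}(0)$; $h(-,0)=\mathrm{id}$; $h(a,\tau)=a$ for all $a\in C_0$ and all $\tau$; and $h(x,1)\in C_0$ whenever $u(x)<1$. Let $BC=|NC|$ be the geometric realisation of the nerve of $C$ (a simplicial space), and let $\mathrm{disc}(S)$ be the topological category with space of objects $S$ and only identity arrows, so that $B\,\mathrm{disc}(S)=S$. Let $f\colon X\to Y$ be a functor between well-pointed topological categories. Let $Y_0\downarrow f$ be the topological category whose objects are the pairs $(\eta,b)$ with $b\in X_0$ and $\eta\colon a\to f(b)$ an arrow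 of $Y$, topologised as $Y_1\times_{Y_0}X_0$, and whose arrows $(\eta\colon a\to f(b),b)\to(\eta'\colon a\to f(b'),b')$ are the arrows $h\colon b\to b'$ of $X$ with $\eta'=f(h)\circ\eta$, where the space of arrows is topologised as $Y_1\times_{Y_0}X_1$. Let $\rho\colon Y_0\downarrow f\to\mathrm{disc}(Y_0)$ be the functor that sends $(\eta\colon a\to f(b),b)$ to $a$. Suppose that $B\rho\colon B(Y_0\downarrow f)\to Y_0$ is *shrinkable*, that is, that it has a continuous section $\sigma$ such that $\sigma\circ B\rho$ is homotopic to the identity of $B(Y_0\downarrow f)$ through maps over $Y_0$. Then $Bf\colon BX\to BY$ is a homotopy equivalence. -/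

import Mathlib

open CategoryTheory

universe u

/-! ### Compactly generated topologies and fibre products in `CGH`

A space in `CGH` is a type with a topology, `[T2Space]` and `[CompactlyGeneratedSpace]`. -/

/-- The compactly generated topology associated with a topology `t`: a set is open iff its trace on
every compact set is open. -/
@[reducible]
noncomputable def kTopology {A : Type u} (t : TopologicalSpace A) : TopologicalSpace A :=
  TopologicalSpace.induced (CompactCoherentification.mk A) inferInstance

theorem kTopology_le {A : Type u} (t : TopologicalSpace A) : kTopology t ≤ t :=
  continuous_id_iff_le.1 <| @Continuous.comp A (CompactCoherentification A) A (kTopology t)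
    _ t _ _ CompactCoherentification.continuous_mk_symm continuous_induced_dom

/-- `A` with the topology `kTopology t` is homeomorphic to Mathlib's compact coherentification. -/
noncomputable def kHomeo {A : Type u} (t : TopologicalSpace A) :
    @Homeomorph A (CompactCoherentification A) (kTopology t)
      (@CompactCoherentification.instTopologicalSpace A t) :=
  @Equiv.toHomeomorphOfIsInducing A (CompactCoherentification A) (kTopology t)
    (@CompactCoherentification.instTopologicalSpace A t) (CompactCoherentification.mk A)
    (@Topology.IsInducing.mk _ _ (kTopology t)
      (@CompactCoherentification.instTopologicalSpace A t) _ rfl)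

theorem kTopology_t2 {A : Type u} (t : TopologicalSpace A) (ht : T2Space A) :
    @T2Space A (kTopology t) :=
  @T2Space.of_injective_continuous A (CompactCoherentification A) (kTopology t)
    (@CompactCoherentification.instTopologicalSpace A t)
    (@CompactCoherentification.t2space A t ht) _ (CompactCoherentification.mk A).injective
    continuous_induced_dom

theorem compactlyGeneratedSpace_of_homeo {A C : Type u} [TopologicalSpace A] [TopologicalSpace C]
    [CompactlyGeneratedSpace C] (e : A ≃ₜ C) : CompactlyGeneratedSpace A :=
  uCompactlyGeneratedSpace_of_coinduced e.symm.continuous e.symm.isQuotientMap.isCoinducing.eq_coinduced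

theorem kTopology_cg {A : Type u} (t : TopologicalSpace A) (ht : T2Space A) :
    @CompactlyGeneratedSpace A (kTopology t) :=
  haveI := @CompactCoherentification.t2space A t ht
  @compactlyGeneratedSpace_of_homeo A (CompactCoherentification A) (kTopology t)
    (@CompactCoherentification.instTopologicalSpace A t)
    (@of_compactlyCoherentSpace_of_t2 _ (@CompactCoherentification.instTopologicalSpace A t) this
      (@CompactCoherentification.instCompactlyCoherentSpace A t)) (kHomeo t)

/-- A continuous map out of a compactly generated space remains continuous for `kTopology`. -/
theorem continuous_kTopology {Z A : Type u} [TopologicalSpace Z] [CompactlyGeneratedSpace Z]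
    [T2Space Z] (t : TopologicalSpace A) {g : Z → A} (hg : Continuous g) :
    @Continuous Z A _ (kTopology t) g :=
  continuous_induced_rng.2 <|
    (CompactCoherentification.continuous_map_of_continuous hg).comp
      CompactCoherentification.continuous_mk

/-- The set-theoretic fibre product `A ×_S B`. -/
@[ext]
structure FibProd {A B S : Type u} (p : A → S) (q : B → S) : Type u where
  fst : A
  snd : B
  w : p fst = q snd

namespace FibProd

variable {A B S Z : Type u} [TopologicalSpace A] [TopologicalSpace B] [TopologicalSpace Z]
  {p : A → S} {q : B → S}

/-- The subspace topology of the usual product. -/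
@[reducible]
def subspaceTopology (p : A → S) (q : B → S) : TopologicalSpace (FibProd p q) :=
  TopologicalSpace.induced (fun x => (x.fst, x.snd)) inferInstance

theorem subspaceTopology_t2 [T2Space A] [T2Space B] :
    @T2Space (FibProd p q) (subspaceTopology p q) :=
  letI := subspaceTopology p q
  T2Space.of_injective_continuous (f := fun x : FibProd p q => (x.fst, x.snd))
    (fun _ _ h => FibProd.ext (congrArg Prod.fst h) (congrArg Prod.snd h)) continuous_induced_dom

/-- The topology of the fibre product in `CGH`: the compactly generated refinement of the subspace
topology of the product. -/
noncomputable instance : TopologicalSpace (FibProd p q) := kTopology (subspaceTopology p q)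

instance [T2Space A] [T2Space B] : T2Space (FibProd p q) :=
  @kTopology_t2 _ (subspaceTopology p q) subspaceTopology_t2

instance [T2Space A] [T2Space B] : CompactlyGeneratedSpace (FibProd p q) :=
  @kTopology_cg _ (subspaceTopology p q) subspaceTopology_t2

theorem continuous_pair : Continuous (fun x : FibProd p q => (x.fst, x.snd)) :=
  continuous_le_dom (kTopology_le (subspaceTopology p q)) continuous_induced_dom

theorem continuous_fst : Continuous (fun x : FibProd p q => x.fst) :=
  _root_.continuous_fst.comp continuous_pair

theorem continuous_snd : Continuous (fun x : FibProd p q => x.snd) :=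
  _root_.continuous_snd.comp continuous_pair

theorem continuous_lift [T2Space Z] [CompactlyGeneratedSpace Z] {a : Z → A} {b : Z → B}
    (ha : Continuous a) (hb : Continuous b) (h : ∀ z, p (a z) = q (b z)) :
    Continuous (fun z => (⟨a z, b z, h z⟩ : FibProd p q)) :=
  continuous_kTopology (subspaceTopology p q) (continuous_induced_rng.2 (ha.prodMk hb))

end FibProd

/-! ### Topological categories -/

/-- A topological category: a category internal to `CGH`. Composition is written in diagrammatic
order, so `comp g h` is "first `g`, then `h`", and it is continuous on the fibre product formed in
`CGH`. -/
structure CGHCategory : Type (u + 1) where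
  Ob : Type u
  Mor : Type u
  [topOb : TopologicalSpace Ob]
  [t2Ob : T2Space Ob]
  [cgOb : CompactlyGeneratedSpace Ob]
  [topMor : TopologicalSpace Mor]
  [t2Mor : T2Space Mor]
  [cgMor : CompactlyGeneratedSpace Mor]
  src : Mor → Ob
  tgt : Mor → Ob
  one : Ob → Mor
  comp : ∀ g h : Mor, tgt g = src h → Mor
  continuous_src : Continuous src
  continuous_tgt : Continuous tgt
  continuous_one : Continuous one
  continuous_comp : Continuous (fun x : FibProd tgt src => comp x.fst x.snd x.w)
  src_one : ∀ a, src (one a) = a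
  tgt_one : ∀ a, tgt (one a) = a
  src_comp : ∀ g h w, src (comp g h w) = src g
  tgt_comp : ∀ g h w, tgt (comp g h w) = tgt h
  one_comp : ∀ g, comp (one (src g)) g (tgt_one _) = g
  comp_one : ∀ g, comp g (one (tgt g)) (src_one _).symm = g
  assoc : ∀ g h k (w : tgt g = src h) (w' : tgt h = src k),
    comp (comp g h w) k ((tgt_comp g h w).trans w') =
      comp g (comp h k w') (w.trans (src_comp h k w').symm)

attribute [instance] CGHCategory.topOb CGHCategory.t2Ob CGHCategory.cgOb
  CGHCategory.topMor CGHCategory.t2Mor CGHCategory.cgMor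

/-- A functor between topological categories (an internal functor in `CGH`). -/
structure CGHFunctor (X Y : CGHCategory.{u}) : Type u where
  ob : X.Ob → Y.Ob
  mor : X.Mor → Y.Mor
  continuous_ob : Continuous ob
  continuous_mor : Continuous mor
  src_mor : ∀ g, Y.src (mor g) = ob (X.src g)
  tgt_mor : ∀ g, Y.tgt (mor g) = ob (X.tgt g)
  mor_one : ∀ a, mor (X.one a) = Y.one (ob a)
  mor_comp : ∀ g h w, mor (X.comp g h w) =
    Y.comp (mor g) (mor h) (by rw [tgt_mor, src_mor, w])

/-! ### NDR-pairs over a base and well-pointed topological categories -/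

/-- `(E, A)` is an NDR-pair over the base, with respect to the projection `p : E → B`. A map
`E → I × B` over `B` is the same thing as a map `u : E → I`. -/
def IsNDRPairOver {E B : Type u} [TopologicalSpace E] (p : E → B) (A : Set E) : Prop :=
  ∃ (u : C(E, unitInterval)) (h : C(E × unitInterval, E)),
    A = u ⁻¹' {0} ∧
    (∀ x t, p (h (x, t)) = p x) ∧
    (∀ x, h (x, 0) = x) ∧
    (∀ x ∈ A, ∀ t, h (x, t) = x) ∧
    (∀ x, u x < 1 → h (x, 1) ∈ A)

/-- `Y` is well-pointed: the pair `(Y₁, Y₀)`, with `Y₀` included in `Y₁` by the identities, is an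
NDR-pair over `Y₀ × Y₀` with respect to `(s, t) : Y₁ → Y₀ × Y₀`. -/
def CGHCategory.WellPointed (Y : CGHCategory.{u}) : Prop :=
  IsNDRPairOver (fun g : Y.Mor => (Y.src g, Y.tgt g)) (Set.range Y.one)

/-! ### Nerves -/

/-- An `n`-simplex of the nerve: a functor from the poset `{0 < ⋯ < n}` to `C`, that is, a string of
`n` composable arrows together with all its composites. -/
@[ext]
structure NerveSimplex (C : CGHCategory.{u}) (n : ℕ) : Type u where
  obj : Fin (n + 1) → C.Ob
  map : ∀ i j : Fin (n + 1), i ≤ j → C.Mor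
  src_map : ∀ i j h, C.src (map i j h) = obj i
  tgt_map : ∀ i j h, C.tgt (map i j h) = obj j
  map_id : ∀ i, map i i le_rfl = C.one (obj i)
  map_comp : ∀ i j k (h : i ≤ j) (h' : j ≤ k),
    map i k (h.trans h') = C.comp (map i j h) (map j k h') (by rw [tgt_map, src_map])

namespace NerveSimplex

variable {C D : CGHCategory.{u}} {m n : ℕ}

/-- The objects and the arrows of a simplex, as a point of a product of copies of `C₀` and `C₁`. -/
def coords (x : NerveSimplex C n) :
    (Fin (n + 1) → C.Ob) × ({p : Fin (n + 1) × Fin (n + 1) // p.1 ≤ p.2} → C.Mor) :=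
  (x.obj, fun p => x.map p.1.1 p.1.2 p.2)

theorem coords_injective : Function.Injective (coords : NerveSimplex C n → _) := fun _ _ h =>
  NerveSimplex.ext (congrArg Prod.fst h)
    (funext fun i => funext fun j => funext fun hij => congrFun (congrArg Prod.snd h) ⟨(i, j), hij⟩)

/-- The subspace topology of the product of the spaces of objects and of arrows. -/
@[reducible]
def subspaceTopology (C : CGHCategory.{u}) (n : ℕ) : TopologicalSpace (NerveSimplex C n) :=
  TopologicalSpace.induced coords inferInstance

/-- The space of `n`-simplices as a limit in `CGH`. As composition is continuous this is the
`n`-fold fibre product `C₁ ×_{C₀} ⋯ ×_{C₀} C₁` (and `C₀` if `n = 0`) in `CGH`. -/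
noncomputable instance : TopologicalSpace (NerveSimplex C n) := kTopology (subspaceTopology C n)

theorem subspaceTopology_t2 : @T2Space (NerveSimplex C n) (subspaceTopology C n) :=
  letI := subspaceTopology C n
  T2Space.of_injective_continuous coords_injective continuous_induced_dom

instance : T2Space (NerveSimplex C n) :=
  @kTopology_t2 _ (subspaceTopology C n) subspaceTopology_t2

instance : CompactlyGeneratedSpace (NerveSimplex C n) :=
  @kTopology_cg _ (subspaceTopology C n) subspaceTopology_t2

theorem continuous_coords : Continuous (coords : NerveSimplex C n → _) :=
  continuous_le_dom (kTopology_le (subspaceTopology C n)) continuous_induced_dom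

theorem continuous_obj (i : Fin (n + 1)) : Continuous (fun x : NerveSimplex C n => x.obj i) :=
  (continuous_apply i).comp (continuous_fst.comp continuous_coords)

theorem continuous_map (i j : Fin (n + 1)) (h : i ≤ j) :
    Continuous (fun x : NerveSimplex C n => x.map i j h) :=
  (continuous_apply (⟨(i, j), h⟩ : {p : Fin (n + 1) × Fin (n + 1) // p.1 ≤ p.2})).comp
    (continuous_snd.comp continuous_coords)

theorem continuous_mk {Z : Type u} [TopologicalSpace Z] [T2Space Z] [CompactlyGeneratedSpace Z]
    {g : Z → NerveSimplex C n} (ho : ∀ i, Continuous fun z => (g z).obj i)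
    (hm : ∀ i j h, Continuous fun z => (g z).map i j h) : Continuous g :=
  continuous_kTopology (subspaceTopology C n) <| continuous_induced_rng.2 <|
    (continuous_pi ho).prodMk (continuous_pi fun p => hm p.1.1 p.1.2 p.2)

/-- Precomposition of a simplex with a monotone map. -/
def restrict (θ : Fin (m + 1) →o Fin (n + 1)) (x : NerveSimplex C n) : NerveSimplex C m where
  obj i := x.obj (θ i)
  map i j h := x.map (θ i) (θ j) (θ.monotone h)
  src_map _ _ _ := x.src_map _ _ _
  tgt_map _ _ _ := x.tgt_map _ _ _
  map_id _ := x.map_id _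
  map_comp _ _ _ _ _ := x.map_comp _ _ _ _ _

theorem continuous_restrict (θ : Fin (m + 1) →o Fin (n + 1)) :
    Continuous (restrict θ : NerveSimplex C n → NerveSimplex C m) :=
  continuous_mk (fun i => continuous_obj (θ i))
    (fun i j h => continuous_map (θ i) (θ j) (θ.monotone h))

/-- The image of a simplex under a functor. -/
def push (f : CGHFunctor C D) (x : NerveSimplex C n) : NerveSimplex D n where
  obj i := f.ob (x.obj i)
  map i j h := f.mor (x.map i j h)
  src_map i j h := by rw [f.src_mor, x.src_map]
  tgt_map i j h := by rw [f.tgt_mor, x.tgt_map]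
  map_id i := by rw [x.map_id, f.mor_one]
  map_comp i j k h h' :=
    (congrArg f.mor (x.map_comp i j k h h')).trans (f.mor_comp _ _ _)

theorem continuous_push (f : CGHFunctor C D) :
    Continuous (push f : NerveSimplex C n → NerveSimplex D n) :=
  continuous_mk (fun i => f.continuous_ob.comp (continuous_obj i))
    (fun i j h => f.continuous_mor.comp (continuous_map i j h))

end NerveSimplex

/-- The nerve of a topological category, a simplicial space. -/
noncomputable def nerveSpace (C : CGHCategory.{u}) : SimplicialObject TopCat.{u} where
  obj n := TopCat.of (NerveSimplex C n.unop.len)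
  map θ := TopCat.ofHom ⟨NerveSimplex.restrict θ.unop.toOrderHom,
    NerveSimplex.continuous_restrict _⟩
  map_id _ := rfl
  map_comp _ _ := rfl

/-- The map of nerves induced by a functor. -/
noncomputable def nerveSpaceMap {C D : CGHCategory.{u}} (f : CGHFunctor C D) : nerveSpace C ⟶ nerveSpace D where
  app n := TopCat.ofHom ⟨NerveSimplex.push f, NerveSimplex.continuous_push f⟩
  naturality _ _ _ := rfl

/-! ### Geometric realisation of simplicial spaces -/

/-- The disjoint union of the products `Mₙ × Δⁿ`. -/
abbrev PreRealization (M : SimplicialObject TopCat.{u}) : Type u :=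
  Σ n : ℕ, M.obj (Opposite.op (SimplexCategory.mk n)) × stdSimplex ℝ (Fin (n + 1))

/-- The relation `(θ^* x, t) ∼ (x, θ_* t)` for `θ : [m] → [n]`. -/
inductive RealizationRel (M : SimplicialObject TopCat.{u}) :
    PreRealization M → PreRealization M → Prop
  | glue {m n : ℕ} (θ : SimplexCategory.mk m ⟶ SimplexCategory.mk n)
      (x : M.obj (Opposite.op (SimplexCategory.mk n))) (t : stdSimplex ℝ (Fin (m + 1))) :
      RealizationRel M ⟨m, M.map θ.op x, t⟩ ⟨n, x, stdSimplex.map θ.toOrderHom t⟩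

/-- The geometric realisation of a simplicial space, with the quotient topology (for a simplicial
object in `CGH` this is the realisation in `CGH`, since `Δⁿ` is compact Hausdorff). -/
def Realization (M : SimplicialObject TopCat.{u}) : Type u := Quot (RealizationRel M)

instance (M : SimplicialObject TopCat.{u}) : TopologicalSpace (Realization M) :=
  inferInstanceAs (TopologicalSpace (Quot (RealizationRel M)))

/-- The geometric realisation of a map of simplicial spaces. -/
def Realization.map {M N : SimplicialObject TopCat.{u}} (φ : M ⟶ N) :
    C(Realization M, Realization N) where
  toFun := Quot.map (fun x => ⟨x.1, φ.app _ x.2.1, x.2.2⟩) (by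
    rintro _ _ ⟨θ, x, t⟩
    have h : φ.app _ (M.map θ.op x) = N.map θ.op (φ.app _ x) :=
      ConcreteCategory.congr_hom (φ.naturality θ.op) x
    dsimp only
    rw [h]
    exact .glue θ _ t)
  continuous_toFun := continuous_quot_lift _ (continuous_quot_mk.comp
    (continuous_sigma fun n => continuous_sigmaMk.comp
      (((φ.app _).hom.continuous.comp continuous_fst).prodMk continuous_snd)))

/-- The classifying space `BC = |NC|` of a topological category. -/
abbrev ClassifyingSpace (C : CGHCategory.{u}) : Type u := Realization (nerveSpace C)

/-- The map `Bf : BX → BY` induced by a functor. -/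
noncomputable def classifyingMap {X Y : CGHCategory.{u}} (f : CGHFunctor X Y) :
    C(ClassifyingSpace X, ClassifyingSpace Y) :=
  Realization.map (nerveSpaceMap f)

/-! ### The discrete category on a space -/

/-- The topological category `disc(S)` with space of objects `S` and only identity arrows. -/
noncomputable def discCat (S : Type u) [TopologicalSpace S] [T2Space S] [CompactlyGeneratedSpace S] :
    CGHCategory.{u} where
  Ob := S
  Mor := S
  src := id
  tgt := id
  one := id
  comp g _ _ := g
  continuous_src := continuous_id
  continuous_tgt := continuous_id
  continuous_one := continuous_id
  continuous_comp := FibProd.continuous_fst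
  src_one _ := rfl
  tgt_one _ := rfl
  src_comp _ _ _ := rfl
  tgt_comp _ _ w := w
  one_comp _ := rfl
  comp_one _ := rfl
  assoc _ _ _ _ _ := rfl

section Disc

variable (S : Type u) [TopologicalSpace S] [T2Space S] [CompactlyGeneratedSpace S]

theorem NerveSimplex.disc_obj {S : Type u} [TopologicalSpace S] [T2Space S]
    [CompactlyGeneratedSpace S] {n : ℕ} (x : NerveSimplex (discCat S) n) (i : Fin (n + 1)) :
    x.obj i = x.obj 0 :=
  (x.tgt_map 0 i (Fin.zero_le i)).symm.trans (x.src_map 0 i (Fin.zero_le i))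

/-- The degenerate simplex on a point of `S`. -/
def NerveSimplex.discConst (n : ℕ) (s : S) : NerveSimplex (discCat S) n where
  obj _ := s
  map _ _ _ := s
  src_map _ _ _ := rfl
  tgt_map _ _ _ := rfl
  map_id _ := rfl
  map_comp _ _ _ _ _ := rfl

/-- The canonical identification `B disc(S) = S`. -/
noncomputable def classifyingDisc : ClassifyingSpace (discCat S) ≃ₜ S where
  toFun := Quot.lift (fun x => NerveSimplex.obj x.2.1 0) (by
    rintro _ _ ⟨θ, x, t⟩
    exact NerveSimplex.disc_obj x _)
  invFun s := Quot.mk _ ⟨0, NerveSimplex.discConst S 0 s, default⟩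
  left_inv := by
    rintro ⟨n, x, t⟩
    have h := RealizationRel.glue (M := nerveSpace (discCat S))
      (SimplexCategory.mkHom (⟨fun _ => 0, fun _ _ _ => le_rfl⟩ : Fin (n + 1) →o Fin (0 + 1)))
      (NerveSimplex.discConst S 0 (NerveSimplex.obj x 0)) t
    have hx : x = NerveSimplex.discConst S n (NerveSimplex.obj x 0) := by
      refine NerveSimplex.ext (funext fun i => NerveSimplex.disc_obj x i) ?_
      funext i j h
      exact (NerveSimplex.src_map x i j h).trans (NerveSimplex.disc_obj x i)
    have ht : ∀ t : stdSimplex ℝ (Fin (0 + 1)), t = default := fun t => Subsingleton.elim _ _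
    rw [ht (stdSimplex.map _ t)] at h
    refine (Quot.sound h).symm.trans ?_
    conv_rhs => rw [hx]
    rfl
  right_inv _ := rfl
  continuous_toFun := continuous_quot_lift _ (continuous_sigma fun n =>
    (NerveSimplex.continuous_obj (C := discCat S) (n := n) 0).comp continuous_fst)
  continuous_invFun := by
    have h : Continuous (NerveSimplex.discConst S 0) :=
      NerveSimplex.continuous_mk (fun _ => continuous_id) (fun _ _ _ => continuous_id)
    exact continuous_quot_mk.comp (continuous_sigmaMk.comp (h.prodMk continuous_const))

end Disc

/-! ### The category `Y₀ ↓ f` -/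

section Slice

variable {X Y : CGHCategory.{u}} (f : CGHFunctor X Y)

/-- The objects of `Y₀ ↓ f`: pairs `(η : a → f b, b)`, i.e. the space `Y₁ ×_{Y₀} X₀`. -/
abbrev SliceOb : Type u := FibProd Y.tgt f.ob

/-- The arrows of `Y₀ ↓ f`: pairs `(η : a → f b, h : b → b')`, i.e. the space `Y₁ ×_{Y₀} X₁`. Such a
pair stands for the commuting triangle with sides `η`, `f h` and `η' = f h ∘ η`, together with `h`;
it is an arrow from `(η, b)` to `(η', b')`. -/
abbrev SliceMor : Type u := FibProd Y.tgt (fun h : X.Mor => f.ob (X.src h))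

/-- The composite `f h ∘ η`. -/
def sliceAct (x : SliceMor f) : Y.Mor :=
  Y.comp x.fst (f.mor x.snd) (x.w.trans (f.src_mor x.snd).symm)

theorem continuous_sliceAct : Continuous (sliceAct f) :=
  Y.continuous_comp.comp (FibProd.continuous_lift (p := Y.tgt) (q := Y.src)
    FibProd.continuous_fst (f.continuous_mor.comp FibProd.continuous_snd)
    (fun x : SliceMor f => x.w.trans (f.src_mor x.snd).symm))

/-- The source `(η, b)` of an arrow. -/
def sliceSrc (x : SliceMor f) : SliceOb f := ⟨x.fst, X.src x.snd, x.w⟩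

/-- The target `(f h ∘ η, b')` of an arrow. -/
def sliceTgt (x : SliceMor f) : SliceOb f :=
  ⟨sliceAct f x, X.tgt x.snd, (Y.tgt_comp _ _ _).trans (f.tgt_mor _)⟩

/-- Arrows of `Y₀ ↓ f` compose as in `X`. -/
def sliceComp (x y : SliceMor f) (w : sliceTgt f x = sliceSrc f y) : SliceMor f :=
  ⟨x.fst, X.comp x.snd y.snd (congrArg FibProd.snd w),
    x.w.trans (congrArg f.ob (X.src_comp _ _ _).symm)⟩

theorem CGHCategory.comp_congr (C : CGHCategory.{u}) {g g' h h' : C.Mor} (hg : g = g')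
    (hh : h = h') (w : C.tgt g = C.src h) (w' : C.tgt g' = C.src h') :
    C.comp g h w = C.comp g' h' w' := by
  subst hg hh; rfl

theorem CGHCategory.comp_one' (C : CGHCategory.{u}) (g : C.Mor) (a : C.Ob)
    (w : C.tgt g = C.src (C.one a)) : C.comp g (C.one a) w = g := by
  have h : C.tgt g = a := w.trans (C.src_one a)
  subst h; exact C.comp_one g

theorem CGHCategory.one_comp' (C : CGHCategory.{u}) (g : C.Mor) (a : C.Ob)
    (w : C.tgt (C.one a) = C.src g) : C.comp (C.one a) g w = g := by
  have h : a = C.src g := (C.tgt_one a).symm.trans w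
  subst h; exact C.one_comp g

/-- The topological category `Y₀ ↓ f`. -/
noncomputable def sliceCat : CGHCategory.{u} where
  Ob := SliceOb f
  Mor := SliceMor f
  src := sliceSrc f
  tgt := sliceTgt f
  one x := ⟨x.fst, X.one x.snd, x.w.trans (congrArg f.ob (X.src_one _).symm)⟩
  comp := sliceComp f
  continuous_src := FibProd.continuous_lift FibProd.continuous_fst
    (X.continuous_src.comp FibProd.continuous_snd) _
  continuous_tgt := FibProd.continuous_lift (continuous_sliceAct f)
    (X.continuous_tgt.comp FibProd.continuous_snd) _
  continuous_one := FibProd.continuous_lift FibProd.continuous_fst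
    (X.continuous_one.comp FibProd.continuous_snd) _
  continuous_comp := FibProd.continuous_lift
    (FibProd.continuous_fst.comp FibProd.continuous_fst)
    (X.continuous_comp.comp (FibProd.continuous_lift (p := X.tgt) (q := X.src)
      (FibProd.continuous_snd.comp FibProd.continuous_fst)
      (FibProd.continuous_snd.comp FibProd.continuous_snd)
      (fun x : FibProd (sliceTgt f) (sliceSrc f) => congrArg FibProd.snd x.w))) _
  src_one x := FibProd.ext rfl (X.src_one _)
  tgt_one x := FibProd.ext
    ((Y.comp_congr rfl (f.mor_one _) _ (x.w.trans (Y.src_one _).symm)).trans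
      (Y.comp_one' _ _ _)) (X.tgt_one _)
  src_comp x y w := FibProd.ext rfl (X.src_comp _ _ _)
  tgt_comp x y w := by
    refine FibProd.ext ?_ (X.tgt_comp _ _ _)
    have h1 : Y.tgt (f.mor x.snd) = Y.src (f.mor y.snd) := by
      rw [f.tgt_mor, f.src_mor]; exact congrArg f.ob (congrArg FibProd.snd w)
    have h2 : sliceAct f x = y.fst := congrArg FibProd.fst w
    have h3 : Y.tgt x.fst = Y.src (f.mor x.snd) := x.w.trans (f.src_mor x.snd).symm
    refine (Y.comp_congr rfl (f.mor_comp _ _ _) _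
      (h3.trans (Y.src_comp _ _ h1).symm)).trans ?_
    exact (Y.assoc _ _ _ h3 h1).symm.trans (Y.comp_congr h2 rfl _ _)
  one_comp _ := FibProd.ext rfl (X.one_comp' _ _ _)
  comp_one _ := FibProd.ext rfl (X.comp_one' _ _ _)
  assoc x y z w w' := FibProd.ext rfl (X.assoc _ _ _ _ _)

/-- The canonical functor `ρ : Y₀ ↓ f → disc(Y₀)`, which sends `η : a → f b` to `a`. -/
noncomputable def sliceProj : CGHFunctor (sliceCat f) (discCat Y.Ob) where
  ob x := Y.src x.fst
  mor x := Y.src x.fst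
  continuous_ob := Y.continuous_src.comp FibProd.continuous_fst
  continuous_mor := Y.continuous_src.comp FibProd.continuous_fst
  src_mor _ := rfl
  tgt_mor x := (Y.src_comp _ _ _).symm
  mor_one _ := rfl
  mor_comp _ _ _ := rfl

/-- The map `Bρ : B(Y₀ ↓ f) → B disc(Y₀) = Y₀`. -/
noncomputable def sliceProjMap : C(ClassifyingSpace (sliceCat f), Y.Ob) :=
  (classifyingDisc Y.Ob : C(ClassifyingSpace (discCat Y.Ob), Y.Ob)).comp
    (classifyingMap (sliceProj f))

end Slice

/-! ### Shrinkable maps and homotopy equivalences -/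

/-- A map `p : E → B` is shrinkable if it has a section `s` such that `s ∘ p` is fibrewise homotopic
to the identity of `E`. -/
def Shrinkable {E B : Type u} [TopologicalSpace E] [TopologicalSpace B] (p : C(E, B)) : Prop :=
  ∃ s : C(B, E), p.comp s = ContinuousMap.id B ∧
    ∃ H : ContinuousMap.Homotopy (s.comp p) (ContinuousMap.id E), ∀ t x, p (H (t, x)) = p x

/-- A map is a homotopy equivalence if it underlies one in Mathlib's sense. -/
def IsHomotopyEquivalence {E B : Type u} [TopologicalSpace E] [TopologicalSpace B]
    (g : C(E, B)) : Prop :=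
  ∃ e : ContinuousMap.HomotopyEquiv E B, e.toFun = g

/-!
The idea of the proof. Write `E = B(Y₀ ↓ f)`, a space over `Y₀`, and let `Y` act on `E` by
precomposition. For a simplex `y₀ → ⋯ → y_p` of `Y` with barycentric coordinates `t`, a point `e`
of the fibre of `E` over `y_p`, and a height `w ∈ [0, 1]` in the cone on this fibre, consider the
tuple `(y, e, w, t)`, a `JoinPt`. Sending it to the point `(w t, (1 - w) r)` of the join of `y`
with the simplex of `X` that carries `e` defines a family of maps to `BY` (`joinFamily`), which
is compatible with the simplicial identities and restricts to `BY` itself on the cone points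
`w = 1`, and to the map `E → BX → BY` on the bases `w = 0` of the cones.

As the fibres of `E` are contractible, uniformly over `Y₀`, maps defined on the bases of the
cones extend. By induction on `p`, the projection `E → BX` extends to a compatible family
`retractFamily` with values in `BX`: a join point is pushed (`JoinPt.move`) until it lies in a
base, on a face, or in a degenerate simplex of `Y`, where the value is already known. It is here
that `Y` has to be well-pointed: nearly degenerate simplices are deformed into degenerate ones,
by moving their arrows to identities. The same construction, with a parameter, deforms
`joinFamily` into the image of `retractFamily` under `Bf` (`interpolate`), by a homotopy which
takes longer and longer as `p` grows, but is constant at the beginning for each `p`.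

The restriction of `retractFamily` to the cone points is a map `g : BY → BX` (`homotopyInverse`),
and the restriction of `interpolate` shows that `Bf ∘ g` is homotopic to the identity. For
`g ∘ Bf`, split the coordinates `c` of a point of a simplex `b` of `X` as `c = w t + (1 - w) r`, where
the support of `t` precedes that of `r`. The value of `retractFamily` at the join point given by
the image of `(b, t)` under `f`, by the point `(b, r)` of `E`, and by `w`, is `g (Bf (b, c))` for
`w = 1` and `(b, c)` itself for `w = 0`, and compatibility shows that it depends only on `(b, c)`
and `w`.

Continuity of functions of join points is tested on families parametrized by compact Hausdorff
spaces, so that no topology on the iterated fibre products and cones is needed.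
-/

/-! ### Testing continuity on compact Hausdorff spaces -/

/-- A subset of the product of a compactly generated space with a compact Hausdorff space is closed
as soon as its preimages in all compact Hausdorff test spaces are. -/
theorem isClosed_prod_of_forall_compact {X L : Type u} [TopologicalSpace X]
    [CompactlyGeneratedSpace X] [TopologicalSpace L] [CompactSpace L] [T2Space L] {s : Set (X × L)}
    (h : ∀ (K : Type u) [TopologicalSpace K] [CompactSpace K] [T2Space K] (x : K → X) (l : K → L),
      Continuous x → Continuous l → IsClosed {k | (x k, l k) ∈ s}) : IsClosed s := by
  -- closed sets are encoded as continuous maps to the Sierpinski space `Prop`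
  have key : ∀ (K : Type u) [TopologicalSpace K] [CompactSpace K] [T2Space K] (x : K → X)
      (l : K → L), Continuous x → Continuous l → Continuous fun k => (x k, l k) ∉ s := by
    intro K _ _ _ x l hx hl
    exact continuous_Prop.2 (h K x l hx hl).isOpen_compl
  let G : X → C(L, Prop) := fun x =>
    ⟨fun l => (x, l) ∉ s, key L (fun _ => x) id continuous_const continuous_id⟩
  have hG : Continuous G := by
    refine continuous_from_compactlyGeneratedSpace G fun K _ _ _ x hx => ?_
    exact (ContinuousMap.curry ⟨fun p : K × L => (x p.1, p.2) ∉ s,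
      key (K × L) (fun p => x p.1) (fun p => p.2) (hx.comp continuous_fst) continuous_snd⟩).continuous
  have := ContinuousMap.continuous_uncurry_of_continuous ⟨G, hG⟩
  exact ⟨continuous_Prop.1 this⟩

/-- A map out of the product of a compactly generated space with a compact Hausdorff space is
continuous if all its composites with compact Hausdorff test spaces are. -/
theorem continuous_prod_of_forall_compact {X : Type u} {L : Type} {Z : Type*} [TopologicalSpace X]
    [CompactlyGeneratedSpace X] [TopologicalSpace L] [CompactSpace L] [T2Space L]
    [TopologicalSpace Z] {f : X × L → Z}
    (h : ∀ (K : Type u) [TopologicalSpace K] [CompactSpace K] [T2Space K] (x : K → X) (l : K → L),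
      Continuous x → Continuous l → Continuous fun k => f (x k, l k)) : Continuous f := by
  have h' : Continuous fun p : X × ULift.{u} L => f (p.1, p.2.down) := by
    refine continuous_iff_isClosed.2 fun s hs => isClosed_prod_of_forall_compact ?_
    intro K _ _ _ x l hx hl
    exact hs.preimage (h K x (fun k => (l k).down) hx (continuous_uliftDown.comp hl))
  exact h'.comp (continuous_fst.prodMk (continuous_uliftUp.comp continuous_snd))

/-- Pulling back a realization along a map `a : K → B` from a compact Hausdorff space commutes with
the formation of the quotient: a function on the fibre product `K ×_B |M|` is continuous along a
section `e` if it is continuous on all compact Hausdorff families of representatives. -/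
theorem continuous_comp_realization {M : SimplicialObject TopCat.{u}}
    [∀ n, CompactlyGeneratedSpace (M.obj n)] {B K : Type u} {Z : Type*} [TopologicalSpace B]
    [T2Space B] [TopologicalSpace K] [CompactSpace K] [T2Space K] [TopologicalSpace Z]
    {p : Realization M → B} (hp : Continuous p) (F : K → Realization M → Z)
    {a : K → B} (ha : Continuous a) {e : K → Realization M} (he : Continuous e)
    (hae : ∀ k, p (e k) = a k)
    (hF : ∀ (n : ℕ) (L : Type u) [TopologicalSpace L] [CompactSpace L] [T2Space L] (k : L → K)
      (x : L → M.obj (Opposite.op (SimplexCategory.mk n)))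
      (r : L → stdSimplex ℝ (Fin (n + 1))),
      Continuous k → Continuous x → Continuous r →
      (∀ l, p (Quot.mk _ ⟨n, x l, r l⟩) = a (k l)) →
      Continuous fun l => F (k l) (Quot.mk _ ⟨n, x l, r l⟩)) :
    Continuous fun k => F k (e k) := by
  refine continuous_iff_isClosed.2 fun V hV => ?_
  let S : Set (K × Realization M) := {q | p q.2 = a q.1 ∧ F q.1 q.2 ∈ V}
  suffices hS : IsClosed S by
    have := hS.preimage (continuous_id.prodMk he)
    convert this using 1
    ext k
    simp [S, hae]
  have hq : Topology.IsQuotientMap (Quot.mk (RealizationRel M)) := isQuotientMap_quot_mk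
  have hc : Continuous fun q : K × Realization M => q ∉ S := by
    refine hq.continuous_lift_prod_right (g := fun q : K × Realization M => q ∉ S) ?_
    have hcl : ∀ n, IsClosed {q : M.obj (Opposite.op (SimplexCategory.mk n)) ×
        (K × ULift.{u} (stdSimplex ℝ (Fin (n + 1)))) |
          ((q.2.1, Quot.mk _ ⟨n, q.1, q.2.2.down⟩) : K × Realization M) ∈ S} := by
      intro n
      refine isClosed_prod_of_forall_compact fun L _ _ _ x l hx hl => ?_
      have hk : Continuous fun l' => (l l').1 := continuous_fst.comp hl
      have hr : Continuous fun l' => (l l').2.down :=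
        continuous_uliftDown.comp (continuous_snd.comp hl)
      have hm : Continuous fun l' =>
          (Quot.mk _ ⟨n, x l', (l l').2.down⟩ : Realization M) :=
        continuous_quot_mk.comp (continuous_sigmaMk.comp (hx.prodMk hr))
      have hD : IsClosed {l' | p (Quot.mk _ ⟨n, x l', (l l').2.down⟩) = a (l l').1} :=
        isClosed_eq (hp.comp hm) (ha.comp hk)
      have := hD.isClosedEmbedding_subtypeVal.compactSpace
      have := hF n {l' | p (Quot.mk _ ⟨n, x l', (l l').2.down⟩) = a (l l').1}
        (fun l' => (l l').1) (fun l' => x l') (fun l' => (l l').2.down)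
        (hk.comp continuous_subtype_val) (hx.comp continuous_subtype_val)
        (hr.comp continuous_subtype_val) (fun l' => l'.2)
      convert hD.isClosedMap_subtype_val _ (hV.preimage this) using 1
      ext l'
      simp [S, and_comm]
    -- distribute the product over the disjoint union of the simplex levels
    have hσ : ∀ n, Continuous fun q : M.obj (Opposite.op (SimplexCategory.mk n)) ×
        (K × ULift.{u} (stdSimplex ℝ (Fin (n + 1)))) =>
          ((q.2.1, Quot.mk _ ⟨n, q.1, q.2.2.down⟩) : K × Realization M) ∉ S :=
      fun n => continuous_Prop.2 (hcl n).isOpen_compl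
    rw [← (Homeomorph.sigmaProdDistrib.symm.trans (Homeomorph.prodComm _ _)).comp_continuous_iff']
    refine continuous_sigma fun n => ?_
    exact (hσ n).comp ((continuous_fst.comp continuous_fst).prodMk (continuous_snd.prodMk
      (continuous_uliftUp.comp (continuous_snd.comp continuous_fst))))
  exact ⟨continuous_Prop.1 hc⟩

/-- If `F (x, ·)` is constant wherever `ρ` fails to be continuous, then `F (x, ρ x)` depends
continuously on `x`. -/
theorem continuous_of_eq_const {X I Z : Type*} [TopologicalSpace X] [TopologicalSpace I]
    [CompactSpace I] [TopologicalSpace Z] {F : X × I → Z} (hF : Continuous F) {ρ : X → I}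
    (h : ∀ x, ContinuousAt ρ x ∨ ∀ r r', F (x, r) = F (x, r')) :
    Continuous fun x => F (x, ρ x) := by
  refine continuous_iff_continuousAt.2 fun x => ?_
  rcases h x with h | h
  · exact hF.continuousAt.comp (continuousAt_id.prodMk h)
  · intro V hV
    obtain ⟨U, hUV, hU, hxU⟩ := mem_nhds_iff.1 hV
    obtain ⟨A, B, hA, -, hxA, hB, hAB⟩ := generalized_tube_lemma (isCompact_singleton (x := x))
      (isCompact_univ (X := I)) (hU.preimage hF) (by
        rintro ⟨y, r⟩ ⟨rfl, -⟩
        simpa only [Set.mem_preimage, h r (ρ y)] using hxU)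
    refine Filter.mem_map.2 (Filter.mem_of_superset (hA.mem_nhds (hxA rfl)) fun y hy => hUV ?_)
    exact hAB ⟨hy, hB trivial⟩

/-! ### Points of classifying spaces and functions on them -/

section ClassifyingPoints

variable {m n : ℕ}

/-- The point of a classifying space given by a simplex and barycentric coordinates. -/
def classPt {C : CGHCategory.{u}} (x : NerveSimplex C n) (r : stdSimplex ℝ (Fin (n + 1))) :
    ClassifyingSpace C :=
  Quot.mk _ ⟨n, x, r⟩

theorem classPt_restrict {C : CGHCategory.{u}} (χ : Fin (m + 1) →o Fin (n + 1))
    (x : NerveSimplex C n) (r : stdSimplex ℝ (Fin (m + 1))) :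
    classPt (x.restrict χ) r = classPt x (stdSimplex.map χ r) :=
  Quot.sound (RealizationRel.glue (M := nerveSpace C) (SimplexCategory.mkHom χ) x r)

theorem exists_eq_classPt {C : CGHCategory.{u}} (e : ClassifyingSpace C) :
    ∃ (n : ℕ) (x : NerveSimplex C n) (r : stdSimplex ℝ (Fin (n + 1))), e = classPt x r := by
  obtain ⟨⟨n, x, r⟩, rfl⟩ := Quot.exists_rep e
  exact ⟨n, x, r, rfl⟩

theorem continuous_classPt {C : CGHCategory.{u}} :
    Continuous fun q : NerveSimplex C n × stdSimplex ℝ (Fin (n + 1)) => classPt q.1 q.2 :=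
  continuous_quot_mk.comp (continuous_sigmaMk (σ := fun n : ℕ =>
    (nerveSpace C).obj (Opposite.op (SimplexCategory.mk n)) × stdSimplex ℝ (Fin (n + 1))))

/-- A function on a classifying space, from compatible functions of simplices and barycentric
coordinates. -/
def classLift {C : CGHCategory.{u}} {Z : Type*}
    (φ : ∀ n, NerveSimplex C n → stdSimplex ℝ (Fin (n + 1)) → Z)
    (h : ∀ (m n : ℕ) (θ : Fin (m + 1) →o Fin (n + 1)) (x : NerveSimplex C n)
      (t : stdSimplex ℝ (Fin (m + 1))), φ m (x.restrict θ) t = φ n x (stdSimplex.map θ t)) :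
    ClassifyingSpace C → Z :=
  Quot.lift (fun a => φ a.1 a.2.1 a.2.2) (by
    rintro _ _ ⟨θ, x, t⟩
    exact h _ _ θ.toOrderHom x t)

theorem continuous_of_comp_classPt {C : CGHCategory.{u}} {Z : Type*} [TopologicalSpace Z]
    {g : ClassifyingSpace C → Z}
    (h : ∀ n, Continuous fun q : NerveSimplex C n × stdSimplex ℝ (Fin (n + 1)) =>
      g (classPt q.1 q.2)) : Continuous g :=
  isQuotientMap_quot_mk.continuous_iff.2 (continuous_sigma h)

instance (C : CGHCategory.{u}) (n : SimplexCategoryᵒᵖ) :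
    CompactlyGeneratedSpace ((nerveSpace C).obj n) :=
  inferInstanceAs (CompactlyGeneratedSpace (NerveSimplex C n.unop.len))

/-- `continuous_comp_realization` for classifying spaces. -/
theorem continuous_comp_classifyingSpace {C : CGHCategory.{u}} {B K : Type u} {Z : Type*}
    [TopologicalSpace B] [T2Space B] [TopologicalSpace K] [CompactSpace K] [T2Space K]
    [TopologicalSpace Z] (p : C(ClassifyingSpace C, B)) (F : K → ClassifyingSpace C → Z)
    {a : K → B} (ha : Continuous a) {e : K → ClassifyingSpace C} (he : Continuous e)
    (hae : ∀ k, p (e k) = a k)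
    (hF : ∀ (n : ℕ) (L : Type u) [TopologicalSpace L] [CompactSpace L] [T2Space L] (k : L → K)
      (x : L → NerveSimplex C n) (r : L → stdSimplex ℝ (Fin (n + 1))),
      Continuous k → Continuous x → Continuous r → (∀ l, p (classPt (x l) (r l)) = a (k l)) →
      Continuous fun l => F (k l) (classPt (x l) (r l))) :
    Continuous fun k => F k (e k) :=
  continuous_comp_realization (map_continuous p) F ha he hae
    fun n L _ _ _ k x r hk hx hr hp => hF n L k x r hk hx hr hp

end ClassifyingPoints

/-! ### The classifying space of the slice category and the action of `Y` on it -/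

section SliceSimplices

variable {X Y : CGHCategory.{u}} (f : CGHFunctor X Y) {m n : ℕ}

/-- The functor `Y₀ ↓ f → X` that forgets the arrow `η : a → f b`. -/
noncomputable def sliceForget : CGHFunctor (sliceCat f) X where
  ob x := FibProd.snd (p := Y.tgt) (q := f.ob) x
  mor x := FibProd.snd (p := Y.tgt) (q := fun h : X.Mor => f.ob (X.src h)) x
  continuous_ob := FibProd.continuous_snd
  continuous_mor := FibProd.continuous_snd
  src_mor _ := rfl
  tgt_mor _ := rfl
  mor_one _ := rfl
  mor_comp _ _ _ := rfl

/-- The simplex `η, f(b₀₁) ∘ η, …` of `Y₀ ↓ f` determined by a simplex `b` of `X` and an arrow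
`η : a → f b₀`. -/
noncomputable def sliceSimplex (η : Y.Mor) (b : NerveSimplex X n) (h : Y.tgt η = f.ob (b.obj 0)) :
    NerveSimplex (sliceCat f) n where
  obj i := (⟨Y.comp η (f.mor (b.map 0 i (Fin.zero_le i))) (by rw [h, f.src_mor, b.src_map]),
    b.obj i, by rw [Y.tgt_comp, f.tgt_mor, b.tgt_map]⟩ : SliceOb f)
  map i j hij := (⟨Y.comp η (f.mor (b.map 0 i (Fin.zero_le i))) (by rw [h, f.src_mor, b.src_map]),
    b.map i j hij, (Y.tgt_comp _ _ _).trans ((f.tgt_mor _).trans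
      (congrArg f.ob ((b.tgt_map 0 i _).trans (b.src_map i j hij).symm)))⟩ : SliceMor f)
  src_map i j hij := FibProd.ext rfl (b.src_map i j hij)
  tgt_map i j hij := by
    refine FibProd.ext ?_ (b.tgt_map i j hij)
    have w : Y.tgt (f.mor (b.map 0 i (Fin.zero_le i))) = Y.src (f.mor (b.map i j hij)) := by
      rw [f.src_mor, f.tgt_mor, b.src_map, b.tgt_map]
    refine (Y.assoc _ _ _ _ w).trans ?_
    exact Y.comp_congr rfl ((congrArg f.mor (b.map_comp 0 i j _ _)).trans
      (f.mor_comp _ _ _)).symm _ _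
  map_id i := FibProd.ext rfl (b.map_id i)
  map_comp i j k hij hjk := FibProd.ext rfl (b.map_comp i j k hij hjk)

/-- The arrow `η : a → f b₀` of a simplex of `Y₀ ↓ f`. -/
def sliceHead (x : NerveSimplex (sliceCat f) n) : Y.Mor :=
  FibProd.fst (p := Y.tgt) (q := f.ob) (x.obj 0)

theorem tgt_sliceHead (x : NerveSimplex (sliceCat f) n) :
    Y.tgt (sliceHead f x) = f.ob ((x.push (sliceForget f)).obj 0) :=
  FibProd.w (p := Y.tgt) (q := f.ob) (x.obj 0)

theorem slice_fst_eq (x : NerveSimplex (sliceCat f) n) (i : Fin (n + 1)) :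
    FibProd.fst (p := Y.tgt) (q := f.ob) (x.obj i) =
      Y.comp (sliceHead f x) (f.mor ((x.push (sliceForget f)).map 0 i (Fin.zero_le i)))
        (by rw [tgt_sliceHead, f.src_mor, NerveSimplex.src_map]) := by
  have h1 := congrArg (FibProd.fst (p := Y.tgt) (q := f.ob)) (x.tgt_map 0 i (Fin.zero_le i))
  have h2 := congrArg (FibProd.fst (p := Y.tgt) (q := f.ob)) (x.src_map 0 i (Fin.zero_le i))
  exact h1.symm.trans (Y.comp_congr h2 rfl _ _)

/-- A simplex of `Y₀ ↓ f` is determined by its first arrow and its image in `X`. -/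
theorem sliceSimplex_head (x : NerveSimplex (sliceCat f) n) :
    sliceSimplex f (sliceHead f x) (x.push (sliceForget f)) (tgt_sliceHead f x) = x := by
  refine NerveSimplex.ext (funext fun i => FibProd.ext (slice_fst_eq f x i).symm rfl) ?_
  funext i j hij
  refine FibProd.ext ((slice_fst_eq f x i).symm.trans ?_) rfl
  exact (congrArg (FibProd.fst (p := Y.tgt) (q := f.ob)) (x.src_map i j hij)).symm

theorem sliceHead_sliceSimplex (η : Y.Mor) (b : NerveSimplex X n)
    (h : Y.tgt η = f.ob (b.obj 0)) : sliceHead f (sliceSimplex f η b h) = η :=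
  (Y.comp_congr rfl ((congrArg f.mor (b.map_id 0)).trans (f.mor_one _)) _
    (by rw [h, Y.src_one])).trans (Y.comp_one' _ _ _)

theorem restrict_sliceSimplex (η : Y.Mor) (b : NerveSimplex X n) (h : Y.tgt η = f.ob (b.obj 0))
    (χ : Fin (m + 1) →o Fin (n + 1)) :
    (sliceSimplex f η b h).restrict χ =
      sliceSimplex f (Y.comp η (f.mor (b.map 0 (χ 0) (Fin.zero_le _)))
        (by rw [h, f.src_mor, b.src_map])) (b.restrict χ)
        (by rw [Y.tgt_comp, f.tgt_mor, b.tgt_map]; rfl) :=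
  (sliceSimplex_head f ((sliceSimplex f η b h).restrict χ)).symm

theorem continuous_sliceSimplex {K : Type u} [TopologicalSpace K] [T2Space K]
    [CompactlyGeneratedSpace K] {η : K → Y.Mor} {b : K → NerveSimplex X n} (hη : Continuous η)
    (hb : Continuous b) (h : ∀ k, Y.tgt (η k) = f.ob ((b k).obj 0)) :
    Continuous fun k => sliceSimplex f (η k) (b k) (h k) := by
  have hw : ∀ (i : Fin (n + 1)) k, Y.tgt (η k) = Y.src (f.mor ((b k).map 0 i (Fin.zero_le i))) :=
    fun i k => by rw [h, f.src_mor, NerveSimplex.src_map]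
  have h1 : ∀ i : Fin (n + 1), Continuous fun k =>
      Y.comp (η k) (f.mor ((b k).map 0 i (Fin.zero_le i))) (hw i k) := fun i =>
    Y.continuous_comp.comp (FibProd.continuous_lift hη
      (f.continuous_mor.comp ((NerveSimplex.continuous_map 0 i _).comp hb)) (hw i))
  refine NerveSimplex.continuous_mk (fun i => ?_) (fun i j hij => ?_)
  · exact FibProd.continuous_lift (h1 i) ((NerveSimplex.continuous_obj i).comp hb) _
  · exact FibProd.continuous_lift (h1 i) ((NerveSimplex.continuous_map i j hij).comp hb) _

theorem continuous_sliceHead :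
    Continuous (sliceHead f : NerveSimplex (sliceCat f) n → Y.Mor) :=
  FibProd.continuous_fst.comp (NerveSimplex.continuous_obj (C := sliceCat f) 0)

/-- The point of `B(Y₀ ↓ f)` given by an arrow `η : a → f b₀` and a point of the simplex `b`. -/
noncomputable def slicePt (η : Y.Mor) (b : NerveSimplex X n) (h : Y.tgt η = f.ob (b.obj 0))
    (r : stdSimplex ℝ (Fin (n + 1))) : ClassifyingSpace (sliceCat f) :=
  classPt (sliceSimplex f η b h) r

theorem slicePt_congr {η η' : Y.Mor} {b b' : NerveSimplex X n} {r r' : stdSimplex ℝ (Fin (n + 1))}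
    (hη : η = η') (hb : b = b') (hr : r = r')
    (h : Y.tgt η = f.ob (b.obj 0)) (h' : Y.tgt η' = f.ob (b'.obj 0)) :
    slicePt f η b h r = slicePt f η' b' h' r' := by
  subst hη hb hr; rfl

theorem slicePt_head (x : NerveSimplex (sliceCat f) n) (r : stdSimplex ℝ (Fin (n + 1))) :
    slicePt f (sliceHead f x) (x.push (sliceForget f)) (tgt_sliceHead f x) r = classPt x r :=
  congrArg (classPt · r) (sliceSimplex_head f x)

theorem exists_eq_slicePt (e : ClassifyingSpace (sliceCat f)) :
    ∃ (n : ℕ) (η : Y.Mor) (b : NerveSimplex X n) (h : Y.tgt η = f.ob (b.obj 0))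
      (r : stdSimplex ℝ (Fin (n + 1))), e = slicePt f η b h r := by
  obtain ⟨n, x, r, rfl⟩ := exists_eq_classPt e
  exact ⟨n, _, _, _, r, (slicePt_head f x r).symm⟩

theorem slicePt_map (η : Y.Mor) (b : NerveSimplex X n) (h : Y.tgt η = f.ob (b.obj 0))
    (χ : Fin (m + 1) →o Fin (n + 1)) (r : stdSimplex ℝ (Fin (m + 1))) :
    slicePt f η b h (stdSimplex.map χ r) =
      slicePt f (Y.comp η (f.mor (b.map 0 (χ 0) (Fin.zero_le _)))
        (by rw [h, f.src_mor, b.src_map])) (b.restrict χ)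
        (by rw [Y.tgt_comp, f.tgt_mor, b.tgt_map]; rfl) r := by
  rw [slicePt, ← classPt_restrict, restrict_sliceSimplex]; rfl

@[simp]
theorem sliceProjMap_slicePt (η : Y.Mor) (b : NerveSimplex X n) (h : Y.tgt η = f.ob (b.obj 0))
    (r : stdSimplex ℝ (Fin (n + 1))) : sliceProjMap f (slicePt f η b h r) = Y.src η :=
  Y.src_comp _ _ _

theorem classifyingMap_sliceForget_slicePt (η : Y.Mor) (b : NerveSimplex X n)
    (h : Y.tgt η = f.ob (b.obj 0)) (r : stdSimplex ℝ (Fin (n + 1))) :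
    classifyingMap (sliceForget f) (slicePt f η b h r) = classPt b r :=
  rfl

/-- Precomposition with an arrow `g : a' → a` of `Y`, as a map from the fibre of `B(Y₀ ↓ f)` over
`a` to the fibre over `a'`. Outside the fibre over the target of `g` its value is irrelevant; it is
chosen to be the identity there. -/
noncomputable def sliceAction (g : Y.Mor) :
    ClassifyingSpace (sliceCat f) → ClassifyingSpace (sliceCat f) := by
  classical
  exact classLift (fun n x r => if h : Y.tgt g = Y.src (sliceHead f x) then
      slicePt f (Y.comp g (sliceHead f x) h) (x.push (sliceForget f))
        ((Y.tgt_comp _ _ _).trans (tgt_sliceHead f x)) r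
    else classPt x r) (by
  intro m n θ x t
  have hsrc : Y.src (sliceHead f (x.restrict θ)) = Y.src (sliceHead f x) :=
    (congrArg Y.src (slice_fst_eq f x (θ 0))).trans (Y.src_comp _ _ _)
  by_cases h : Y.tgt g = Y.src (sliceHead f x)
  · rw [dif_pos (h.trans hsrc.symm), dif_pos h, slicePt_map]
    refine slicePt_congr f ?_ rfl rfl _ _
    refine (Y.comp_congr rfl (slice_fst_eq f x (θ 0)) _ ?_).trans ?_
    · rw [Y.src_comp]; exact h
    · exact (Y.assoc _ _ _ h _).symm
  · rw [dif_neg (fun h' => h (h'.trans hsrc)), dif_neg h, classPt_restrict])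

theorem sliceAction_slicePt (g η : Y.Mor) (w : Y.tgt g = Y.src η) (b : NerveSimplex X n)
    (h : Y.tgt η = f.ob (b.obj 0)) (r : stdSimplex ℝ (Fin (n + 1))) :
    sliceAction f g (slicePt f η b h r) =
      slicePt f (Y.comp g η w) b ((Y.tgt_comp _ _ _).trans h) r := by
  have hw : Y.tgt g = Y.src (sliceHead f (sliceSimplex f η b h)) := by
    rw [sliceHead_sliceSimplex, w]
  refine (dif_pos hw).trans ?_
  exact slicePt_congr f (Y.comp_congr rfl (sliceHead_sliceSimplex f η b h) _ _) rfl rfl _ _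

theorem sliceProjMap_sliceAction (g : Y.Mor) (e : ClassifyingSpace (sliceCat f))
    (h : sliceProjMap f e = Y.tgt g) : sliceProjMap f (sliceAction f g e) = Y.src g := by
  obtain ⟨n, η, b, hη, r, rfl⟩ := exists_eq_slicePt f e
  rw [sliceProjMap_slicePt] at h
  rw [sliceAction_slicePt f g η h.symm, sliceProjMap_slicePt, Y.src_comp]

theorem classifyingMap_sliceAction (g : Y.Mor) (e : ClassifyingSpace (sliceCat f))
    (h : sliceProjMap f e = Y.tgt g) :
    classifyingMap (sliceForget f) (sliceAction f g e) = classifyingMap (sliceForget f) e := by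
  obtain ⟨n, η, b, hη, r, rfl⟩ := exists_eq_slicePt f e
  rw [sliceProjMap_slicePt] at h
  rw [sliceAction_slicePt f g η h.symm]
  rfl

theorem sliceAction_one (a : Y.Ob) (e : ClassifyingSpace (sliceCat f))
    (h : sliceProjMap f e = a) : sliceAction f (Y.one a) e = e := by
  obtain ⟨n, η, b, hη, r, rfl⟩ := exists_eq_slicePt f e
  rw [sliceProjMap_slicePt] at h
  rw [sliceAction_slicePt f _ η (by rw [Y.tgt_one, h])]
  exact slicePt_congr f (Y.one_comp' _ _ _) rfl rfl _ _

theorem sliceAction_comp (g g' : Y.Mor) (w : Y.tgt g = Y.src g')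
    (e : ClassifyingSpace (sliceCat f)) (h : sliceProjMap f e = Y.tgt g') :
    sliceAction f (Y.comp g g' w) e = sliceAction f g (sliceAction f g' e) := by
  obtain ⟨n, η, b, hη, r, rfl⟩ := exists_eq_slicePt f e
  rw [sliceProjMap_slicePt] at h
  rw [sliceAction_slicePt f g' η h.symm, sliceAction_slicePt f g _ (by rw [Y.src_comp, w]),
    sliceAction_slicePt f _ η (by rw [Y.tgt_comp, h])]
  exact slicePt_congr f (Y.assoc _ _ _ _ _) rfl rfl _ _

theorem continuous_sliceAction {K : Type u} [TopologicalSpace K] [CompactSpace K] [T2Space K]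
    {g : K → Y.Mor} {e : K → ClassifyingSpace (sliceCat f)} (hg : Continuous g)
    (he : Continuous e) (h : ∀ k, sliceProjMap f (e k) = Y.tgt (g k)) :
    Continuous fun k => sliceAction f (g k) (e k) := by
  refine continuous_comp_classifyingSpace (sliceProjMap f)
    (fun k e => sliceAction f (g k) e) (Y.continuous_tgt.comp hg) he h ?_
  intro n L _ _ _ k x r hk hx hr hp
  have hw : ∀ l, Y.tgt (g (k l)) = Y.src (sliceHead f (x l)) := fun l => (hp l).symm
  have hx' : Continuous fun l => sliceHead f (x l) := (continuous_sliceHead f).comp hx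
  have ht : ∀ l, Y.tgt (Y.comp (g (k l)) (sliceHead f (x l)) (hw l)) =
      f.ob (((x l).push (sliceForget f)).obj 0) :=
    fun l => (Y.tgt_comp _ _ _).trans (tgt_sliceHead f (x l))
  have : Continuous fun l => slicePt f (Y.comp (g (k l)) (sliceHead f (x l)) (hw l))
      ((x l).push (sliceForget f)) (ht l) (r l) := by
    refine continuous_classPt.comp ((continuous_sliceSimplex f ?_ ?_ ht).prodMk hr)
    · exact Y.continuous_comp.comp (FibProd.continuous_lift (hg.comp hk) hx' hw)
    · exact (NerveSimplex.continuous_push _).comp hx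
  refine this.congr fun l => ?_
  rw [← sliceAction_slicePt f _ _ _ _ (tgt_sliceHead f (x l)), slicePt_head]

end SliceSimplices

/-! ### Convex combinations in standard simplices -/

section Mix

variable {ι κ : Type*} [Fintype ι] [Fintype κ]

/-- The convex combination `w • a + (1 - w) • b` in a standard simplex. -/
noncomputable def stdSimplex.mix (w : unitInterval) (a b : stdSimplex ℝ ι) : stdSimplex ℝ ι :=
  ⟨(w : ℝ) • (a : ι → ℝ) + (1 - (w : ℝ)) • (b : ι → ℝ),
    convex_stdSimplex ℝ ι a.2 b.2 w.2.1 (sub_nonneg.2 w.2.2) (add_sub_cancel _ _)⟩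

theorem stdSimplex.mix_apply (w : unitInterval) (a b : stdSimplex ℝ ι) (i : ι) :
    stdSimplex.mix w a b i = w * a i + (1 - w) * b i := rfl

theorem stdSimplex.map_mix (θ : ι → κ) (w : unitInterval) (a b : stdSimplex ℝ ι) :
    stdSimplex.map θ (stdSimplex.mix w a b) =
      stdSimplex.mix w (stdSimplex.map θ a) (stdSimplex.map θ b) :=
  Subtype.ext (((FunOnFinite.linearMap ℝ ℝ θ).map_add _ _).trans (congrArg₂ (· + ·)
    ((FunOnFinite.linearMap ℝ ℝ θ).map_smul _ _) ((FunOnFinite.linearMap ℝ ℝ θ).map_smul _ _)))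

@[simp]
theorem stdSimplex.mix_zero (a b : stdSimplex ℝ ι) : stdSimplex.mix 0 a b = b := by
  ext i; simp [stdSimplex.mix_apply]

@[simp]
theorem stdSimplex.mix_one (a b : stdSimplex ℝ ι) : stdSimplex.mix 1 a b = a := by
  ext i; simp [stdSimplex.mix_apply]

theorem stdSimplex.continuous_mix {K : Type*} [TopologicalSpace K] {w : K → unitInterval}
    {a b : K → stdSimplex ℝ ι} (hw : Continuous w) (ha : Continuous a) (hb : Continuous b) :
    Continuous fun k => stdSimplex.mix (w k) (a k) (b k) := by
  refine Continuous.subtype_mk ?_ _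
  have hw' : Continuous fun k => (w k : ℝ) := continuous_subtype_val.comp hw
  exact (hw'.smul (continuous_subtype_val.comp ha)).add
    ((continuous_const.sub hw').smul (continuous_subtype_val.comp hb))

end Mix

/-! ### Joining two simplices along an arrow -/

section JoinSimplex

variable {C : CGHCategory.{u}} {m n p q : ℕ}

/-- The inclusion of `{0 < ⋯ < p}` as an initial segment of `{0 < ⋯ < p + 1 + q}`. -/
def joinInl (p q : ℕ) : Fin (p + 1) →o Fin (p + 1 + q + 1) where
  toFun i := ⟨i, by omega⟩
  monotone' _ _ h := h

/-- The inclusion of `{0 < ⋯ < q}` as a final segment of `{0 < ⋯ < p + 1 + q}`. -/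
def joinInr (p q : ℕ) : Fin (q + 1) →o Fin (p + 1 + q + 1) where
  toFun i := ⟨p + 1 + i, by omega⟩
  monotone' _ _ h := Nat.add_le_add_left h _

@[simp]
theorem joinInl_val (i : Fin (p + 1)) : (joinInl p q i).val = i.val := rfl

@[simp]
theorem joinInr_val (i : Fin (q + 1)) : (joinInr p q i).val = p + 1 + i.val := rfl

theorem joinInl_or_joinInr (i : Fin (p + 1 + q + 1)) :
    (∃ i', i = joinInl p q i') ∨ ∃ i', i = joinInr p q i' := by
  by_cases hi : i.val < p + 1
  · exact Or.inl ⟨⟨i, hi⟩, rfl⟩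
  · exact Or.inr ⟨⟨i - (p + 1), by omega⟩, Fin.ext (by simp; omega)⟩

/-- The join of two monotone maps. -/
def joinMap (φ : Fin (m + 1) →o Fin (p + 1)) (χ : Fin (n + 1) →o Fin (q + 1)) :
    Fin (m + 1 + n + 1) →o Fin (p + 1 + q + 1) where
  toFun i := if h : i.val < m + 1 then joinInl p q (φ ⟨i, h⟩)
    else joinInr p q (χ ⟨i - (m + 1), by omega⟩)
  monotone' i j hij := by
    have hij' : i.val ≤ j.val := hij
    by_cases hj : j.val < m + 1
    · simp only [dif_pos hj, dif_pos (lt_of_le_of_lt hij' hj)]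
      exact (joinInl p q).monotone (φ.monotone hij')
    · by_cases hi : i.val < m + 1
      · simp only [dif_pos hi, dif_neg hj]
        rw [Fin.le_def]
        rw [joinInl_val, joinInr_val]
        omega
      · simp only [dif_neg hi, dif_neg hj]
        exact (joinInr p q).monotone (χ.monotone (Nat.sub_le_sub_right hij' _))

theorem joinMap_comp_joinInl (φ : Fin (m + 1) →o Fin (p + 1)) (χ : Fin (n + 1) →o Fin (q + 1)) :
    joinMap φ χ ∘ joinInl m n = joinInl p q ∘ φ :=
  funext fun i => dif_pos i.2

theorem joinMap_comp_joinInr (φ : Fin (m + 1) →o Fin (p + 1)) (χ : Fin (n + 1) →o Fin (q + 1)) :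
    joinMap φ χ ∘ joinInr m n = joinInr p q ∘ χ := by
  funext i
  have h : ¬ (joinInr m n i).val < m + 1 := by rw [joinInr_val]; omega
  refine (dif_neg h).trans ?_
  simp

/-- The simplex `y₀ → ⋯ → y_p → c₀ → ⋯ → c_q` obtained from simplices `y` and `c` and a connecting
arrow `η : y_p → c₀`. -/
def joinSimplex (y : NerveSimplex C p) (c : NerveSimplex C q) (η : C.Mor)
    (hs : C.src η = y.obj (Fin.last p)) (ht : C.tgt η = c.obj 0) :
    NerveSimplex C (p + 1 + q) where
  obj i := if h : i.val < p + 1 then y.obj ⟨i, h⟩ else c.obj ⟨i - (p + 1), by omega⟩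
  map i j hij := if hj : j.val < p + 1 then y.map ⟨i, lt_of_le_of_lt hij hj⟩ ⟨j, hj⟩ hij
    else if hi : i.val < p + 1 then
      C.comp (C.comp (y.map ⟨i, hi⟩ (Fin.last p) (Fin.le_last _)) η (by rw [y.tgt_map, hs]))
        (c.map 0 ⟨j - (p + 1), by omega⟩ (Fin.zero_le _)) (by rw [C.tgt_comp, ht, c.src_map])
    else c.map ⟨i - (p + 1), by omega⟩ ⟨j - (p + 1), by omega⟩ (Nat.sub_le_sub_right hij _)
  src_map i j hij := by
    have hij' : i.val ≤ j.val := hij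
    by_cases hj : j.val < p + 1
    · simp only [dif_pos hj, dif_pos (lt_of_le_of_lt hij' hj), y.src_map]
    · by_cases hi : i.val < p + 1
      · simp only [dif_pos hi, dif_neg hj, C.src_comp, y.src_map]
      · simp only [dif_neg hi, dif_neg hj, c.src_map]
  tgt_map i j hij := by
    have hij' : i.val ≤ j.val := hij
    by_cases hj : j.val < p + 1
    · simp only [dif_pos hj, y.tgt_map]
    · by_cases hi : i.val < p + 1
      · simp only [dif_pos hi, dif_neg hj, C.tgt_comp, c.tgt_map]
      · simp only [dif_neg hi, dif_neg hj, c.tgt_map]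
  map_id i := by
    by_cases hi : i.val < p + 1
    · simp only [dif_pos hi, y.map_id]
    · simp only [dif_neg hi, c.map_id]
  map_comp i j k hij hjk := by
    have hij' : i.val ≤ j.val := hij
    have hjk' : j.val ≤ k.val := hjk
    by_cases hk : k.val < p + 1
    · have hj := lt_of_le_of_lt hjk' hk
      rw [dif_pos hk]
      refine (y.map_comp ⟨i, lt_of_le_of_lt hij' hj⟩ ⟨j, hj⟩ ⟨k, hk⟩ hij hjk).trans
        (C.comp_congr ?_ ?_ _ _)
      exacts [by rw [dif_pos hj], by rw [dif_pos hk]]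
    · rw [dif_neg hk]
      by_cases hi : i.val < p + 1
      · rw [dif_pos hi]
        by_cases hj : j.val < p + 1
        · refine Eq.trans ?_ (C.comp_congr (dif_pos hj).symm
            ((dif_neg hk).trans (dif_pos hj)).symm ?_ _)
          · refine Eq.trans ?_ (C.assoc _ _ _ ?_ ?_)
            · refine C.comp_congr ((C.comp_congr (y.map_comp _ ⟨j, hj⟩ _ hij' _) rfl _ ?_).trans
                (C.assoc _ _ _ _ _)) rfl _ _
              rw [C.tgt_comp, y.tgt_map, hs]
            · rw [C.tgt_comp, ht, c.src_map]
          · rw [C.src_comp, C.src_comp, y.tgt_map, y.src_map]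
        · refine Eq.trans ?_ (C.comp_congr ((dif_neg hj).trans (dif_pos hi)).symm
            ((dif_neg hk).trans (dif_neg hj)).symm ?_ _)
          · refine (C.comp_congr rfl (c.map_comp 0 ⟨j - (p + 1), by omega⟩ _ (Fin.zero_le _)
              (Nat.sub_le_sub_right hjk' _)) _ ?_).trans (C.assoc _ _ _ _ _).symm
            rw [C.tgt_comp, ht, C.src_comp, c.src_map]
          · rw [C.tgt_comp, c.tgt_map, c.src_map]
      · have hj : ¬ j.val < p + 1 := fun h => hi (lt_of_le_of_lt hij' h)
        rw [dif_neg hi]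
        exact (c.map_comp _ _ _ _ _).trans (C.comp_congr
          ((dif_neg hj).trans (dif_neg hi)).symm ((dif_neg hk).trans (dif_neg hj)).symm _ _)

theorem joinSimplex_congr {y y' : NerveSimplex C p} {c c' : NerveSimplex C q} {η η' : C.Mor}
    (hy : y = y') (hc : c = c') (hη : η = η') (hs : C.src η = y.obj (Fin.last p))
    (ht : C.tgt η = c.obj 0) (hs' : C.src η' = y'.obj (Fin.last p)) (ht' : C.tgt η' = c'.obj 0) :
    joinSimplex y c η hs ht = joinSimplex y' c' η' hs' ht' := by
  subst hy hc hη; rfl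

theorem restrict_joinInl (y : NerveSimplex C p) (c : NerveSimplex C q) (η : C.Mor)
    (hs : C.src η = y.obj (Fin.last p)) (ht : C.tgt η = c.obj 0) :
    (joinSimplex y c η hs ht).restrict (joinInl p q) = y :=
  NerveSimplex.ext (funext fun i => dif_pos i.2)
    (funext fun _ => funext fun j => funext fun _ => dif_pos j.2)

theorem restrict_joinInr (y : NerveSimplex C p) (c : NerveSimplex C q) (η : C.Mor)
    (hs : C.src η = y.obj (Fin.last p)) (ht : C.tgt η = c.obj 0) :
    (joinSimplex y c η hs ht).restrict (joinInr p q) = c := by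
  have h : ∀ i : Fin (q + 1), ¬ (joinInr p q i).val < p + 1 := fun i => by rw [joinInr_val]; omega
  have h' : ∀ i : Fin (q + 1), (⟨(joinInr p q i).val - (p + 1), by omega⟩ : Fin (q + 1)) = i :=
    fun i => Fin.ext (by simp)
  refine NerveSimplex.ext (funext fun i => ?_) (funext fun i => funext fun j => funext fun hij => ?_)
  · exact (dif_neg (h i)).trans (congrArg c.obj (h' i))
  · refine ((dif_neg (h j)).trans (dif_neg (h i))).trans ?_
    congr 1
    exacts [h' i, h' j]

theorem NerveSimplex.map_congr (x : NerveSimplex C n) {i i' j j' : Fin (n + 1)} (hi : i = i')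
    (hj : j = j') (h : i ≤ j) (h' : i' ≤ j') : x.map i j h = x.map i' j' h' := by
  subst hi hj; rfl

theorem NerveSimplex.map_self (x : NerveSimplex C n) {i j : Fin (n + 1)} (hij : i = j)
    (h : i ≤ j) : x.map i j h = C.one (x.obj j) := by
  subst hij; exact x.map_id i

theorem joinSimplex_obj_inl (y : NerveSimplex C p) (c : NerveSimplex C q) (η : C.Mor)
    (hs : C.src η = y.obj (Fin.last p)) (ht : C.tgt η = c.obj 0) (i : Fin (p + 1)) :
    (joinSimplex y c η hs ht).obj (joinInl p q i) = y.obj i :=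
  congrArg (fun x => NerveSimplex.obj x i) (restrict_joinInl y c η hs ht)

theorem joinSimplex_obj_inr (y : NerveSimplex C p) (c : NerveSimplex C q) (η : C.Mor)
    (hs : C.src η = y.obj (Fin.last p)) (ht : C.tgt η = c.obj 0) (i : Fin (q + 1)) :
    (joinSimplex y c η hs ht).obj (joinInr p q i) = c.obj i :=
  congrArg (fun x => NerveSimplex.obj x i) (restrict_joinInr y c η hs ht)

theorem joinSimplex_map_inl_inl (y : NerveSimplex C p) (c : NerveSimplex C q) (η : C.Mor)
    (hs : C.src η = y.obj (Fin.last p)) (ht : C.tgt η = c.obj 0) (i j : Fin (p + 1)) (h : i ≤ j)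
    (h' : joinInl p q i ≤ joinInl p q j) :
    (joinSimplex y c η hs ht).map (joinInl p q i) (joinInl p q j) h' = y.map i j h :=
  congrArg (fun x => NerveSimplex.map x i j h) (restrict_joinInl y c η hs ht)

theorem joinSimplex_map_inr_inr (y : NerveSimplex C p) (c : NerveSimplex C q) (η : C.Mor)
    (hs : C.src η = y.obj (Fin.last p)) (ht : C.tgt η = c.obj 0) (i j : Fin (q + 1)) (h : i ≤ j)
    (h' : joinInr p q i ≤ joinInr p q j) :
    (joinSimplex y c η hs ht).map (joinInr p q i) (joinInr p q j) h' = c.map i j h :=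
  congrArg (fun x => NerveSimplex.map x i j h) (restrict_joinInr y c η hs ht)

theorem joinSimplex_map_inl_inr (y : NerveSimplex C p) (c : NerveSimplex C q) (η : C.Mor)
    (hs : C.src η = y.obj (Fin.last p)) (ht : C.tgt η = c.obj 0) (i : Fin (p + 1))
    (j : Fin (q + 1)) (h : joinInl p q i ≤ joinInr p q j) :
    (joinSimplex y c η hs ht).map (joinInl p q i) (joinInr p q j) h =
      C.comp (C.comp (y.map i (Fin.last p) (Fin.le_last _)) η (by rw [y.tgt_map, hs]))
        (c.map 0 j (Fin.zero_le _)) (by rw [C.tgt_comp, ht, c.src_map]) := by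
  have hj : ¬ (joinInr p q j).val < p + 1 := by rw [joinInr_val]; omega
  refine (dif_neg hj).trans ((dif_pos i.2).trans (C.comp_congr rfl ?_ _ _))
  exact c.map_congr rfl (Fin.ext (by simp)) _ _

theorem restrict_joinMap (φ : Fin (m + 1) →o Fin (p + 1)) (χ : Fin (n + 1) →o Fin (q + 1))
    (y : NerveSimplex C p) (c : NerveSimplex C q) (η : C.Mor)
    (hs : C.src η = y.obj (Fin.last p)) (ht : C.tgt η = c.obj 0) :
    (joinSimplex y c η hs ht).restrict (joinMap φ χ) =
      joinSimplex (y.restrict φ) (c.restrict χ)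
        (C.comp (C.comp (y.map (φ (Fin.last m)) (Fin.last p) (Fin.le_last _)) η
          (by rw [y.tgt_map, hs])) (c.map 0 (χ 0) (Fin.zero_le _))
          (by rw [C.tgt_comp, ht, c.src_map]))
        (by rw [C.src_comp, C.src_comp, y.src_map]; rfl) (by rw [C.tgt_comp, c.tgt_map]; rfl) := by
  have el : ∀ i, joinMap φ χ (joinInl m n i) = joinInl p q (φ i) :=
    congrFun (joinMap_comp_joinInl φ χ)
  have er : ∀ i, joinMap φ χ (joinInr m n i) = joinInr p q (χ i) :=
    congrFun (joinMap_comp_joinInr φ χ)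
  symm
  refine NerveSimplex.ext (funext fun i => ?_) (funext fun i => funext fun j => funext fun hij => ?_)
  · rcases joinInl_or_joinInr i with ⟨i, rfl⟩ | ⟨i, rfl⟩
    · exact (joinSimplex_obj_inl _ _ _ _ _ _).trans ((congrArg _ (el i)).trans
        (joinSimplex_obj_inl y c η hs ht _)).symm
    · exact (joinSimplex_obj_inr _ _ _ _ _ _).trans ((congrArg _ (er i)).trans
        (joinSimplex_obj_inr y c η hs ht _)).symm
  · rcases joinInl_or_joinInr i with ⟨i, rfl⟩ | ⟨i, rfl⟩ <;>
      rcases joinInl_or_joinInr j with ⟨j, rfl⟩ | ⟨j, rfl⟩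
    · have hij' : i ≤ j := hij
      exact (joinSimplex_map_inl_inl _ _ _ _ _ _ _ hij' _).trans
        ((NerveSimplex.map_congr _ (el i) (el j) _ (φ.monotone hij')).trans
          (joinSimplex_map_inl_inl y c η hs ht _ _ (φ.monotone hij') _)).symm
    · have hle : joinInl p q (φ i) ≤ joinInr p q (χ j) := by
        rw [Fin.le_def, joinInl_val, joinInr_val]; omega
      refine (joinSimplex_map_inl_inr _ _ _ _ _ _ _ _).trans (Eq.trans ?_
        ((NerveSimplex.map_congr _ (el i) (er j) _ hle).trans
          (joinSimplex_map_inl_inr y c η hs ht _ _ _)).symm)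
      have w1 : C.tgt (C.comp (y.map (φ (Fin.last m)) (Fin.last p) (Fin.le_last _)) η
          (by rw [y.tgt_map, hs])) = C.src (c.map 0 (χ 0) (Fin.zero_le _)) := by
        rw [C.tgt_comp, ht, c.src_map]
      have w2 : C.tgt (y.map (φ i) (φ (Fin.last m)) (φ.monotone (Fin.le_last _))) =
          C.src (y.map (φ (Fin.last m)) (Fin.last p) (Fin.le_last _)) := by
        rw [y.tgt_map, y.src_map]
      have w3 : C.tgt (c.map 0 (χ 0) (Fin.zero_le _)) =
          C.src (c.map (χ 0) (χ j) (χ.monotone (Fin.zero_le _))) := by rw [c.tgt_map, c.src_map]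
      have w4 : C.tgt (y.map (φ (Fin.last m)) (Fin.last p) (Fin.le_last _)) = C.src η := by
        rw [y.tgt_map, hs]
      -- both sides are the composite `y (φ i) → y_p → c₀ → c (χ j)`
      refine (C.comp_congr (C.assoc _ _ _ (w2.trans (C.src_comp _ _ _).symm) w1).symm rfl _
        ((C.tgt_comp _ _ _).trans w3)).trans ?_
      refine (C.assoc _ _ _ _ w3).trans (C.comp_congr ?_ ?_ _ _)
      · refine (C.assoc _ _ _ w2 w4).symm.trans (C.comp_congr ?_ rfl _ _)
        exact (y.map_comp _ _ _ _ _).symm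
      · exact (c.map_comp _ _ _ _ _).symm
    · exact absurd hij (by rw [Fin.le_def, joinInl_val, joinInr_val]; omega)
    · have hij' : i ≤ j := by rw [Fin.le_def, joinInr_val, joinInr_val] at hij; omega
      exact (joinSimplex_map_inr_inr _ _ _ _ _ _ _ hij' _).trans
        ((NerveSimplex.map_congr _ (er i) (er j) _ ((joinInr p q).monotone
          (χ.monotone hij'))).trans
          (joinSimplex_map_inr_inr y c η hs ht _ _ (χ.monotone hij') _)).symm

theorem continuous_joinSimplex {K : Type u} [TopologicalSpace K] [T2Space K]
    [CompactlyGeneratedSpace K] {y : K → NerveSimplex C p} {c : K → NerveSimplex C q}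
    {η : K → C.Mor} (hy : Continuous y) (hc : Continuous c) (hη : Continuous η)
    (hs : ∀ k, C.src (η k) = (y k).obj (Fin.last p)) (ht : ∀ k, C.tgt (η k) = (c k).obj 0) :
    Continuous fun k => joinSimplex (y k) (c k) (η k) (hs k) (ht k) := by
  have hw : ∀ (i : Fin (p + 1)) k, C.tgt ((y k).map i (Fin.last p) (Fin.le_last _)) =
      C.src (η k) := fun i k => by rw [NerveSimplex.tgt_map, hs]
  have h1 : ∀ i : Fin (p + 1), Continuous fun k =>
      C.comp ((y k).map i (Fin.last p) (Fin.le_last _)) (η k) (hw i k) := fun i =>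
    C.continuous_comp.comp (FibProd.continuous_lift
      ((NerveSimplex.continuous_map _ _ _).comp hy) hη (hw i))
  refine NerveSimplex.continuous_mk (fun i => ?_) (fun i j hij => ?_)
  · by_cases hi : i.val < p + 1
    · simp only [joinSimplex, dif_pos hi]
      exact (NerveSimplex.continuous_obj _).comp hy
    · simp only [joinSimplex, dif_neg hi]
      exact (NerveSimplex.continuous_obj _).comp hc
  · by_cases hj : j.val < p + 1
    · simp only [joinSimplex, dif_pos hj]
      exact (NerveSimplex.continuous_map _ _ _).comp hy
    · by_cases hi : i.val < p + 1
      · simp only [joinSimplex, dif_neg hj, dif_pos hi]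
        exact C.continuous_comp.comp (FibProd.continuous_lift (h1 _)
          ((NerveSimplex.continuous_map _ _ _).comp hc)
          (fun k => by rw [C.tgt_comp, ht]; exact ((c k).src_map _ _ _).symm))
      · simp only [joinSimplex, dif_neg hj, dif_neg hi]
        exact (NerveSimplex.continuous_map _ _ _).comp hc

end JoinSimplex

/-! ### Join points and compatible families of functions on them -/

/-- A point of `(N_p Y ×_{Y₀} C B(Y₀ ↓ f)) × Δᵖ`, where `C` denotes the fibrewise cone over `Y₀`: a
`p`-simplex `y` of `Y` with barycentric coordinates `t`, and a point `e` of `B(Y₀ ↓ f)` over the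
last vertex of `y`, at height `w` in the cone (`w = 1` is the cone point).

No topology is put on the set of these points: continuity is tested on families of join points
parametrized by compact Hausdorff spaces. -/
@[ext]
structure JoinPt {X Y : CGHCategory.{u}} (f : CGHFunctor X Y) (p : ℕ) : Type u where
  y : NerveSimplex Y p
  e : ClassifyingSpace (sliceCat f)
  w : unitInterval
  t : stdSimplex ℝ (Fin (p + 1))
  base : sliceProjMap f e = y.obj (Fin.last p)

namespace JoinPt

variable {X Y : CGHCategory.{u}} {f : CGHFunctor X Y} {l m n p : ℕ}

/-- A family of join points is continuous if all its components are. -/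
structure Cont {K : Type u} [TopologicalSpace K] (z : K → JoinPt f p) : Prop where
  y : Continuous fun k => (z k).y
  e : Continuous fun k => (z k).e
  w : Continuous fun k => (z k).w
  t : Continuous fun k => (z k).t

theorem Cont.comp {K L : Type u} [TopologicalSpace K] [TopologicalSpace L] {z : K → JoinPt f p}
    (hz : Cont z) {g : L → K} (hg : Continuous g) : Cont fun l => z (g l) :=
  ⟨hz.y.comp hg, hz.e.comp hg, hz.w.comp hg, hz.t.comp hg⟩

/-- Change of the barycentric coordinates. -/
def withT (z : JoinPt f p) (t : stdSimplex ℝ (Fin (p + 1))) : JoinPt f p := { z with t := t }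

/-- Precomposition of the simplex of `Y` with a monotone map `φ`. The point of `B(Y₀ ↓ f)` is moved
to the fibre over the new last vertex. -/
noncomputable def reindex (z : JoinPt f p) (φ : Fin (m + 1) →o Fin (p + 1))
    (t : stdSimplex ℝ (Fin (m + 1))) : JoinPt f m where
  y := z.y.restrict φ
  e := sliceAction f (z.y.map (φ (Fin.last m)) (Fin.last p) (Fin.le_last _)) z.e
  w := z.w
  t := t
  base := by
    rw [sliceProjMap_sliceAction, z.y.src_map]
    · rfl
    · rw [z.base, z.y.tgt_map]

theorem reindex_reindex (z : JoinPt f p) (φ : Fin (m + 1) →o Fin (p + 1))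
    (t : stdSimplex ℝ (Fin (m + 1))) (ψ : Fin (n + 1) →o Fin (m + 1))
    (t' : stdSimplex ℝ (Fin (n + 1))) :
    (z.reindex φ t).reindex ψ t' = z.reindex (φ.comp ψ) t' := by
  refine JoinPt.ext rfl ?_ rfl rfl
  refine (sliceAction_comp f _ _ ?_ _ ?_).symm.trans ?_
  · exact (NerveSimplex.tgt_map _ _ _ _).trans (z.y.src_map _ _ _).symm
  · rw [z.base, z.y.tgt_map]
  · exact congrArg (sliceAction f · z.e) (z.y.map_comp _ _ _ _ _).symm

/-- Reindexing along a map that fixes the last vertex does not move the point of `B(Y₀ ↓ f)`. -/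
theorem reindex_e_of_last (z : JoinPt f p) (φ : Fin (m + 1) →o Fin (p + 1))
    (t : stdSimplex ℝ (Fin (m + 1))) (h : φ (Fin.last m) = Fin.last p) :
    (z.reindex φ t).e = z.e := by
  refine (congrArg (sliceAction f · z.e) (z.y.map_self h _)).trans ?_
  exact sliceAction_one f _ _ z.base

theorem reindex_id (z : JoinPt f p) (t : stdSimplex ℝ (Fin (p + 1))) :
    z.reindex OrderHom.id t = z.withT t :=
  JoinPt.ext rfl (z.reindex_e_of_last _ _ rfl) rfl rfl

theorem Cont.reindex {K : Type u} [TopologicalSpace K] [CompactSpace K] [T2Space K]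
    {z : K → JoinPt f p} (hz : Cont z) (φ : Fin (m + 1) →o Fin (p + 1))
    {t : K → stdSimplex ℝ (Fin (m + 1))} (ht : Continuous t) :
    Cont fun k => (z k).reindex φ (t k) where
  y := (NerveSimplex.continuous_restrict φ).comp hz.y
  e := continuous_sliceAction f ((NerveSimplex.continuous_map _ _ _).comp hz.y) hz.e
    fun k => by rw [(z k).base]; exact ((z k).y.tgt_map _ _ _).symm
  w := hz.w
  t := ht

/-- Two join points are similar if they differ at most in the point of `B(Y₀ ↓ f)`, and in this only
at the cone point. -/
def Sim (z z' : JoinPt f p) : Prop :=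
  z.y = z'.y ∧ z.w = z'.w ∧ z.t = z'.t ∧ (z.w = 1 ∨ z.e = z'.e)

theorem Sim.reindex {z z' : JoinPt f p} (h : Sim z z') (φ : Fin (m + 1) →o Fin (p + 1))
    (t : stdSimplex ℝ (Fin (m + 1))) : Sim (z.reindex φ t) (z'.reindex φ t) := by
  obtain ⟨y, e, w, s, b⟩ := z
  obtain ⟨y', e', w', s', b'⟩ := z'
  obtain ⟨h1, h2, h3, h4⟩ := h
  dsimp only at h1 h2 h3 h4
  subst h1 h2 h3
  exact ⟨rfl, rfl, rfl, h4.imp id fun he => congrArg (sliceAction f _) he⟩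

end JoinPt

/-- A compatible family of functions on join points that restricts to `β` on the base `w = 0` of the
cones. It amounts to a continuous function on the quotient of
`∐ (N_p Y ×_{Y₀} C B(Y₀ ↓ f)) × Δᵖ` by the simplicial identities. -/
structure CompatibleFamily {X Y : CGHCategory.{u}} (f : CGHFunctor X Y) {Z : Type*}
    [TopologicalSpace Z] (β : ClassifyingSpace (sliceCat f) → Z)
    (F : ∀ p, JoinPt f p → Z) : Prop where
  zero : ∀ p (z : JoinPt f p), z.w = 0 → F p z = β z.e
  sim : ∀ p (z z' : JoinPt f p), z.Sim z' → F p z = F p z'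
  reindex : ∀ m p (φ : Fin (m + 1) →o Fin (p + 1)) (z : JoinPt f p)
    (t : stdSimplex ℝ (Fin (m + 1))), F m (z.reindex φ t) = F p (z.withT (stdSimplex.map φ t))
  cont : ∀ p (K : Type u) [TopologicalSpace K] [CompactSpace K] [T2Space K] (z : K → JoinPt f p),
    JoinPt.Cont z → Continuous fun k => F p (z k)

/-! ### The canonical family with values in `BY` -/

section JoinFamily

variable {X Y : CGHCategory.{u}} (f : CGHFunctor X Y) {m n p q : ℕ}

/-- The barycentric coordinates `(w t, (1 - w) r)` of a point of a join. -/
noncomputable def joinCoord (w : unitInterval) (t : stdSimplex ℝ (Fin (p + 1)))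
    (r : stdSimplex ℝ (Fin (q + 1))) : stdSimplex ℝ (Fin (p + 1 + q + 1)) :=
  stdSimplex.mix w (stdSimplex.map (joinInl p q) t) (stdSimplex.map (joinInr p q) r)

theorem map_joinCoord (φ : Fin (m + 1) →o Fin (p + 1)) (χ : Fin (n + 1) →o Fin (q + 1))
    (w : unitInterval) (t : stdSimplex ℝ (Fin (m + 1))) (r : stdSimplex ℝ (Fin (n + 1))) :
    stdSimplex.map (joinMap φ χ) (joinCoord w t r) =
      joinCoord w (stdSimplex.map φ t) (stdSimplex.map χ r) := by
  rw [joinCoord, stdSimplex.map_mix, stdSimplex.map_comp_apply, stdSimplex.map_comp_apply,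
    joinMap_comp_joinInl, joinMap_comp_joinInr, joinCoord, stdSimplex.map_comp_apply,
    stdSimplex.map_comp_apply]

/-- For a simplex `y` of `Y`, the function on the fibre of `B(Y₀ ↓ f)` over the last vertex of `y`
that sends the point with coordinates `r` of the simplex `η : y_p → f b₀, f b₀ → ⋯ → f b_q` to the point
with coordinates `(w t, (1 - w) r)` of the join `y₀ → ⋯ → y_p → f b₀ → ⋯ → f b_q`. Its value outside
this fibre is irrelevant. -/
noncomputable def joinValue (y : NerveSimplex Y p) (w : unitInterval)
    (t : stdSimplex ℝ (Fin (p + 1))) : ClassifyingSpace (sliceCat f) → ClassifyingSpace Y := by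
  classical
  exact classLift (fun n x r => if h : Y.src (sliceHead f x) = y.obj (Fin.last p) then
      classPt (joinSimplex y ((x.push (sliceForget f)).push f) (sliceHead f x) h
        (tgt_sliceHead f x)) (joinCoord w t r)
    else classPt y t) (by
  intro m n θ x r
  have hsrc : Y.src (sliceHead f (x.restrict θ)) = Y.src (sliceHead f x) :=
    (congrArg Y.src (slice_fst_eq f x (θ 0))).trans (Y.src_comp _ _ _)
  by_cases h : Y.src (sliceHead f x) = y.obj (Fin.last p)
  · rw [dif_pos (hsrc.trans h), dif_pos h]
    have := map_joinCoord OrderHom.id θ w t r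
    rw [OrderHom.id_coe, stdSimplex.map_id_apply] at this
    rw [← this]
    refine Eq.trans (congrArg (classPt · _) ?_) (classPt_restrict _ _ _)
    refine Eq.trans ?_ (restrict_joinMap _ _ _ _ _ _ _).symm
    refine joinSimplex_congr rfl rfl ?_ _ _ _ _
    refine (slice_fst_eq f x (θ 0)).trans (Y.comp_congr ?_ rfl _ _)
    exact ((Y.comp_congr (y.map_id _) rfl _ (by rw [Y.tgt_one, h]; rfl)).trans
      (Y.one_comp' _ _ _)).symm
  · rw [dif_neg (fun h' => h (hsrc.symm.trans h')), dif_neg h])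

theorem joinValue_classPt (y : NerveSimplex Y p) (w : unitInterval)
    (t : stdSimplex ℝ (Fin (p + 1))) (x : NerveSimplex (sliceCat f) n)
    (r : stdSimplex ℝ (Fin (n + 1))) (h : Y.src (sliceHead f x) = y.obj (Fin.last p)) :
    joinValue f y w t (classPt x r) = classPt (joinSimplex y ((x.push (sliceForget f)).push f)
      (sliceHead f x) h (tgt_sliceHead f x)) (joinCoord w t r) :=
  dif_pos h

theorem joinValue_slicePt (y : NerveSimplex Y p) (w : unitInterval)
    (t : stdSimplex ℝ (Fin (p + 1))) (η : Y.Mor) (b : NerveSimplex X n)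
    (hη : Y.tgt η = f.ob (b.obj 0)) (r : stdSimplex ℝ (Fin (n + 1)))
    (h : Y.src η = y.obj (Fin.last p)) :
    joinValue f y w t (slicePt f η b hη r) =
      classPt (joinSimplex y (b.push f) η h hη) (joinCoord w t r) := by
  refine (joinValue_classPt f y w t _ r (by rw [sliceHead_sliceSimplex, h])).trans ?_
  congr 1
  exact joinSimplex_congr rfl rfl (sliceHead_sliceSimplex f η b hη) _ _ _ _

/-- The family of the points of the joins of simplices of `Y` with simplices of `Y₀ ↓ f`. -/
noncomputable def joinFamily (p : ℕ) (z : JoinPt f p) : ClassifyingSpace Y :=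
  joinValue f z.y z.w z.t z.e

theorem joinFamily_of_w_eq_one (z : JoinPt f p) (h : z.w = 1) :
    joinFamily f p z = classPt z.y z.t := by
  obtain ⟨y, e, w, t, hb⟩ := z
  obtain ⟨n, η, b, hη, r, rfl⟩ := exists_eq_slicePt f e
  rw [sliceProjMap_slicePt] at hb
  dsimp only at h
  subst h
  refine (joinValue_slicePt f y 1 t η b hη r hb).trans ?_
  rw [joinCoord, stdSimplex.mix_one]
  exact (classPt_restrict _ _ _).symm.trans (congrArg (classPt · t) (restrict_joinInl _ _ _ _ _))

theorem compatibleFamily_joinFamily : CompatibleFamily f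
    (fun e => classifyingMap f (classifyingMap (sliceForget f) e)) (joinFamily f) where
  zero p z h := by
    obtain ⟨y, e, w, t, hb⟩ := z
    obtain ⟨n, η, b, hη, r, rfl⟩ := exists_eq_slicePt f e
    rw [sliceProjMap_slicePt] at hb
    dsimp only at h
    subst h
    refine (joinValue_slicePt f y 0 t η b hη r hb).trans ?_
    rw [joinCoord, stdSimplex.mix_zero]
    exact (classPt_restrict _ _ _).symm.trans (congrArg (classPt · r) (restrict_joinInr _ _ _ _ _))
  sim p z z' h := by
    by_cases hw : z.w = 1
    · rw [joinFamily_of_w_eq_one f z hw, joinFamily_of_w_eq_one f z' (h.2.1.symm.trans hw), h.1,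
        h.2.2.1]
    · have he := h.2.2.2.resolve_left hw
      rw [joinFamily, joinFamily, h.1, h.2.1, h.2.2.1, he]
  reindex m p φ z t := by
    obtain ⟨y, e, w, t', hb⟩ := z
    obtain ⟨n, η, b, hη, r, rfl⟩ := exists_eq_slicePt f e
    rw [sliceProjMap_slicePt] at hb
    have hw : Y.tgt (y.map (φ (Fin.last m)) (Fin.last p) (Fin.le_last _)) = Y.src η := by
      rw [y.tgt_map, hb]
    refine (congrArg (joinValue f (y.restrict φ) w t) (sliceAction_slicePt f _ η hw b hη r)).trans ?_
    refine (joinValue_slicePt f _ w t _ b _ r (by rw [Y.src_comp, y.src_map]; rfl)).trans ?_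
    refine Eq.trans ?_ (joinValue_slicePt f y w (stdSimplex.map φ t) η b hη r hb).symm
    have := map_joinCoord φ OrderHom.id w t r
    rw [OrderHom.id_coe, stdSimplex.map_id_apply] at this
    rw [← this]
    refine Eq.trans (congrArg (classPt · _) ?_) (classPt_restrict _ _ _)
    refine Eq.trans ?_ (restrict_joinMap _ _ _ _ _ _ _).symm
    refine joinSimplex_congr rfl rfl ?_ _ _ _ _
    exact ((Y.comp_congr rfl (NerveSimplex.map_id _ _) _
      (by rw [Y.tgt_comp, Y.src_one]; exact hη)).trans (Y.comp_one' _ _ _)).symm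
  cont p K _ _ _ z hz := by
    refine continuous_comp_classifyingSpace (sliceProjMap f)
      (fun k e => joinValue f (z k).y (z k).w (z k).t e)
      ((NerveSimplex.continuous_obj (Fin.last p)).comp hz.y) hz.e (fun k => (z k).base) ?_
    intro n L _ _ _ k x r hk hx hr hp
    have hs : ∀ l, Y.src (sliceHead f (x l)) = (z (k l)).y.obj (Fin.last p) := hp
    have ht : ∀ l, Y.tgt (sliceHead f (x l)) = (((x l).push (sliceForget f)).push f).obj 0 :=
      fun l => tgt_sliceHead f (x l)
    have : Continuous fun l => classPt (joinSimplex (z (k l)).y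
        (((x l).push (sliceForget f)).push f) (sliceHead f (x l)) (hs l) (tgt_sliceHead f (x l)))
        (joinCoord (z (k l)).w (z (k l)).t (r l)) := by
      refine continuous_classPt.comp ((continuous_joinSimplex (hz.y.comp hk) ?_
        ((continuous_sliceHead f).comp hx) hs ht).prodMk ?_)
      · exact (NerveSimplex.continuous_push f).comp ((NerveSimplex.continuous_push _).comp hx)
      · exact stdSimplex.continuous_mix (hz.w.comp hk)
          ((stdSimplex.continuous_map _).comp (hz.t.comp hk)) ((stdSimplex.continuous_map _).comp hr)
    exact this.congr fun l => (joinValue_classPt f _ _ _ _ _ (hs l)).symm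

end JoinFamily

/-! ### Deforming the arrows of a well-pointed category to identities -/

/-- A well-pointed structure, reparametrized: `u` vanishes exactly on the identities, and an arrow
`x` with `u x < 1` is pushed by `move (x, c)`, relative to its end points, until it becomes an
identity at `c = u x`. -/
structure EdgeRetraction (C : CGHCategory.{u}) where
  u : C.Mor → ℝ
  move : C.Mor × ℝ → C.Mor
  continuous_u : Continuous u
  continuous_move : Continuous move
  u_nonneg : ∀ x, 0 ≤ u x
  u_one : ∀ a, u (C.one a) = 0
  src_move : ∀ x, C.src (move x) = C.src x.1
  tgt_move : ∀ x, C.tgt (move x) = C.tgt x.1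
  move_zero : ∀ x, move (x, 0) = x
  move_u : ∀ x, u x < 1 → move (x, u x) ∈ Set.range C.one

theorem CGHCategory.WellPointed.nonempty_edgeRetraction {C : CGHCategory.{u}}
    (hC : C.WellPointed) : Nonempty (EdgeRetraction C) := by
  obtain ⟨u, h, hu, hp, h0, hA, h1⟩ := hC
  have hmem : ∀ x, x ∈ Set.range C.one ↔ (u x : ℝ) = 0 := fun x => by
    rw [hu, Set.mem_preimage, Set.mem_singleton_iff, ← Subtype.coe_inj]; rfl
  have hcu : Continuous fun x => (u x : ℝ) := continuous_subtype_val.comp u.continuous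
  refine ⟨⟨fun x => u x, fun x => h (x.1, Set.projIcc 0 1 zero_le_one (x.2 / u x.1)), hcu, ?_,
    fun x => (u x).2.1, fun a => (hmem _).1 ⟨a, rfl⟩, fun x => congrArg Prod.fst (hp _ _),
    fun x => congrArg Prod.snd (hp _ _), fun x => ?_, fun x hx => ?_⟩⟩
  · refine continuous_of_eq_const (X := C.Mor × ℝ) (F := fun q => h (q.1.1, q.2))
      (h.continuous.comp ((continuous_fst.comp continuous_fst).prodMk continuous_snd))
      fun x => ?_
    by_cases hx : (u x.1 : ℝ) = 0
    · right
      intro r r'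
      exact (hA _ ((hmem _).2 hx) r).trans (hA _ ((hmem _).2 hx) r').symm
    · left
      exact (continuous_projIcc (h := zero_le_one (α := ℝ))).continuousAt.comp
        (f := fun x : C.Mor × ℝ => x.2 / (u x.1 : ℝ))
        (continuousAt_snd.div (hcu.comp continuous_fst).continuousAt hx)
  · have : Set.projIcc (0 : ℝ) 1 zero_le_one (0 / u x) = 0 := by
      rw [zero_div]; exact Set.projIcc_left _
    exact (congrArg (fun r => h (x, r)) this).trans (h0 x)
  · by_cases hx0 : (u x : ℝ) = 0
    · have : h (x, Set.projIcc 0 1 zero_le_one ((u x : ℝ) / u x)) = x := hA _ ((hmem _).2 hx0) _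
      simpa only [this] using (hmem x).2 hx0
    · have : Set.projIcc (0 : ℝ) 1 zero_le_one ((u x : ℝ) / u x) = 1 := by
        rw [div_self hx0]; exact Set.projIcc_right _
      simpa only [this] using h1 x (by exact_mod_cast hx)

namespace NerveSimplex

variable {C : CGHCategory.{u}} {p : ℕ}

/-- The `k`-th of the `p` consecutive arrows of a `p`-simplex. -/
def edge (y : NerveSimplex C p) (k : Fin p) : C.Mor :=
  y.map k.castSucc k.succ (Fin.castSucc_lt_succ).le

theorem src_edge (y : NerveSimplex C p) (k : Fin p) : C.src (y.edge k) = y.obj k.castSucc :=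
  y.src_map _ _ _

theorem tgt_edge (y : NerveSimplex C p) (k : Fin p) : C.tgt (y.edge k) = y.obj k.succ :=
  y.tgt_map _ _ _

theorem continuous_edge (k : Fin p) : Continuous fun y : NerveSimplex C p => y.edge k :=
  continuous_map _ _ _

/-- Replacement of the `k`-th consecutive arrow of a simplex by a parallel one. -/
def setEdge (y : NerveSimplex C p) (k : Fin p) (g : C.Mor) (hs : C.src g = C.src (y.edge k))
    (ht : C.tgt g = C.tgt (y.edge k)) : NerveSimplex C p where
  obj := y.obj
  map i j hij := if h : i ≤ k.castSucc ∧ k.succ ≤ j then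
      C.comp (C.comp (y.map i k.castSucc h.1) g (by rw [y.tgt_map, hs, src_edge]))
        (y.map k.succ j h.2) (by rw [C.tgt_comp, ht, tgt_edge, y.src_map])
    else y.map i j hij
  src_map i j hij := by
    by_cases h : i ≤ k.castSucc ∧ k.succ ≤ j
    · rw [dif_pos h, C.src_comp, C.src_comp, y.src_map]
    · rw [dif_neg h, y.src_map]
  tgt_map i j hij := by
    by_cases h : i ≤ k.castSucc ∧ k.succ ≤ j
    · rw [dif_pos h, C.tgt_comp, y.tgt_map]
    · rw [dif_neg h, y.tgt_map]
  map_id i := by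
    rw [dif_neg, y.map_id]
    simp only [Fin.le_def, Fin.val_castSucc, Fin.val_succ]
    omega
  map_comp i j l hij hjl := by
    have hij' : i.val ≤ j.val := hij
    have hjl' : j.val ≤ l.val := hjl
    by_cases h1 : i ≤ k.castSucc ∧ k.succ ≤ j
    · have h2 : ¬ (j ≤ k.castSucc ∧ k.succ ≤ l) := by
        simp only [Fin.le_def, Fin.val_castSucc, Fin.val_succ] at h1 ⊢
        omega
      have h3 : i ≤ k.castSucc ∧ k.succ ≤ l := ⟨h1.1, h1.2.trans hjl⟩
      have w1 : C.tgt (y.map i k.castSucc h1.1) = C.src g := by rw [y.tgt_map, hs, src_edge]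
      have w2 : C.tgt (C.comp (y.map i k.castSucc h1.1) g w1) = C.src (y.map k.succ j h1.2) := by
        rw [C.tgt_comp, ht, tgt_edge, y.src_map]
      have w3 : C.tgt (y.map k.succ j h1.2) = C.src (y.map j l hjl) := by
        rw [y.tgt_map, y.src_map]
      rw [dif_pos h3]
      refine Eq.trans ?_ (C.comp_congr (g := C.comp (C.comp (y.map i k.castSucc h1.1) g w1)
        (y.map k.succ j h1.2) w2) ?_ (dif_neg h2).symm ((C.tgt_comp _ _ _).trans w3) _)
      · refine Eq.trans ?_ (C.assoc _ _ _ w2 w3).symm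
        exact C.comp_congr rfl (y.map_comp _ _ _ _ _) _ _
      · rw [dif_pos h1]
    · by_cases h2 : j ≤ k.castSucc ∧ k.succ ≤ l
      · have h3 : i ≤ k.castSucc ∧ k.succ ≤ l := ⟨hij.trans h2.1, h2.2⟩
        have w1 : C.tgt (y.map j k.castSucc h2.1) = C.src g := by rw [y.tgt_map, hs, src_edge]
        have w2 : C.tgt (C.comp (y.map j k.castSucc h2.1) g w1) = C.src (y.map k.succ l h2.2) := by
          rw [C.tgt_comp, ht, tgt_edge, y.src_map]
        have w3 : C.tgt (y.map i j hij) = C.src (y.map j k.castSucc h2.1) := by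
          rw [y.tgt_map, y.src_map]
        rw [dif_pos h3]
        refine Eq.trans ?_ (C.comp_congr (h := C.comp (C.comp (y.map j k.castSucc h2.1) g w1)
          (y.map k.succ l h2.2) w2) (dif_neg h1).symm ?_
          (w3.trans ((C.src_comp _ _ _).trans (C.src_comp _ _ _)).symm) _)
        · refine Eq.trans ?_ (C.assoc _ _ _ (w3.trans (C.src_comp _ _ _).symm) w2)
          refine C.comp_congr (Eq.trans ?_ (C.assoc _ _ _ w3 w1)) rfl _ _
          exact C.comp_congr (y.map_comp _ _ _ _ _) rfl _ _
        · rw [dif_pos h2]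
      · have h3 : ¬ (i ≤ k.castSucc ∧ k.succ ≤ l) := by
          simp only [Fin.le_def, Fin.val_castSucc, Fin.val_succ] at h1 h2 ⊢
          omega
        rw [dif_neg h3]
        refine (y.map_comp i j l hij hjl).trans (C.comp_congr ?_ ?_ _ _)
        exacts [by rw [dif_neg h1], by rw [dif_neg h2]]

theorem setEdge_edge_self (y : NerveSimplex C p) (k : Fin p) (g : C.Mor)
    (hs : C.src g = C.src (y.edge k)) (ht : C.tgt g = C.tgt (y.edge k)) :
    (y.setEdge k g hs ht).edge k = g := by
  refine (dif_pos ⟨le_rfl, le_rfl⟩).trans ?_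
  refine (C.comp_congr ((C.comp_congr (y.map_id _) rfl _ ?_).trans (C.one_comp' _ _ ?_))
    (y.map_id _) _ ?_).trans (C.comp_one' _ _ ?_)
  all_goals first | rw [C.tgt_one, hs, src_edge] | rw [C.src_one, ht, tgt_edge]

theorem setEdge_edge_ne (y : NerveSimplex C p) {k k' : Fin p} (h : k ≠ k') (g : C.Mor)
    (hs : C.src g = C.src (y.edge k)) (ht : C.tgt g = C.tgt (y.edge k)) :
    (y.setEdge k g hs ht).edge k' = y.edge k' := by
  refine dif_neg ?_
  simp only [Fin.le_def, Fin.val_castSucc, Fin.val_succ]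
  have : k.val ≠ k'.val := fun h' => h (Fin.ext h')
  omega

theorem setEdge_self (y : NerveSimplex C p) (k : Fin p) (g : C.Mor) (h : g = y.edge k)
    (hs : C.src g = C.src (y.edge k)) (ht : C.tgt g = C.tgt (y.edge k)) :
    y.setEdge k g hs ht = y := by
  subst h
  refine NerveSimplex.ext rfl (funext fun i => funext fun j => funext fun hij => ?_)
  by_cases hk : i ≤ k.castSucc ∧ k.succ ≤ j
  · refine (dif_pos hk).trans ?_
    refine Eq.trans ?_ (y.map_comp i k.succ j
      (hk.1.trans (Fin.castSucc_lt_succ).le) hk.2).symm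
    exact C.comp_congr (y.map_comp _ _ _ _ _).symm rfl _ _
  · exact dif_neg hk

theorem continuous_setEdge {K : Type u} [TopologicalSpace K] [T2Space K]
    [CompactlyGeneratedSpace K] {y : K → NerveSimplex C p} (hy : Continuous y) (k : Fin p)
    {g : K → C.Mor} (hg : Continuous g) (hs : ∀ a, C.src (g a) = C.src ((y a).edge k))
    (ht : ∀ a, C.tgt (g a) = C.tgt ((y a).edge k)) :
    Continuous fun a => (y a).setEdge k (g a) (hs a) (ht a) := by
  refine continuous_mk (fun i => ?_) (fun i j hij => ?_)
  · change Continuous fun a => (y a).obj i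
    exact (continuous_obj i).comp hy
  by_cases h : i ≤ k.castSucc ∧ k.succ ≤ j
  · have w1 : ∀ a, C.tgt ((y a).map i k.castSucc h.1) = C.src (g a) := fun a => by
      rw [tgt_map, hs, src_edge]
    have w2 : ∀ a, C.tgt (C.comp ((y a).map i k.castSucc h.1) (g a) (w1 a)) =
        C.src ((y a).map k.succ j h.2) := fun a => by
      rw [C.tgt_comp, ht, tgt_edge, src_map]
    simp only [setEdge, dif_pos h]
    exact C.continuous_comp.comp (FibProd.continuous_lift
      (C.continuous_comp.comp (FibProd.continuous_lift ((continuous_map _ _ _).comp hy) hg w1))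
      ((continuous_map _ _ _).comp hy) w2)
  · simp only [setEdge, dif_neg h]
    exact (continuous_map _ _ _).comp hy

end NerveSimplex

namespace EdgeRetraction

variable {C : CGHCategory.{u}} (R : EdgeRetraction C) {p : ℕ}

/-- Moving the consecutive arrows of a simplex with indices in a list. -/
def moveList (c : ℝ) : List (Fin p) → NerveSimplex C p → NerveSimplex C p
  | [], y => y
  | k :: L, y => (moveList c L y).setEdge k (R.move ((moveList c L y).edge k, c))
      (R.src_move _) (R.tgt_move _)

theorem moveList_obj (c : ℝ) (L : List (Fin p)) (y : NerveSimplex C p) :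
    (R.moveList c L y).obj = y.obj := by
  induction L with
  | nil => rfl
  | cons k L ih => exact ih

theorem moveList_zero (L : List (Fin p)) (y : NerveSimplex C p) : R.moveList 0 L y = y := by
  induction L with
  | nil => rfl
  | cons k L ih =>
    exact (NerveSimplex.setEdge_self _ _ _ (R.move_zero _) _ _).trans ih

theorem moveList_edge_of_notMem (c : ℝ) {L : List (Fin p)} (y : NerveSimplex C p) {k : Fin p}
    (hk : k ∉ L) : (R.moveList c L y).edge k = y.edge k := by
  induction L with
  | nil => rfl
  | cons k' L ih =>
    rw [List.mem_cons, not_or] at hk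
    exact (NerveSimplex.setEdge_edge_ne _ (Ne.symm hk.1) _ _ _).trans (ih hk.2)

theorem moveList_edge_of_mem (c : ℝ) {L : List (Fin p)} (hL : L.Nodup) (y : NerveSimplex C p)
    {k : Fin p} (hk : k ∈ L) : (R.moveList c L y).edge k = R.move (y.edge k, c) := by
  induction L with
  | nil => simp at hk
  | cons k' L ih =>
    rw [List.nodup_cons] at hL
    by_cases h : k = k'
    · subst h
      refine (NerveSimplex.setEdge_edge_self _ _ _ _ _).trans ?_
      rw [R.moveList_edge_of_notMem c y hL.1]
    · exact (NerveSimplex.setEdge_edge_ne _ (Ne.symm h) _ _ _).trans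
        (ih hL.2 ((List.mem_cons.1 hk).resolve_left h))

theorem continuous_moveList {K : Type u} [TopologicalSpace K] [T2Space K]
    [CompactlyGeneratedSpace K] {c : K → ℝ} (hc : Continuous c) (L : List (Fin p))
    {y : K → NerveSimplex C p} (hy : Continuous y) :
    Continuous fun a => R.moveList (c a) L (y a) := by
  induction L with
  | nil => exact hy
  | cons k L ih =>
    exact NerveSimplex.continuous_setEdge ih k (R.continuous_move.comp
      (((NerveSimplex.continuous_edge k).comp ih).prodMk hc)) _ _

end EdgeRetraction

/-! ### Shrinking barycentric coordinates towards the boundary -/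

/-- Subtraction of a constant from all barycentric coordinates, followed by normalization. -/
noncomputable def stdSimplex.shrink {p : ℕ} (t : stdSimplex ℝ (Fin (p + 1))) (c : ℝ)
    (ht : ∀ i, c ≤ t i) (hc : ((p : ℝ) + 1) * c < 1) : stdSimplex ℝ (Fin (p + 1)) :=
  ⟨fun i => (t i - c) / (1 - (p + 1) * c),
    fun i => div_nonneg (sub_nonneg.2 (ht i)) (by linarith), by
      rw [← Finset.sum_div, Finset.sum_sub_distrib, stdSimplex.sum_eq_one, Finset.sum_const,
        Finset.card_univ, Fintype.card_fin, nsmul_eq_mul]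
      push_cast
      exact div_self (by linarith)⟩

theorem stdSimplex.shrink_apply {p : ℕ} (t : stdSimplex ℝ (Fin (p + 1))) (c : ℝ)
    (ht : ∀ i, c ≤ t i) (hc : ((p : ℝ) + 1) * c < 1) (i : Fin (p + 1)) :
    stdSimplex.shrink t c ht hc i = (t i - c) / (1 - (p + 1) * c) := rfl

theorem stdSimplex.continuous_apply {ι K : Type*} [Fintype ι] [TopologicalSpace K]
    {t : K → stdSimplex ℝ ι} (h : Continuous t) (i : ι) : Continuous fun k => t k i :=
  (_root_.continuous_apply i).comp (continuous_subtype_val.comp h)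

theorem stdSimplex.continuous_shrink {p : ℕ} {K : Type*} [TopologicalSpace K]
    {t : K → stdSimplex ℝ (Fin (p + 1))} {c : K → ℝ} (h : Continuous t) (h' : Continuous c)
    (ht : ∀ k i, c k ≤ t k i) (hc : ∀ k, ((p : ℝ) + 1) * c k < 1) :
    Continuous fun k => stdSimplex.shrink (t k) (c k) (ht k) (hc k) := by
  refine Continuous.subtype_mk (continuous_pi fun i => ?_) _
  refine ((stdSimplex.continuous_apply h i).sub h').div
    (continuous_const.sub (continuous_const.mul h')) fun k => ?_
  have := hc k
  linarith

/-! ### Pushing join points towards the boundary -/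

/-- A fibrewise contraction of `B(Y₀ ↓ f)` onto a section of the projection to `Y₀`. The homotopy is
parametrized by `ℝ`, but only its restriction to `[0, 1]` matters. -/
structure SliceContraction {X Y : CGHCategory.{u}} (f : CGHFunctor X Y) where
  s : Y.Ob → ClassifyingSpace (sliceCat f)
  H : ℝ × ClassifyingSpace (sliceCat f) → ClassifyingSpace (sliceCat f)
  continuous_s : Continuous s
  continuous_H : Continuous H
  proj_s : ∀ a, sliceProjMap f (s a) = a
  proj_H : ∀ x, sliceProjMap f (H x) = sliceProjMap f x.2
  H_zero : ∀ e, H (0, e) = s (sliceProjMap f e)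
  H_one : ∀ e, H (1, e) = e

theorem Shrinkable.nonempty_sliceContraction {X Y : CGHCategory.{u}} {f : CGHFunctor X Y}
    (h : Shrinkable (sliceProjMap f)) : Nonempty (SliceContraction f) := by
  obtain ⟨s, hs, H, hH⟩ := h
  refine ⟨⟨s, fun x => H (Set.projIcc 0 1 zero_le_one x.1, x.2), s.continuous, ?_,
    fun a => ContinuousMap.congr_fun hs a, fun x => hH _ _, fun e => ?_, fun e => ?_⟩⟩
  · exact H.continuous.comp ((continuous_projIcc.comp continuous_fst).prodMk continuous_snd)
  · rw [Set.projIcc_left]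
    exact H.apply_zero e
  · rw [Set.projIcc_right]
    exact H.apply_one e

namespace JoinPt

variable {X Y : CGHCategory.{u}} {f : CGHFunctor X Y} {p : ℕ} (R : EdgeRetraction Y)
  (S : SliceContraction f)

/-- The quantities that measure the distance of a join point from the base `w = 0`, from the
simplices whose `k`-th arrow is an identity, and from the `i`-th face. -/
noncomputable def gaugeTerm (z : JoinPt f p) : Option (Fin p ⊕ Fin (p + 1)) → ℝ
  | none => z.w / (2 * (p + 1))
  | some (Sum.inl k) => R.u (z.y.edge k)
  | some (Sum.inr i) => z.t i

/-- The minimum of the quantities `gaugeTerm`. -/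
noncomputable def gauge (z : JoinPt f p) : ℝ :=
  Finset.univ.inf' Finset.univ_nonempty (gaugeTerm R z)

theorem gauge_le (z : JoinPt f p) (k : Option (Fin p ⊕ Fin (p + 1))) :
    gauge R z ≤ gaugeTerm R z k :=
  Finset.inf'_le _ (Finset.mem_univ k)

theorem exists_gauge_eq (z : JoinPt f p) : ∃ k, gauge R z = gaugeTerm R z k := by
  obtain ⟨k, -, hk⟩ := Finset.exists_mem_eq_inf' Finset.univ_nonempty (gaugeTerm R z)
  exact ⟨k, hk⟩

theorem gaugeTerm_nonneg (z : JoinPt f p) (k : Option (Fin p ⊕ Fin (p + 1))) :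
    0 ≤ gaugeTerm R z k := by
  rcases k with _ | k | i
  · exact div_nonneg z.w.2.1 (by positivity)
  · exact R.u_nonneg _
  · exact z.t.2.1 i

theorem gauge_nonneg (z : JoinPt f p) : 0 ≤ gauge R z :=
  (Finset.le_inf'_iff _ _).2 fun k _ => gaugeTerm_nonneg R z k

theorem gauge_eq_zero {z : JoinPt f p} {k : Option (Fin p ⊕ Fin (p + 1))}
    (h : gaugeTerm R z k = 0) : gauge R z = 0 :=
  le_antisymm ((gauge_le R z k).trans_eq h) (gauge_nonneg R z)

theorem mul_gauge_le (z : JoinPt f p) : 2 * ((p + 1) * gauge R z) ≤ z.w := by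
  have h := gauge_le R z none
  rw [gaugeTerm, le_div_iff₀ (by positivity)] at h
  linarith

theorem Sim.gaugeTerm_eq {z z' : JoinPt f p} (h : Sim z z') : gaugeTerm R z = gaugeTerm R z' := by
  funext k
  rcases k with _ | k | i
  · simp only [gaugeTerm, h.2.1]
  · simp only [gaugeTerm, h.1]
  · simp only [gaugeTerm, h.2.2.1]

theorem Sim.gauge_eq {z z' : JoinPt f p} (h : Sim z z') : gauge R z = gauge R z' := by
  rw [gauge, gauge, h.gaugeTerm_eq]

theorem Cont.gaugeTerm {K : Type u} [TopologicalSpace K] {z : K → JoinPt f p} (hz : Cont z)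
    (k : Option (Fin p ⊕ Fin (p + 1))) : Continuous fun a => gaugeTerm R (z a) k := by
  rcases k with _ | k | i
  · exact (continuous_subtype_val.comp hz.w).div_const _
  · exact R.continuous_u.comp ((NerveSimplex.continuous_edge k).comp hz.y)
  · exact stdSimplex.continuous_apply hz.t i

theorem Cont.gauge {K : Type u} [TopologicalSpace K] {z : K → JoinPt f p} (hz : Cont z) :
    Continuous fun a => gauge R (z a) :=
  Continuous.finset_inf'_apply _ fun k _ => hz.gaugeTerm R k

theorem mul_gauge_bounds (z : JoinPt f p) (l : unitInterval) :
    0 ≤ (l : ℝ) * gauge R z ∧ (l : ℝ) * gauge R z ≤ gauge R z :=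
  ⟨mul_nonneg l.2.1 (gauge_nonneg R z), mul_le_of_le_one_left (gauge_nonneg R z) l.2.2⟩

theorem mul_mul_gauge_le (z : JoinPt f p) (l : unitInterval) :
    2 * ((p + 1) * ((l : ℝ) * gauge R z)) ≤ z.w :=
  le_trans (by have := (mul_gauge_bounds R z l).2; gcongr) (mul_gauge_le R z)

/-- The deformation, with parameter `l ∈ [0, 1]`, that moves a join point until it lies in the base
`w = 0`, in a degenerate simplex, or on a face. The point of the fibrewise cone first slides, at
constant height, from `e` towards the section, and then, at double speed, down to the base: thus a
point near the cone point is independent of `e`. -/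
noncomputable def move (z : JoinPt f p) (l : unitInterval) : JoinPt f p where
  y := R.moveList (l * gauge R z) (List.finRange p) z.y
  e := S.H (max (1 - 4 * ((p + 1) * (l * gauge R z))) (1 - z.w), z.e)
  w := ⟨min z.w (2 * z.w - 4 * ((p + 1) * (l * gauge R z))), by
    have h := mul_mul_gauge_le R z l
    exact ⟨le_min z.w.2.1 (by linarith), (min_le_left _ _).trans z.w.2.2⟩⟩
  t := stdSimplex.shrink z.t (l * gauge R z)
    (fun i => (mul_gauge_bounds R z l).2.trans (gauge_le R z (some (Sum.inr i))))
    (by have h := mul_mul_gauge_le R z l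
        have := z.w.2.2
        linarith)
  base := by
    rw [S.proj_H, R.moveList_obj]
    exact z.base

theorem move_of_mul_gauge_eq_zero (z : JoinPt f p) (l : unitInterval)
    (h : (l : ℝ) * gauge R z = 0) : z.move R S l = z := by
  have hw := z.w.2.1
  refine JoinPt.ext ?_ ?_ (Subtype.ext ?_) (stdSimplex.ext (funext fun i => ?_))
  · change R.moveList (l * gauge R z) (List.finRange p) z.y = z.y
    rw [h, R.moveList_zero]
  · change S.H (max (1 - 4 * ((p + 1) * (l * gauge R z))) (1 - z.w), z.e) = z.e
    rw [h, max_eq_left (by linarith), mul_zero, mul_zero, sub_zero, S.H_one]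
  · change min (z.w : ℝ) (2 * z.w - 4 * ((p + 1) * (l * gauge R z))) = z.w
    rw [h]
    exact min_eq_left (by linarith)
  · change (z.t i - l * gauge R z) / (1 - (p + 1) * (l * gauge R z)) = z.t i
    rw [h]
    simp

theorem move_zero (z : JoinPt f p) : z.move R S 0 = z :=
  z.move_of_mul_gauge_eq_zero R S 0 (zero_mul _)

theorem move_of_gauge_eq_zero (z : JoinPt f p) (l : unitInterval) (h : gauge R z = 0) :
    z.move R S l = z :=
  z.move_of_mul_gauge_eq_zero R S l (by rw [h, mul_zero])

theorem Sim.move {z z' : JoinPt f p} (h : Sim z z') (l : unitInterval) :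
    Sim (z.move R S l) (z'.move R S l) := by
  have hg := h.gauge_eq R
  obtain ⟨y, e, w, t, b⟩ := z
  obtain ⟨y', e', w', t', b'⟩ := z'
  obtain ⟨h1, h2, h3, h4⟩ := h
  dsimp only at h1 h2 h3 h4
  subst h1 h2 h3
  refine ⟨?_, Subtype.ext ?_, stdSimplex.ext (funext fun i => ?_), ?_⟩
  · simp only [JoinPt.move, hg]
  · simp only [JoinPt.move, hg]
  · simp only [JoinPt.move, stdSimplex.shrink_apply, hg]
  · by_cases he : e = e'
    · right
      subst he
      rfl
    · have hw : w = 1 := h4.resolve_right he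
      subst hw
      rcases le_total (4 * (((p : ℝ) + 1) * (l * JoinPt.gauge R ⟨y, e, 1, t, b⟩))) 1 with hl | hl
      · left
        refine Subtype.ext (min_eq_left ?_)
        dsimp only [Set.Icc.coe_one]
        linarith
      · right
        have e1 : max (1 - 4 * (((p : ℝ) + 1) * (l * JoinPt.gauge R ⟨y, e, 1, t, b⟩)))
            (1 - ((1 : unitInterval) : ℝ)) = 0 := by
          rw [Set.Icc.coe_one, sub_self]
          exact max_eq_right (by linarith)
        have e2 := e1
        rw [hg] at e2
        simp only [JoinPt.move]
        rw [e1, e2, S.H_zero, S.H_zero, b, b']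

theorem Cont.move {K : Type u} [TopologicalSpace K] [T2Space K] [CompactlyGeneratedSpace K]
    {z : K → JoinPt f p} (hz : Cont z) {l : K → unitInterval} (hl : Continuous l) :
    Cont fun a => (z a).move R S (l a) := by
  have hc : Continuous fun a => (l a : ℝ) * JoinPt.gauge R (z a) :=
    (continuous_subtype_val.comp hl).mul (hz.gauge R)
  have hw : Continuous fun a => ((z a).w : ℝ) := continuous_subtype_val.comp hz.w
  have hc' : Continuous fun a => 4 * (((p : ℝ) + 1) * ((l a : ℝ) * JoinPt.gauge R (z a))) :=
    continuous_const.mul (continuous_const.mul hc)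
  refine ⟨R.continuous_moveList hc _ hz.y, S.continuous_H.comp (Continuous.prodMk ?_ hz.e),
    Continuous.subtype_mk ?_ _, stdSimplex.continuous_shrink hz.t hc
      (fun a i => (mul_gauge_bounds R (z a) (l a)).2.trans (gauge_le R (z a) (some (Sum.inr i))))
      fun a => ?_⟩
  · exact (continuous_const.sub hc').max (continuous_const.sub hw)
  · exact hw.min ((continuous_const.mul hw).sub hc')
  · have h := mul_mul_gauge_le R (z a) (l a)
    have := (z a).w.2.2
    linarith

theorem move_one_w {z : JoinPt f p} (h : gauge R z = gaugeTerm R z none) :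
    (z.move R S 1).w = 0 := by
  have hw := z.w.2.1
  have h' : 4 * (((p : ℝ) + 1) * gauge R z) = 2 * z.w := by
    rw [h, gaugeTerm]
    field_simp
    ring
  refine Subtype.ext ?_
  change min (z.w : ℝ) (2 * z.w - 4 * ((p + 1) * (1 * gauge R z))) = 0
  rw [one_mul, h', sub_self]
  exact min_eq_right hw

theorem move_one_edge {z : JoinPt f p} {k : Fin p}
    (h : gauge R z = gaugeTerm R z (some (Sum.inl k))) :
    (z.move R S 1).y.edge k ∈ Set.range Y.one := by
  have h' : (1 : ℝ) * gauge R z = R.u (z.y.edge k) := by rw [one_mul, h, gaugeTerm]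
  have e1 : (z.move R S 1).y.edge k = R.move (z.y.edge k, 1 * gauge R z) :=
    R.moveList_edge_of_mem _ (List.nodup_finRange p) _ (List.mem_finRange k)
  rw [e1, h']
  refine R.move_u _ ?_
  rw [← h', one_mul]
  have h1 := mul_gauge_le R z
  have h2 := z.w.2.2
  have h3 := gauge_nonneg R z
  have h4 : 0 ≤ (p : ℝ) * gauge R z := mul_nonneg p.cast_nonneg h3
  linarith

theorem move_one_t {z : JoinPt f p} {i : Fin (p + 1)}
    (h : gauge R z = gaugeTerm R z (some (Sum.inr i))) : (z.move R S 1).t i = 0 := by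
  change (z.t i - 1 * gauge R z) / (1 - (p + 1) * (1 * gauge R z)) = 0
  rw [h, gaugeTerm, one_mul, sub_self, zero_div]

end JoinPt

/-! ### Pushing forward barycentric coordinates -/

namespace stdSimplex

variable {ι κ : Type*} [Fintype ι] [Fintype κ]

theorem map_apply [DecidableEq κ] (g : ι → κ) (t : stdSimplex ℝ ι) (j : κ) :
    stdSimplex.map g t j = ∑ i with g i = j, t i :=
  FunOnFinite.linearMap_apply_apply ..

theorem map_apply_eq_zero (g : ι → κ) (t : stdSimplex ℝ ι) (j : κ)
    (h : ∀ i, g i = j → t i = 0) : stdSimplex.map g t j = 0 := by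
  classical
  rw [map_apply]
  exact Finset.sum_eq_zero fun i hi => h i (Finset.mem_filter.1 hi).2

theorem map_congr_of_ne_zero {g g' : ι → κ} {t : stdSimplex ℝ ι}
    (h : ∀ i, t i ≠ 0 → g i = g' i) : stdSimplex.map g t = stdSimplex.map g' t := by
  classical
  refine stdSimplex.ext (funext fun j => ?_)
  rw [map_apply, map_apply, Finset.sum_filter, Finset.sum_filter]
  refine Finset.sum_congr rfl fun i _ => ?_
  by_cases hi : t i = 0
  · rw [hi, ite_self, ite_self]
  · rw [h i hi]

end stdSimplex

/-! ### Faces of join points -/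

/-- The injective monotone map that omits `i`. -/
def faceMap {p : ℕ} (i : Fin (p + 2)) : Fin (p + 1) →o Fin (p + 2) :=
  (Fin.succAboveOrderEmb i).toOrderHom

/-- The surjective monotone map that takes the value `k` twice. -/
def collapseMap {p : ℕ} (k : Fin (p + 1)) : Fin (p + 2) →o Fin (p + 1) where
  toFun := k.predAbove
  monotone' := Fin.predAbove_right_monotone k

/-- The surjective monotone map that identifies `i` with `i + 1`, or with its predecessor if `i` is
the last element. -/
def mergeMap {p : ℕ} (i : Fin (p + 2)) : Fin (p + 2) →o Fin (p + 1) :=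
  collapseMap ⟨min i p, by omega⟩

theorem faceMap_val {p : ℕ} (i : Fin (p + 2)) (j : Fin (p + 1)) :
    (faceMap i j).val = if j.val < i.val then j.val else j.val + 1 := by
  change (i.succAbove j).val = _
  rw [Fin.succAbove]
  split_ifs with h1 h2 h2
  · rfl
  · exact absurd h1 h2
  · exact absurd h2 h1
  · rfl

theorem collapseMap_val {p : ℕ} (k : Fin (p + 1)) (j : Fin (p + 2)) :
    (collapseMap k j).val = if j.val ≤ k.val then j.val else j.val - 1 := by
  change (k.predAbove j).val = _
  rw [Fin.predAbove]
  split_ifs with h1 h2 h2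
  · simp only [Fin.lt_def, Fin.val_castSucc] at h1
    omega
  · rfl
  · rfl
  · simp only [Fin.lt_def, Fin.val_castSucc] at h1
    omega

theorem mergeMap_val {p : ℕ} (i : Fin (p + 2)) (j : Fin (p + 2)) :
    (mergeMap i j).val = if j.val ≤ min i.val p then j.val else j.val - 1 :=
  collapseMap_val _ _

theorem mergeMap_comp_faceMap {p : ℕ} (i : Fin (p + 2)) : mergeMap i ∘ faceMap i = id := by
  funext j
  refine Fin.ext ?_
  rw [Function.comp_apply, mergeMap_val, faceMap_val, id]
  split_ifs <;> omega

theorem faceMap_mergeMap {p : ℕ} {i j : Fin (p + 2)} (h : j ≠ i) :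
    faceMap i (mergeMap i j) = j := by
  have h' : j.val ≠ i.val := fun h' => h (Fin.ext h')
  refine Fin.ext ?_
  rw [faceMap_val, mergeMap_val]
  split_ifs <;> omega

theorem map_faceMap_mergeMap {p : ℕ} {i : Fin (p + 2)} {t : stdSimplex ℝ (Fin (p + 2))}
    (h : t i = 0) : stdSimplex.map (faceMap i) (stdSimplex.map (mergeMap i) t) = t := by
  rw [stdSimplex.map_comp_apply]
  refine (stdSimplex.map_congr_of_ne_zero (g' := id) fun j hj => ?_).trans
    (stdSimplex.map_id_apply t)
  exact faceMap_mergeMap fun hji => hj (hji ▸ h)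

/-- A simplex is not changed by precomposition with `φ ≥ id` if it maps all `i ≤ φ i` to
identities. -/
theorem NerveSimplex.restrict_eq_self {C : CGHCategory.{u}} {p : ℕ} (y : NerveSimplex C p)
    (φ : Fin (p + 1) →o Fin (p + 1)) (h : ∀ i, i ≤ φ i)
    (hy : ∀ i, y.map i (φ i) (h i) ∈ Set.range C.one) : y.restrict φ = y := by
  have hobj : ∀ i, y.obj (φ i) = y.obj i := fun i => by
    obtain ⟨a, ha⟩ := hy i
    rw [← y.tgt_map i (φ i) (h i), ← y.src_map i (φ i) (h i), ← ha, C.tgt_one, C.src_one]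
  have hone : ∀ i, y.map i (φ i) (h i) = C.one (y.obj i) := fun i => by
    obtain ⟨a, ha⟩ := hy i
    rw [← y.src_map i (φ i) (h i), ← ha, C.src_one]
  refine NerveSimplex.ext (funext hobj) (funext fun i => funext fun j => funext fun hij => ?_)
  have w1 : C.tgt (C.one (y.obj i)) = C.src (y.map (φ i) (φ j) (φ.monotone hij)) := by
    rw [C.tgt_one, y.src_map, hobj]
  have w2 : C.tgt (y.map i j hij) = C.src (C.one (y.obj j)) := by rw [C.src_one, y.tgt_map]
  refine (C.one_comp' _ _ w1).symm.trans ?_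
  refine (C.comp_congr (hone i).symm rfl _ ?_).trans ?_
  · rw [y.tgt_map, y.src_map]
  refine (y.map_comp i (φ i) (φ j) (h i) (φ.monotone hij)).symm.trans ?_
  refine (y.map_comp i j (φ j) hij (h j)).trans ?_
  exact (C.comp_congr rfl (hone j) _ w2).trans (C.comp_one' _ _ w2)

namespace JoinPt

variable {X Y : CGHCategory.{u}} {f : CGHFunctor X Y} {p : ℕ}

/-- The join point obtained by omitting the `i`-th vertex and adding its weight to the next vertex,
or to the previous one if `i` is the last vertex. -/
noncomputable def face (z : JoinPt f (p + 1)) (i : Fin (p + 2)) : JoinPt f p :=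
  z.reindex (faceMap i) (stdSimplex.map (mergeMap i) z.t)

/-- A vertex is redundant if its weight is zero or the arrow to its successor is an identity. -/
def Redundant (z : JoinPt f (p + 1)) (i : Fin (p + 2)) : Prop :=
  z.t i = 0 ∨ ∃ k : Fin (p + 1), i = k.castSucc ∧ z.y.edge k ∈ Set.range Y.one

theorem Cont.face {K : Type u} [TopologicalSpace K] [CompactSpace K] [T2Space K]
    {z : K → JoinPt f (p + 1)} (hz : Cont z) (i : Fin (p + 2)) : Cont fun k => (z k).face i :=
  hz.reindex _ ((stdSimplex.continuous_map _).comp hz.t)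

theorem Sim.face {z z' : JoinPt f (p + 1)} (h : Sim z z') (i : Fin (p + 2)) :
    Sim (z.face i) (z'.face i) := by
  rw [JoinPt.face, JoinPt.face, ← h.2.2.1]
  exact h.reindex _ _

theorem Sim.redundant {z z' : JoinPt f (p + 1)} (h : Sim z z') {i : Fin (p + 2)}
    (hi : z.Redundant i) : z'.Redundant i := by
  rw [Redundant, ← h.1, ← h.2.2.1]
  exact hi

theorem Redundant.gauge_eq_zero (R : EdgeRetraction Y) {z : JoinPt f (p + 1)} {i : Fin (p + 2)}
    (h : z.Redundant i) : gauge R z = 0 := by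
  rcases h with h | ⟨k, -, a, h⟩
  · exact JoinPt.gauge_eq_zero R (k := some (Sum.inr i)) h
  · refine JoinPt.gauge_eq_zero R (k := some (Sum.inl k)) ?_
    rw [gaugeTerm, ← h, R.u_one]

theorem gauge_eq_zero_of_w (R : EdgeRetraction Y) {z : JoinPt f p} (h : z.w = 0) :
    gauge R z = 0 :=
  JoinPt.gauge_eq_zero R (k := none) (by rw [gaugeTerm, h, Set.Icc.coe_zero, zero_div])

theorem reindex_eq_self_of_edge (z : JoinPt f (p + 1)) (k : Fin (p + 1))
    (h : z.y.edge k ∈ Set.range Y.one) :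
    z.reindex ((faceMap k.castSucc).comp (collapseMap k)) z.t = z := by
  have hval : ∀ i, (((faceMap k.castSucc).comp (collapseMap k)) i).val =
      if i.val = k.val then i.val + 1 else i.val := fun i => by
    change (faceMap k.castSucc (collapseMap k i)).val = _
    rw [faceMap_val, collapseMap_val, Fin.val_castSucc]
    split_ifs <;> omega
  refine JoinPt.ext (z.y.restrict_eq_self _ (fun i => ?_) fun i => ?_)
    (z.reindex_e_of_last _ _ (Fin.ext ?_)) rfl rfl
  · rw [Fin.le_def, hval]
    split_ifs <;> omega
  · by_cases hi : i.val = k.val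
    · have e1 : i = k.castSucc := Fin.ext hi
      have e2 : ((faceMap k.castSucc).comp (collapseMap k)) i = k.succ :=
        Fin.ext (by rw [hval, if_pos hi, Fin.val_succ, hi])
      rw [z.y.map_congr e1 e2 _ (Fin.castSucc_lt_succ).le]
      exact h
    · exact ⟨_, (z.y.map_self (Fin.ext (by rw [hval, if_neg hi])) _).symm⟩
  · rw [hval, if_neg (by rw [Fin.val_last]; omega)]

theorem edge_reindex_collapseMap (z : JoinPt f p) (k : Fin (p + 1))
    (t : stdSimplex ℝ (Fin (p + 2))) :
    (z.reindex (collapseMap k) t).y.edge k ∈ Set.range Y.one := by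
  refine ⟨_, (z.y.map_self (Fin.ext ?_) _).symm⟩
  rw [collapseMap_val, collapseMap_val, Fin.val_castSucc, Fin.val_succ]
  split_ifs <;> omega

theorem mergeMap_castSucc (k : Fin (p + 1)) : mergeMap k.castSucc = collapseMap k := by
  rw [mergeMap]
  congr 1
  refine Fin.ext ?_
  change min k.val p = k.val
  omega

/-- The two faces coincide if the arrow between the two omitted vertices is an identity and the
second has weight zero. -/
theorem face_castSucc_eq_face_succ (z : JoinPt f (p + 1)) (k : Fin (p + 1))
    (h : z.y.edge k ∈ Set.range Y.one) (ht : z.t k.succ = 0) :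
    z.face k.castSucc = z.face k.succ := by
  have h1 : z.face k.succ = z.reindex (((faceMap k.castSucc).comp (collapseMap k)).comp
      (faceMap k.succ)) (stdSimplex.map (mergeMap k.succ) z.t) := by
    rw [← reindex_reindex z _ z.t, z.reindex_eq_self_of_edge k h, face]
  have h2 : ((faceMap k.castSucc).comp (collapseMap k)).comp (faceMap k.succ) =
      faceMap k.castSucc := by
    refine OrderHom.ext _ _ (funext fun i => congrArg (faceMap k.castSucc) (Fin.ext ?_))
    rw [collapseMap_val, faceMap_val, Fin.val_succ]
    split_ifs <;> omega
  have h3 : stdSimplex.map (mergeMap k.succ) z.t = stdSimplex.map (mergeMap k.castSucc) z.t := by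
    refine stdSimplex.map_congr_of_ne_zero fun i hi => Fin.ext ?_
    have hi' : i.val ≠ k.val + 1 := fun h' => hi (by
      rwa [show i = k.succ from Fin.ext h'])
    rw [mergeMap_val, mergeMap_val, Fin.val_castSucc, Fin.val_succ]
    split_ifs <;> omega
  rw [h1, h2, h3, face]

theorem face_face (z : JoinPt f (p + 2)) {i j : Fin (p + 3)} (hij : i.val < j.val)
    {i' j' : Fin (p + 2)} (hi : i'.val = i.val) (hj : j'.val = j.val - 1) :
    (z.face i).face j' = (z.face j).face i' := by
  have h1 : (faceMap i).comp (faceMap j') = (faceMap j).comp (faceMap i') := by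
    refine OrderHom.ext _ _ (funext fun k => Fin.ext ?_)
    change (faceMap i (faceMap j' k)).val = (faceMap j (faceMap i' k)).val
    rw [faceMap_val, faceMap_val, faceMap_val, faceMap_val]
    split_ifs <;> omega
  have h2 : stdSimplex.map (mergeMap j') (stdSimplex.map (mergeMap i) z.t) =
      stdSimplex.map (mergeMap i') (stdSimplex.map (mergeMap j) z.t) := by
    rw [stdSimplex.map_comp_apply, stdSimplex.map_comp_apply]
    congr 1
    refine funext fun k => Fin.ext ?_
    rw [Function.comp_apply, Function.comp_apply, mergeMap_val, mergeMap_val, mergeMap_val,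
      mergeMap_val]
    split_ifs <;> omega
  refine (reindex_reindex z _ _ _ _).trans (Eq.trans ?_ (reindex_reindex z _ _ _ _).symm)
  rw [h1]
  exact congrArg _ h2

/-- The edge of a face, as an arrow of the original simplex. -/
theorem edge_face (z : JoinPt f (p + 2)) (i : Fin (p + 3)) (k : Fin (p + 1)) {a b : Fin (p + 3)}
    (ha : (faceMap i k.castSucc).val = a.val) (hb : (faceMap i k.succ).val = b.val) (hab : a ≤ b) :
    (z.face i).y.edge k = z.y.map a b hab :=
  z.y.map_congr (Fin.ext ha) (Fin.ext hb) _ _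

theorem Redundant.face_left {z : JoinPt f (p + 2)} {i j : Fin (p + 3)} (hij : i.val < j.val)
    (hi : j.val = i.val + 1 → z.t i = 0 ∨ z.t j ≠ 0) (hj : z.Redundant j) {j' : Fin (p + 2)}
    (hj' : j'.val = j.val - 1) : (z.face i).Redundant j' := by
  rcases hj with hj | ⟨k, rfl, hk⟩
  · left
    refine stdSimplex.map_apply_eq_zero _ _ _ fun l hl => ?_
    have hl' : (mergeMap i l).val = j'.val := congrArg Fin.val hl
    rw [mergeMap_val] at hl'
    rcases (show l.val = j.val ∨ (l.val = i.val ∧ j.val = i.val + 1) by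
      split_ifs at hl' <;> omega) with h | ⟨h, h'⟩
    · rwa [show l = j from Fin.ext h]
    · rw [show l = i from Fin.ext h]
      exact (hi h').resolve_right (not_not_intro hj)
  · right
    rw [Fin.val_castSucc] at hij hj'
    refine ⟨⟨k.val - 1, by omega⟩, Fin.ext (by rw [hj']; rfl), ?_⟩
    rw [edge_face z i _ (a := k.castSucc) (b := k.succ) _ _ (Fin.castSucc_lt_succ).le]
    · exact hk
    · rw [faceMap_val, Fin.val_castSucc, Fin.val_castSucc]
      dsimp only
      split_ifs <;> omega
    · rw [faceMap_val, Fin.val_succ, Fin.val_succ]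
      dsimp only
      split_ifs <;> omega

theorem Redundant.face_right {z : JoinPt f (p + 2)} {i j : Fin (p + 3)} (hij : i.val < j.val)
    (hi : z.Redundant i) (hj : z.Redundant j) (hji : j.val = i.val + 1 → z.t i = 0 ∨ z.t j ≠ 0)
    {i' : Fin (p + 2)} (hi' : i'.val = i.val) : (z.face j).Redundant i' := by
  by_cases hti : z.t i = 0
  · left
    refine stdSimplex.map_apply_eq_zero _ _ _ fun l hl => ?_
    have hl' : (mergeMap j l).val = i'.val := congrArg Fin.val hl
    rw [mergeMap_val] at hl'
    rcases (show l.val = i.val ∨ (l.val = j.val ∧ j.val = p + 2) by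
      split_ifs at hl' <;> omega) with h | ⟨h, h'⟩
    · rwa [show l = i from Fin.ext h]
    · rw [show l = j from Fin.ext h]
      refine hj.resolve_right fun ⟨k, hk, _⟩ => ?_
      have := congrArg Fin.val hk
      rw [Fin.val_castSucc] at this
      omega
  · obtain ⟨k, rfl, hk⟩ := hi.resolve_left hti
    right
    rw [Fin.val_castSucc] at hij hi' hji
    by_cases h : j.val = k.val + 1
    · obtain ⟨k', rfl, hk'⟩ := hj.resolve_left ((hji h).resolve_left hti)
      rw [Fin.val_castSucc] at hij h
      refine ⟨⟨k.val, by omega⟩, Fin.ext hi', ?_⟩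
      rw [edge_face z k'.castSucc _ (a := k.castSucc) (b := k'.succ) _ _
        (by rw [Fin.le_def, Fin.val_castSucc, Fin.val_succ]; omega)]
      · obtain ⟨a, ha⟩ := hk
        obtain ⟨b, hb⟩ := hk'
        have e1 : k.succ = k'.castSucc := Fin.ext (by rw [Fin.val_succ, Fin.val_castSucc, h])
        refine ⟨b, ?_⟩
        refine Eq.trans ?_ (z.y.map_comp k.castSucc k'.castSucc k'.succ
          (by rw [← e1]; exact (Fin.castSucc_lt_succ).le) (Fin.castSucc_lt_succ).le).symm
        have e2 : z.y.map k.castSucc k'.castSucc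
            (by rw [← e1]; exact (Fin.castSucc_lt_succ).le) = Y.one a :=
          (z.y.map_congr rfl e1.symm _ (Fin.castSucc_lt_succ).le).trans ha.symm
        have w : Y.tgt (Y.one a) = Y.src (z.y.edge k') := by
          rw [← e2, z.y.tgt_map, z.y.src_edge]
        exact (hb.trans (Y.one_comp' _ _ w).symm).trans (Y.comp_congr e2.symm rfl _ _)
      · rw [faceMap_val, Fin.val_castSucc, Fin.val_castSucc, Fin.val_castSucc]
        dsimp only
        split_ifs
        omega
      · rw [faceMap_val, Fin.val_succ, Fin.val_succ, Fin.val_castSucc]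
        dsimp only
        split_ifs <;> omega
    · refine ⟨⟨k.val, by omega⟩, Fin.ext hi', ?_⟩
      rw [edge_face z j _ (a := k.castSucc) (b := k.succ) _ _ (Fin.castSucc_lt_succ).le]
      · exact hk
      · rw [faceMap_val, Fin.val_castSucc, Fin.val_castSucc]
        dsimp only
        split_ifs <;> omega
      · rw [faceMap_val, Fin.val_succ, Fin.val_succ]
        dsimp only
        split_ifs <;> omega

end JoinPt

/-! ### Compatibility with faces -/

section FaceCompatible

variable {X Y : CGHCategory.{u}} {f : CGHFunctor X Y} {Z : Type*} {p : ℕ}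

open JoinPt

/-- Compatibility with the omission of redundant vertices. -/
def FaceCompatible (F : JoinPt f p → Z) (F' : JoinPt f (p + 1) → Z) : Prop :=
  ∀ (z : JoinPt f (p + 1)) (i : Fin (p + 2)), z.Redundant i → F' z = F (z.face i)

/-- The value at the face is the same for all redundant vertices. -/
def FaceConsistent (F : JoinPt f p → Z) : Prop :=
  ∀ (z : JoinPt f (p + 1)) (i j : Fin (p + 2)), z.Redundant i → z.Redundant j →
    F (z.face i) = F (z.face j)

theorem faceConsistent_of_lt {F : JoinPt f p → Z}
    (h : ∀ (z : JoinPt f (p + 1)) (i j : Fin (p + 2)), i.val < j.val → z.Redundant i →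
      z.Redundant j → (j.val = i.val + 1 → z.t i = 0 ∨ z.t j ≠ 0) →
      F (z.face i) = F (z.face j)) : FaceConsistent F := by
  have key : ∀ (z : JoinPt f (p + 1)) (i j : Fin (p + 2)), i.val < j.val → z.Redundant i →
      z.Redundant j → F (z.face i) = F (z.face j) := by
    intro z i j hij hi hj
    by_cases hc : j.val = i.val + 1 → z.t i = 0 ∨ z.t j ≠ 0
    · exact h z i j hij hi hj hc
    · push Not at hc
      obtain ⟨h1, h2, h3⟩ := hc
      obtain ⟨k, rfl, hk⟩ := hi.resolve_left h2
      obtain rfl : j = k.succ := Fin.ext h1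
      rw [z.face_castSucc_eq_face_succ k hk h3]
  intro z i j hi hj
  rcases lt_trichotomy i.val j.val with hij | hij | hij
  · exact key z i j hij hi hj
  · rw [Fin.ext hij]
  · exact (key z j i hij hj hi).symm

/-- On a `1`-simplex of weights `(t₀, t₁) = (1, 0)`, both faces are given by the vertex. -/
theorem faceConsistent_zero (F : JoinPt f 0 → Z) : FaceConsistent F := by
  refine faceConsistent_of_lt fun z i j hij hi hj h => ?_
  exfalso
  have hi0 : i.val = 0 := by omega
  have hj1 : j.val = 1 := by omega
  obtain rfl : i = 0 := Fin.ext hi0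
  obtain rfl : j = 1 := Fin.ext hj1
  have h1 : z.t 1 = 0 := hj.resolve_right fun ⟨k, hk, _⟩ => by
    have := congrArg Fin.val hk
    rw [Fin.val_castSucc] at this
    omega
  have h0 : z.t 0 = 0 := (h rfl).resolve_right fun h' => h' h1
  have := stdSimplex.sum_eq_one z.t
  rw [Fin.sum_univ_two, h0, h1] at this
  norm_num at this

theorem FaceCompatible.faceConsistent {F : JoinPt f p → Z} {F' : JoinPt f (p + 1) → Z}
    (hF : FaceCompatible F F') : FaceConsistent F' := by
  refine faceConsistent_of_lt fun z i j hij hi hj h => ?_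
  have hi' : (⟨i.val, by omega⟩ : Fin (p + 2)).val = i.val := rfl
  have hj' : (⟨j.val - 1, by omega⟩ : Fin (p + 2)).val = j.val - 1 := rfl
  rw [hF _ _ (Redundant.face_left hij h hj hj'),
    hF _ _ (Redundant.face_right hij hi hj h hi'), z.face_face hij hi' hj']

end FaceCompatible

/-! ### Extension of families of functions from faces -/

section Extension

variable {X Y : CGHCategory.{u}} {f : CGHFunctor X Y} {Z Λ : Type*} {p : ℕ}
  {β : ClassifyingSpace (sliceCat f) → Z}

open JoinPt

/-- A function of join points over `p`-simplices, with parameters in `Λ`, that is continuous, equal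
to `β` on the base `w = 0`, and independent of the point of `B(Y₀ ↓ f)` if `w = 1`. -/
structure LevelFamily [TopologicalSpace Z] [TopologicalSpace Λ]
    (β : ClassifyingSpace (sliceCat f) → Z) (F : Λ → JoinPt f p → Z) : Prop where
  zero : ∀ l z, z.w = 0 → F l z = β z.e
  sim : ∀ l z z', z.Sim z' → F l z = F l z'
  cont : ∀ (K : Type u) [TopologicalSpace K] [CompactSpace K] [T2Space K] (l : K → Λ)
    (z : K → JoinPt f p), Continuous l → Cont z → Continuous fun k => F (l k) (z k)

variable (β) in
open Classical in
/-- The function on join points in the base or with a redundant vertex that is determined by its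
values on faces. (At other join points the value is irrelevant.) -/
noncomputable def boundaryExt (F : JoinPt f p → Z) (z : JoinPt f (p + 1)) : Z :=
  if h : z.w ≠ 0 ∧ ∃ i, z.Redundant i then F (z.face h.2.choose) else β z.e

theorem boundaryExt_zero (F : JoinPt f p → Z) {z : JoinPt f (p + 1)} (h : z.w = 0) :
    boundaryExt β F z = β z.e :=
  dif_neg fun h' => h'.1 h

theorem boundaryExt_of_redundant {F : JoinPt f p → Z} (hc : FaceConsistent F)
    (h0 : ∀ z, z.w = 0 → F z = β z.e) (hβ : ∀ g e, sliceProjMap f e = Y.tgt g →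
      β (sliceAction f g e) = β e) {z : JoinPt f (p + 1)} {i : Fin (p + 2)} (hi : z.Redundant i) :
    boundaryExt β F z = F (z.face i) := by
  by_cases hw : z.w = 0
  · rw [boundaryExt_zero F hw, h0 (z.face i) hw]
    refine (hβ _ _ ?_).symm
    rw [z.base, z.y.tgt_map]
  · have h : z.w ≠ 0 ∧ ∃ i, z.Redundant i := ⟨hw, i, hi⟩
    exact (dif_pos h).trans (hc z _ i h.2.choose_spec hi)

variable (R : EdgeRetraction Y) (S : SliceContraction f)

variable (β) in
/-- The extension of a function from join points over `p`-simplices to those over `p + 1`-simplices,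
obtained by pushing a join point to the boundary. -/
noncomputable def extend (F : JoinPt f p → Z) (z : JoinPt f (p + 1)) : Z :=
  boundaryExt β F (z.move R S 1)

/-- After the full deformation a join point lies in the base or has a redundant vertex. -/
theorem move_one_boundary (z : JoinPt f (p + 1)) :
    (z.move R S 1).w = 0 ∨ ∃ i, (z.move R S 1).Redundant i := by
  obtain ⟨_ | k | i, h⟩ := z.exists_gauge_eq R
  · exact Or.inl (move_one_w R S h)
  · exact Or.inr ⟨k.castSucc, Or.inr ⟨k, rfl, move_one_edge R S h⟩⟩
  · exact Or.inr ⟨i, Or.inl (move_one_t R S h)⟩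

theorem extend_faceCompatible {F : JoinPt f p → Z} (hc : FaceConsistent F)
    (h0 : ∀ z, z.w = 0 → F z = β z.e) (hβ : ∀ g e, sliceProjMap f e = Y.tgt g →
      β (sliceAction f g e) = β e) : FaceCompatible F (extend β R S F) := fun z i hi => by
  rw [extend, z.move_of_gauge_eq_zero R S 1 (hi.gauge_eq_zero R),
    boundaryExt_of_redundant hc h0 hβ hi]

/-- On a family that is compatible with faces, extension amounts to the deformation. -/
theorem extend_eq_of_faceCompatible {F : JoinPt f p → Z} {F' : JoinPt f (p + 1) → Z}
    (hF : FaceCompatible F F') (h0 : ∀ z, z.w = 0 → F' z = β z.e) (z : JoinPt f (p + 1)) :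
    extend β R S F z = F' (z.move R S 1) := by
  by_cases hw : (z.move R S 1).w = 0
  · rw [extend, boundaryExt_zero F hw, h0 _ hw]
  · have h : (z.move R S 1).w ≠ 0 ∧ ∃ i, (z.move R S 1).Redundant i :=
      ⟨hw, (move_one_boundary R S z).resolve_left hw⟩
    exact (dif_pos h).trans (hF _ _ h.2.choose_spec).symm

theorem LevelFamily.extend [TopologicalSpace Z] [TopologicalSpace Λ] {F : Λ → JoinPt f p → Z}
    (hF : LevelFamily β F) (hβc : Continuous β)
    (hβ : ∀ g e, sliceProjMap f e = Y.tgt g → β (sliceAction f g e) = β e)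
    (hc : ∀ l, FaceConsistent (F l)) : LevelFamily β fun l => extend β R S (F l) where
  zero l z hz := by
    rw [_root_.extend, z.move_of_gauge_eq_zero R S 1 (gauge_eq_zero_of_w R hz),
      boundaryExt_zero _ hz]
  sim l z z' h := by
    have h' := h.move R S 1
    by_cases hw : (z.move R S 1).w = 0
    · have hw' : (z'.move R S 1).w = 0 := h'.2.1.symm.trans hw
      have he := h'.2.2.2.resolve_left (by rw [hw]; exact zero_ne_one)
      rw [_root_.extend, _root_.extend, boundaryExt_zero _ hw, boundaryExt_zero _ hw', he]
    · obtain ⟨i, hi⟩ := (move_one_boundary R S z).resolve_left hw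
      rw [_root_.extend, _root_.extend, boundaryExt_of_redundant (hc l) (hF.zero l) hβ hi,
        boundaryExt_of_redundant (hc l) (hF.zero l) hβ (h'.redundant hi)]
      exact hF.sim l _ _ (h'.face i)
  cont K _ _ _ l z hl hz := by
    -- `K` is covered by the closed sets on which a given term attains the minimum in the gauge
    let A : Option (Fin (p + 1) ⊕ Fin (p + 1 + 1)) → Set K :=
      fun κ => {k | gauge R (z k) = gaugeTerm R (z k) κ}
    have hA : ∀ κ, IsClosed (A κ) := fun κ => isClosed_eq (hz.gauge R) (hz.gaugeTerm R κ)
    have hred : ∀ (i : Fin (p + 2)) (κ), (∀ k ∈ A κ, ((z k).move R S 1).Redundant i) →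
        ContinuousOn (fun k => _root_.extend β R S (F (l k)) (z k)) (A κ) := fun i κ hi => by
      rw [continuousOn_iff_continuous_domRestrict]
      have : CompactSpace (A κ) := isCompact_iff_compactSpace.1 (hA κ).isCompact
      refine (hF.cont (A κ) (fun k => l k) _ (hl.comp continuous_subtype_val)
        (((hz.comp continuous_subtype_val).move R S (continuous_const (y := 1))).face i)).congr
        fun k => ?_
      exact (boundaryExt_of_redundant (hc _) (hF.zero _) hβ (hi k k.2)).symm
    refine (locallyFinite_of_finite A).continuous (Set.eq_univ_of_forall fun k => ?_) hA ?_
    · obtain ⟨κ, hκ⟩ := (z k).exists_gauge_eq R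
      exact Set.mem_iUnion.2 ⟨κ, hκ⟩
    · rintro (_ | i | i)
      · rw [continuousOn_iff_continuous_domRestrict]
        refine (hβc.comp ((hz.move R S (continuous_const (y := 1))).e.comp
          continuous_subtype_val)).congr fun k => ?_
        exact (boundaryExt_zero _ (move_one_w R S k.2)).symm
      · exact hred i.castSucc _ fun k hk => Or.inr ⟨i, rfl, move_one_edge R S hk⟩
      · exact hred i _ fun k hk => Or.inl (move_one_t R S hk)

end Extension

section Reindex

variable {X Y : CGHCategory.{u}} {f : CGHFunctor X Y} {Z : Type*}
  {β : ClassifyingSpace (sliceCat f) → Z} {F : ∀ p, JoinPt f p → Z}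

open JoinPt

theorem CompatibleFamily.faceCompatible [TopologicalSpace Z] (hF : CompatibleFamily f β F) (p : ℕ) :
    FaceCompatible (F p) (F (p + 1)) := by
  intro z i hi
  rcases hi with hi | ⟨k, rfl, hk⟩
  · rw [face, hF.reindex, map_faceMap_mergeMap hi]
    rfl
  · conv_lhs => rw [← z.reindex_eq_self_of_edge k hk,
      ← reindex_reindex z _ (stdSimplex.map (mergeMap k.castSucc) z.t), hF.reindex]
    rw [mergeMap_castSucc, face, mergeMap_castSucc]
    rfl

/-- As the coface and codegeneracy maps generate the simplex category, compatibility with the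
omission of redundant vertices implies compatibility with all monotone maps. -/
theorem reindex_of_faceCompatible (hF : ∀ p, FaceCompatible (F p) (F (p + 1))) (m p : ℕ)
    (φ : Fin (m + 1) →o Fin (p + 1)) (z : JoinPt f p) (t : stdSimplex ℝ (Fin (m + 1))) :
    F m (z.reindex φ t) = F p (z.withT (stdSimplex.map φ t)) := by
  let W : MorphismProperty SimplexCategory := fun a b θ =>
    ∀ (z : JoinPt f b.len) (t : stdSimplex ℝ (Fin (a.len + 1))),
      F a.len (z.reindex θ.toOrderHom t) = F b.len (z.withT (stdSimplex.map θ.toOrderHom t))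
  have : W.IsMultiplicative :=
    { id_mem := fun a z t => by
        refine (congrArg _ (z.reindex_id t)).trans ?_
        exact congrArg (fun t => F a.len (z.withT t)) (stdSimplex.map_id_apply t).symm
      comp_mem := fun {a b c} θ θ' h h' z t => by
        have e1 : z.reindex (θ ≫ θ').toOrderHom t =
            (z.reindex θ'.toOrderHom (stdSimplex.map θ.toOrderHom t)).reindex θ.toOrderHom t :=
          (reindex_reindex z _ _ _ _).symm
        refine (congrArg _ e1).trans ((h _ _).trans ((h' z _).trans ?_))
        exact congrArg (fun t => F c.len (z.withT t)) (stdSimplex.map_comp_apply _ _ _) }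
  have hW : W = ⊤ := by
    refine SimplexCategory.morphismProperty_eq_top W ?_ ?_
    · intro n i z t
      change F n (z.reindex (faceMap i) t) = F (n + 1) (z.withT (stdSimplex.map (faceMap i) t))
      have hi : (z.withT (stdSimplex.map (faceMap i) t)).Redundant i := by
        refine Or.inl (stdSimplex.map_apply_eq_zero _ _ _ fun j hj => ?_)
        have := congrArg Fin.val hj
        rw [faceMap_val] at this
        split_ifs at this <;> omega
      rw [hF n _ i hi]
      refine congrArg (fun t => F n (z.reindex (faceMap i) t)) ?_
      change t = stdSimplex.map (mergeMap i) (stdSimplex.map (faceMap i) t)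
      rw [stdSimplex.map_comp_apply, mergeMap_comp_faceMap, stdSimplex.map_id_apply]
    · intro n k z t
      change F (n + 1) (z.reindex (collapseMap k) t) =
        F n (z.withT (stdSimplex.map (collapseMap k) t))
      rw [hF n _ k.castSucc (Or.inr ⟨k, rfl, z.edge_reindex_collapseMap k t⟩), face,
        reindex_reindex, ← mergeMap_castSucc]
      have : (mergeMap k.castSucc).comp (faceMap k.castSucc) = OrderHom.id :=
        OrderHom.ext _ _ (mergeMap_comp_faceMap _)
      rw [this, reindex_id]
      rfl
  have h : W (SimplexCategory.mkHom φ) := by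
    rw [hW]
    trivial
  exact h z t

theorem compatibleFamily_of_levelFamily [TopologicalSpace Z]
    (h : ∀ p, LevelFamily β fun _ : Unit => F p) (hF : ∀ p, FaceCompatible (F p) (F (p + 1))) :
    CompatibleFamily f β F where
  zero p := (h p).zero ()
  sim p := (h p).sim ()
  reindex := reindex_of_faceCompatible hF
  cont p K _ _ _ z hz := (h p).cont K (fun _ => ()) z continuous_const hz

end Reindex

/-! ### The deformation of the canonical family into a family that factors through `Bf` -/

section Deformation

variable {X Y : CGHCategory.{u}} {f : CGHFunctor X Y} {p : ℕ}

open JoinPt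

theorem boundaryExt_comp {Z Z' : Type*} {β : ClassifyingSpace (sliceCat f) → Z} (g : Z → Z')
    (F : JoinPt f p → Z) (z : JoinPt f (p + 1)) :
    boundaryExt (fun e => g (β e)) (fun z => g (F z)) z = g (boundaryExt β F z) := by
  rw [boundaryExt, boundaryExt]
  split_ifs <;> rfl

variable (R : EdgeRetraction Y) (S : SliceContraction f)

/-- Over a single vertex, the deformation ends in the base of the cone. -/
theorem JoinPt.move_one_w_of_vertex (z : JoinPt f 0) : (z.move R S 1).w = 0 := by
  obtain ⟨_ | k | i, h⟩ := z.exists_gauge_eq R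
  · exact move_one_w R S h
  · exact k.elim0
  · exfalso
    have h1 := mul_gauge_le R z
    have h2 := z.w.2.2
    have h3 : z.t i = 1 := by
      have := stdSimplex.sum_eq_one z.t
      rwa [Fin.sum_univ_one, ← (Fin.subsingleton_one).elim i 0] at this
    rw [h, gaugeTerm, h3] at h1
    norm_num at h1
    linarith

/-- The family with values in `BX` obtained from the projection `B(Y₀ ↓ f) → BX` by pushing join
points to the boundary, down to the base of the cones. -/
noncomputable def retractFamily : ∀ p, JoinPt f p → ClassifyingSpace X
  | 0 => fun z => classifyingMap (sliceForget f) (z.move R S 1).e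
  | p + 1 => extend (fun e => classifyingMap (sliceForget f) e) R S (retractFamily p)

theorem retractFamily_zero (z : JoinPt f 0) :
    retractFamily R S 0 z = classifyingMap (sliceForget f) (z.move R S 1).e := rfl

theorem retractFamily_level (p : ℕ) : LevelFamily (fun e => classifyingMap (sliceForget f) e)
    (fun _ : Unit => retractFamily R S p) ∧ FaceConsistent (retractFamily R S p) := by
  induction p with
  | zero =>
    refine ⟨⟨fun _ z hz => ?_, fun _ z z' h => ?_, fun K _ _ _ _ z _ hz => ?_⟩,
      faceConsistent_zero _⟩
    · rw [retractFamily_zero, z.move_of_gauge_eq_zero R S 1 (gauge_eq_zero_of_w R hz)]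
    · rw [retractFamily_zero, retractFamily_zero, (h.move R S 1).2.2.2.resolve_left
        (by rw [z.move_one_w_of_vertex]; exact zero_ne_one)]
    · exact (classifyingMap _).continuous.comp (hz.move R S (continuous_const (y := 1))).e
  | succ p ih =>
    exact ⟨ih.1.extend R S (classifyingMap _).continuous (classifyingMap_sliceAction f) fun _ => ih.2,
      (extend_faceCompatible R S ih.2 (ih.1.zero ()) (classifyingMap_sliceAction f)).faceConsistent⟩

theorem compatibleFamily_retractFamily :
    CompatibleFamily f (fun e => classifyingMap (sliceForget f) e) (retractFamily R S) :=
  compatibleFamily_of_levelFamily (fun p => (retractFamily_level R S p).1) fun p =>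
    extend_faceCompatible R S (retractFamily_level R S p).2 ((retractFamily_level R S p).1.zero ())
      (classifyingMap_sliceAction f)

/-- A homotopy, with parameter `a ∈ ℝ`, from the canonical family in `BY` to the image of
`retractFamily` under `Bf`. Over `p`-simplices it takes place for `-(p + 1) ≤ a ≤ 0`. -/
noncomputable def interpolate (a : ℝ) : ∀ p, JoinPt f p → ClassifyingSpace Y
  | 0 => fun z => joinFamily f 0 (z.move R S (Set.projIcc 0 1 zero_le_one (a + 1)))
  | p + 1 => fun z => if a ≤ -((p : ℝ) + 1) then
      joinFamily f (p + 1) (z.move R S (Set.projIcc 0 1 zero_le_one (a + p + 2)))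
    else extend (fun e => classifyingMap f (classifyingMap (sliceForget f) e)) R S
      (interpolate a p) z

theorem interpolate_zero (a : ℝ) (z : JoinPt f 0) : interpolate R S a 0 z =
    joinFamily f 0 (z.move R S (Set.projIcc 0 1 zero_le_one (a + 1))) := rfl

theorem interpolate_succ (a : ℝ) (p : ℕ) (z : JoinPt f (p + 1)) : interpolate R S a (p + 1) z =
    if a ≤ -((p : ℝ) + 1) then
      joinFamily f (p + 1) (z.move R S (Set.projIcc 0 1 zero_le_one (a + p + 2)))
    else extend (fun e => classifyingMap f (classifyingMap (sliceForget f) e)) R S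
      (interpolate R S a p) z := rfl

theorem interpolate_of_le {a : ℝ} (p : ℕ) (ha : a ≤ -((p : ℝ) + 1)) (z : JoinPt f p) :
    interpolate R S a p z = joinFamily f p z := by
  cases p with
  | zero =>
    rw [Nat.cast_zero] at ha
    rw [interpolate_zero, Set.projIcc_of_le_left _ (by linarith)]
    exact congrArg _ (z.move_zero R S)
  | succ p =>
    push_cast at ha
    rw [interpolate_succ, if_pos (by linarith), Set.projIcc_of_le_left _ (by linarith)]
    exact congrArg _ (z.move_zero R S)

theorem interpolate_of_nonneg {a : ℝ} (ha : 0 ≤ a) (p : ℕ) (z : JoinPt f p) :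
    interpolate R S a p z = classifyingMap f (retractFamily R S p z) := by
  induction p with
  | zero =>
    rw [interpolate_zero, Set.projIcc_of_right_le _ (by linarith)]
    exact (compatibleFamily_joinFamily f).zero _ _ (z.move_one_w_of_vertex R S)
  | succ p ih =>
    have hp : (0 : ℝ) ≤ p := p.cast_nonneg
    rw [interpolate_succ, if_neg (by linarith), funext ih]
    exact boundaryExt_comp (classifyingMap f) _ _

theorem classifyingMap_classifyingMap_sliceAction (g : Y.Mor) (e : ClassifyingSpace (sliceCat f))
    (h : sliceProjMap f e = Y.tgt g) :
    classifyingMap f (classifyingMap (sliceForget f) (sliceAction f g e)) =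
      classifyingMap f (classifyingMap (sliceForget f) e) :=
  congrArg _ (classifyingMap_sliceAction f g e h)

theorem interpolate_faceCompatible {p : ℕ} (a : ℝ) (hc : FaceConsistent (interpolate R S a p))
    (h0 : ∀ z : JoinPt f p, z.w = 0 → interpolate R S a p z =
      classifyingMap f (classifyingMap (sliceForget f) z.e)) :
    FaceCompatible (interpolate R S a p) (interpolate R S a (p + 1)) := by
  intro z i hi
  rw [interpolate_succ]
  split_ifs with ha
  · rw [z.move_of_gauge_eq_zero R S _ (hi.gauge_eq_zero R), interpolate_of_le R S p ha]
    exact (compatibleFamily_joinFamily f).faceCompatible p z i hi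
  · exact extend_faceCompatible R S hc h0 classifyingMap_classifyingMap_sliceAction z i hi

theorem interpolate_level (p : ℕ) : LevelFamily
    (fun e => classifyingMap f (classifyingMap (sliceForget f) e))
    (fun a => interpolate R S a p) ∧ ∀ a, FaceConsistent (interpolate R S a p) := by
  have hr := compatibleFamily_joinFamily f
  have hcβ : Continuous fun e : ClassifyingSpace (sliceCat f) =>
      classifyingMap f (classifyingMap (sliceForget f) e) :=
    (classifyingMap f).continuous.comp (classifyingMap _).continuous
  induction p with
  | zero =>
    refine ⟨⟨fun a z hz => ?_, fun a z z' h => ?_, fun K _ _ _ a z ha hz => ?_⟩,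
      fun a => faceConsistent_zero _⟩
    · rw [interpolate_zero, z.move_of_gauge_eq_zero R S _ (gauge_eq_zero_of_w R hz), hr.zero _ _ hz]
    · exact hr.sim _ _ _ (h.move R S _)
    · exact hr.cont _ _ _ (hz.move R S (continuous_projIcc.comp (ha.add continuous_const)))
  | succ p ih =>
    have hE := ih.1.extend R S hcβ classifyingMap_classifyingMap_sliceAction ih.2
    refine ⟨⟨fun a z hz => ?_, fun a z z' h => ?_, fun K _ _ _ a z ha hz => ?_⟩, fun a =>
      (interpolate_faceCompatible R S a (ih.2 a) (ih.1.zero a)).faceConsistent⟩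
    · rw [interpolate_succ]
      split_ifs
      · rw [z.move_of_gauge_eq_zero R S _ (gauge_eq_zero_of_w R hz), hr.zero _ _ hz]
      · exact hE.zero a z hz
    · rw [interpolate_succ, interpolate_succ]
      split_ifs
      · exact hr.sim _ _ _ (h.move R S _)
      · exact hE.sim a z z' h
    · simp only [interpolate_succ]
      refine Continuous.if_le ?_ (hE.cont K a z ha hz) ha continuous_const fun k hk => ?_
      · exact hr.cont _ _ _ (hz.move R S (continuous_projIcc.comp
          ((ha.add continuous_const).add continuous_const)))
      · rw [Set.projIcc_of_right_le _ (by rw [hk]; linarith)]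
        rw [show interpolate R S (a k) p = joinFamily f p from
          funext fun z => interpolate_of_le R S p hk.le z]
        exact (extend_eq_of_faceCompatible R S (hr.faceCompatible p) (hr.zero _) _).symm

theorem interpolate_sim (a : ℝ) (p : ℕ) {z z' : JoinPt f p} (h : z.Sim z') :
    interpolate R S a p z = interpolate R S a p z' :=
  (interpolate_level R S p).1.sim a z z' h

theorem interpolate_reindex (a : ℝ) (m p : ℕ) (φ : Fin (m + 1) →o Fin (p + 1)) (z : JoinPt f p)
    (t : stdSimplex ℝ (Fin (m + 1))) : interpolate R S a m (z.reindex φ t) =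
      interpolate R S a p (z.withT (stdSimplex.map φ t)) :=
  reindex_of_faceCompatible (F := interpolate R S a) (fun p => interpolate_faceCompatible R S a
    ((interpolate_level R S p).2 a) ((interpolate_level R S p).1.zero a)) m p φ z t

end Deformation

/-! ### Splitting barycentric coordinates -/

section Split

variable {n : ℕ}

/-- The support of `t` lies in `{0, …, i}`, and that of `r` in `{i, …, n}`. -/
def IsSplit (i : Fin (n + 1)) (t r : stdSimplex ℝ (Fin (n + 1))) : Prop :=
  (∀ j, i < j → t j = 0) ∧ ∀ j, j < i → r j = 0

/-- The sum of the first `k` barycentric coordinates. -/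
noncomputable def partialSum (c : stdSimplex ℝ (Fin (n + 1))) (k : ℕ) : ℝ :=
  ∑ j, if j.val < k then c j else 0

theorem partialSum_zero (c : stdSimplex ℝ (Fin (n + 1))) : partialSum c 0 = 0 := by
  simp [partialSum]

theorem partialSum_succ (c : stdSimplex ℝ (Fin (n + 1))) (j : Fin (n + 1)) :
    partialSum c (j + 1) = partialSum c j + c j := by
  have : c j = ∑ j', if j' = j then c j' else 0 := by simp
  rw [partialSum, partialSum, this, ← Finset.sum_add_distrib]
  refine Finset.sum_congr rfl fun j' _ => ?_
  by_cases h1 : j'.val < j.val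
  · rw [if_pos (by omega), if_pos h1, if_neg (fun h => by rw [h] at h1; omega), add_zero]
  · by_cases h2 : j' = j
    · rw [if_pos (by rw [h2]; omega), if_neg h1, if_pos h2, zero_add]
    · have : j'.val ≠ j.val := fun h => h2 (Fin.ext h)
      rw [if_neg (by omega), if_neg h1, if_neg h2, add_zero]

theorem partialSum_eq_one {c : stdSimplex ℝ (Fin (n + 1))} {k : ℕ}
    (h : ∀ j : Fin (n + 1), k ≤ j.val → c j = 0) : partialSum c k = 1 := by
  rw [partialSum, ← stdSimplex.sum_eq_one c]
  refine Finset.sum_congr rfl fun j _ => ?_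
  split_ifs with hj
  · rfl
  · exact (h j (not_lt.1 hj)).symm

theorem partialSum_nonneg (c : stdSimplex ℝ (Fin (n + 1))) (k : ℕ) : 0 ≤ partialSum c k :=
  Finset.sum_nonneg fun j _ => by
    split_ifs
    exacts [c.2.1 j, le_rfl]

theorem partialSum_le_one (c : stdSimplex ℝ (Fin (n + 1))) (k : ℕ) : partialSum c k ≤ 1 := by
  rw [partialSum, ← stdSimplex.sum_eq_one c]
  refine Finset.sum_le_sum fun j _ => ?_
  split_ifs
  exacts [le_rfl, c.2.1 j]

theorem partialSum_mono (c : stdSimplex ℝ (Fin (n + 1))) {k l : ℕ} (h : k ≤ l) :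
    partialSum c k ≤ partialSum c l := by
  refine Finset.sum_le_sum fun j _ => ?_
  split_ifs
  · exact le_rfl
  · omega
  · exact c.2.1 j
  · exact le_rfl

theorem partialSum_mix (w : unitInterval) (t r : stdSimplex ℝ (Fin (n + 1))) (k : ℕ) :
    partialSum (stdSimplex.mix w t r) k = w * partialSum t k + (1 - w) * partialSum r k := by
  rw [partialSum, partialSum, partialSum, Finset.mul_sum, Finset.mul_sum,
    ← Finset.sum_add_distrib]
  refine Finset.sum_congr rfl fun j _ => ?_
  split_ifs
  · exact stdSimplex.mix_apply w t r j
  · simp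

/-- The first part of a splitting is determined by the convex combination of the two parts. -/
theorem IsSplit.mul_partialSum {i : Fin (n + 1)} {t r : stdSimplex ℝ (Fin (n + 1))}
    (h : IsSplit i t r) (w : unitInterval) (k : ℕ) :
    w * partialSum t k = min (w : ℝ) (partialSum (stdSimplex.mix w t r) k) := by
  rw [partialSum_mix]
  rcases le_or_gt k i.val with hk | hk
  · have : partialSum r k = 0 := Finset.sum_eq_zero fun j _ => by
      split_ifs with hj
      · exact h.2 j (Fin.lt_def.2 (lt_of_lt_of_le hj hk))
      · rfl
    rw [this, mul_zero, add_zero]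
    exact (min_eq_right (mul_le_of_le_one_right w.2.1 (partialSum_le_one t k))).symm
  · rw [partialSum_eq_one fun j hj => h.1 j (Fin.lt_def.2 (lt_of_lt_of_le hk hj)), mul_one]
    exact (min_eq_left (le_add_of_nonneg_right (mul_nonneg (sub_nonneg.2 w.2.2)
      (partialSum_nonneg r k)))).symm

theorem IsSplit.left_unique {i i' : Fin (n + 1)} {t r t' r' : stdSimplex ℝ (Fin (n + 1))}
    (h : IsSplit i t r) (h' : IsSplit i' t' r') {w : unitInterval}
    (hm : stdSimplex.mix w t r = stdSimplex.mix w t' r') (hw : w ≠ 0) : t = t' := by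
  have hw' : (w : ℝ) ≠ 0 := fun h0 => hw (Subtype.ext h0)
  have key : ∀ k, partialSum t k = partialSum t' k := fun k => by
    refine mul_left_cancel₀ hw' ?_
    rw [h.mul_partialSum, h'.mul_partialSum, hm]
  refine stdSimplex.ext (funext fun j => ?_)
  have h1 := partialSum_succ t j
  have h2 := partialSum_succ t' j
  rw [key, key] at h1
  linarith

theorem IsSplit.right_unique {i i' : Fin (n + 1)} {t r t' r' : stdSimplex ℝ (Fin (n + 1))}
    (h : IsSplit i t r) (h' : IsSplit i' t' r') {w : unitInterval}
    (hm : stdSimplex.mix w t r = stdSimplex.mix w t' r') (hw : w ≠ 1) : r = r' := by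
  have hw' : (1 - w : ℝ) ≠ 0 := fun h0 => hw (Subtype.ext (sub_eq_zero.1 h0).symm)
  refine stdSimplex.ext (funext fun j => mul_left_cancel₀ hw' ?_)
  have hj : stdSimplex.mix w t r j = stdSimplex.mix w t' r' j := by rw [hm]
  rw [stdSimplex.mix_apply, stdSimplex.mix_apply] at hj
  by_cases h0 : w = 0
  · subst h0
    simpa using hj
  · rw [h.left_unique h' hm h0] at hj
    linarith

theorem exists_isSplit (c : stdSimplex ℝ (Fin (n + 1))) (w : unitInterval) :
    ∃ i t r, IsSplit i t r ∧ stdSimplex.mix w t r = c := by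
  by_cases h0 : w = 0
  · refine ⟨0, stdSimplex.vertex 0, c, ⟨fun j hj => ?_, fun j hj => absurd hj (by simp)⟩, ?_⟩
    · rw [stdSimplex.vertex_coe, Pi.single_eq_of_ne hj.ne']
    · rw [h0, stdSimplex.mix_zero]
  by_cases h1 : w = 1
  · refine ⟨Fin.last n, c, stdSimplex.vertex (Fin.last n), ⟨fun j hj =>
      absurd hj (not_lt.2 (Fin.le_last j)), fun j hj => ?_⟩, ?_⟩
    · rw [stdSimplex.vertex_coe, Pi.single_eq_of_ne hj.ne]
    · rw [h1, stdSimplex.mix_one]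
  have hw0 : (0 : ℝ) < w := lt_of_le_of_ne w.2.1 fun h => h0 (Subtype.ext h.symm)
  have hw1 : (0 : ℝ) < 1 - w := sub_pos.2 (lt_of_le_of_ne w.2.2 fun h => h1 (Subtype.ext h))
  -- the truncated partial sums of `c` are the partial sums of `w t`
  let A : ℕ → ℝ := fun k => min (w : ℝ) (partialSum c k)
  have hlast : partialSum c (n + 1) = 1 := partialSum_eq_one fun j hj => by omega
  have hA0 : A 0 = 0 := by
    change min (w : ℝ) (partialSum c 0) = 0
    rw [partialSum_zero, min_eq_right hw0.le]
  have hA1 : A (n + 1) = w := by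
    change min (w : ℝ) (partialSum c (n + 1)) = w
    rw [hlast, min_eq_left w.2.2]
  have hsum : ∑ j : Fin (n + 1), (A (j + 1) - A j) = w := by
    rw [Fin.sum_univ_eq_sum_range (fun k => A (k + 1) - A k), Finset.sum_range_sub, hA0, hA1,
      sub_zero]
  have hnn : ∀ j : Fin (n + 1), 0 ≤ A (j + 1) - A j := fun j =>
    sub_nonneg.2 (min_le_min_left _ (partialSum_mono c (Nat.le_succ _)))
  have hle : ∀ j : Fin (n + 1), A (j + 1) - A j ≤ c j := fun j => by
    have h := partialSum_succ c j
    have h' := c.2.1 j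
    change min (w : ℝ) (partialSum c (j + 1)) - min (w : ℝ) (partialSum c j) ≤ c j
    rcases le_total (w : ℝ) (partialSum c j) with hj | hj
    · rw [min_eq_left hj]
      linarith [min_le_left (w : ℝ) (partialSum c (j + 1)), show 0 ≤ c j from h']
    · rw [min_eq_right hj]
      linarith [min_le_right (w : ℝ) (partialSum c (j + 1))]
  have hex : ∃ k, (w : ℝ) ≤ partialSum c (k + 1) := ⟨n, by rw [hlast]; exact w.2.2⟩
  classical
  have hkn : Nat.find hex ≤ n := Nat.find_min' hex (by rw [hlast]; exact w.2.2)
  refine ⟨⟨Nat.find hex, by omega⟩, ⟨fun j => (A (j + 1) - A j) / w, fun j => div_nonneg (hnn j)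
    hw0.le, by rw [← Finset.sum_div, hsum, div_self hw0.ne']⟩, ⟨fun j => (c j - (A (j + 1) - A j)) /
    (1 - w), fun j => div_nonneg (sub_nonneg.2 (hle j)) hw1.le, by
      rw [← Finset.sum_div, Finset.sum_sub_distrib, hsum, stdSimplex.sum_eq_one,
        div_self hw1.ne']⟩, ⟨fun j hj => ?_, fun j hj => ?_⟩, ?_⟩
  · change (A (j + 1) - A j) / w = 0
    have hj' : Nat.find hex + 1 ≤ j.val := hj
    have h2 : (w : ℝ) ≤ partialSum c j := (Nat.find_spec hex).trans (partialSum_mono c hj')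
    have h3 : (w : ℝ) ≤ partialSum c (j + 1) := h2.trans (partialSum_mono c (Nat.le_succ _))
    change (min (w : ℝ) (partialSum c (j + 1)) - min (w : ℝ) (partialSum c j)) / w = 0
    rw [min_eq_left h2, min_eq_left h3, sub_self, zero_div]
  · change (c j - (A (j + 1) - A j)) / (1 - w) = 0
    have h2 : partialSum c (j + 1) ≤ w := (not_le.1 (Nat.find_min hex hj)).le
    have h3 : partialSum c j ≤ w := (partialSum_mono c (Nat.le_succ _)).trans h2
    change (c j - (min (w : ℝ) (partialSum c (j + 1)) - min (w : ℝ) (partialSum c j))) / (1 - w) = 0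
    rw [min_eq_right h2, min_eq_right h3, partialSum_succ]
    simp
  · refine stdSimplex.ext (funext fun j => ?_)
    change (w : ℝ) * ((A (j + 1) - A j) / w) + (1 - w) * ((c j - (A (j + 1) - A j)) / (1 - w)) = c j
    rw [mul_div_cancel₀ _ hw0.ne', mul_div_cancel₀ _ hw1.ne']
    ring

end Split

/-! ### The prism over a simplex of `X` -/

section Prism

variable {X Y : CGHCategory.{u}} (f : CGHFunctor X Y) {l m n q : ℕ}

/-- The join point given by the image under `f` of a face `b φ` of a simplex `b` of `X`, and the
point with coordinates `r` of another face `b χ`, where the last vertex of `b φ` comes before the first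
vertex of `b χ`. -/
noncomputable def prismPt (b : NerveSimplex X n) (φ : Fin (m + 1) →o Fin (n + 1))
    (χ : Fin (q + 1) →o Fin (n + 1)) (h : φ (Fin.last m) ≤ χ 0)
    (t : stdSimplex ℝ (Fin (m + 1))) (r : stdSimplex ℝ (Fin (q + 1))) (w : unitInterval) :
    JoinPt f m where
  y := (b.restrict φ).push f
  e := slicePt f (f.mor (b.map _ _ h)) (b.restrict χ) (by rw [f.tgt_mor, b.tgt_map]; rfl) r
  w := w
  t := t
  base := by rw [sliceProjMap_slicePt, f.src_mor, b.src_map]; rfl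

theorem prismPt_congr {b b' : NerveSimplex X n} {φ φ' : Fin (m + 1) →o Fin (n + 1)}
    {χ χ' : Fin (q + 1) →o Fin (n + 1)} (hb : b = b') (hφ : φ = φ') (hχ : χ = χ')
    (h : φ (Fin.last m) ≤ χ 0) (h' : φ' (Fin.last m) ≤ χ' 0) (t : stdSimplex ℝ (Fin (m + 1)))
    (r : stdSimplex ℝ (Fin (q + 1))) (w : unitInterval) :
    prismPt f b φ χ h t r w = prismPt f b' φ' χ' h' t r w := by
  subst hb hφ hχ; rfl

theorem reindex_prismPt (b : NerveSimplex X n) (φ : Fin (m + 1) →o Fin (n + 1))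
    (χ : Fin (q + 1) →o Fin (n + 1)) (h : φ (Fin.last m) ≤ χ 0)
    (t₀ : stdSimplex ℝ (Fin (m + 1))) (r : stdSimplex ℝ (Fin (q + 1))) (w : unitInterval)
    (θ : Fin (l + 1) →o Fin (m + 1)) (t : stdSimplex ℝ (Fin (l + 1))) :
    (prismPt f b φ χ h t₀ r w).reindex θ t = prismPt f b (φ.comp θ) χ
      ((φ.monotone (Fin.le_last _)).trans h) t r w := by
  refine JoinPt.ext rfl ?_ rfl rfl
  refine (sliceAction_slicePt f _ _ ?_ _ _ _).trans (slicePt_congr f ?_ rfl rfl _ _)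
  · rw [f.src_mor, b.src_map]
    exact NerveSimplex.tgt_map _ _ _ _
  · refine Eq.trans ?_ (congrArg f.mor (b.map_comp _ (φ (Fin.last m)) _
      (φ.monotone (Fin.le_last _)) h)).symm
    exact (f.mor_comp _ _ _).symm

theorem prismPt_comp_right (b : NerveSimplex X n) (φ : Fin (m + 1) →o Fin (n + 1))
    (χ : Fin (q + 1) →o Fin (n + 1)) (h : φ (Fin.last m) ≤ χ 0)
    (t : stdSimplex ℝ (Fin (m + 1))) (w : unitInterval)
    (θ : Fin (l + 1) →o Fin (q + 1)) (r : stdSimplex ℝ (Fin (l + 1))) :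
    prismPt f b φ (χ.comp θ) (h.trans (χ.monotone (Fin.zero_le _))) t r w =
      prismPt f b φ χ h t (stdSimplex.map θ r) w := by
  refine JoinPt.ext rfl ?_ rfl rfl
  have hη : Y.tgt (f.mor (b.map _ _ h)) = f.ob ((b.restrict χ).obj 0) := by
    rw [f.tgt_mor, b.tgt_map]
    rfl
  refine Eq.trans ?_ (slicePt_map f _ (b.restrict χ) hη θ r).symm
  refine slicePt_congr f ?_ rfl rfl _ _
  refine (congrArg f.mor (b.map_comp _ (χ 0) _ h (χ.monotone (Fin.zero_le _)))).trans ?_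
  exact f.mor_comp _ _ _

/-- The monotone map `j ↦ min j i`. -/
def minMap (i : Fin (n + 1)) : Fin (n + 1) →o Fin (n + 1) where
  toFun j := min j i
  monotone' _ _ h := min_le_min_right i h

/-- The monotone map `j ↦ max j i`. -/
def maxMap (i : Fin (n + 1)) : Fin (n + 1) →o Fin (n + 1) where
  toFun j := max j i
  monotone' _ _ h := max_le_max_right i h

theorem minMap_le (i j : Fin (n + 1)) : minMap i j ≤ i := min_le_right _ _

theorem le_maxMap (i j : Fin (n + 1)) : i ≤ maxMap i j := le_max_right _ _

theorem IsSplit.map_minMap {i : Fin (n + 1)} {t r : stdSimplex ℝ (Fin (n + 1))}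
    (h : IsSplit i t r) : stdSimplex.map (minMap i) t = t := by
  refine (stdSimplex.map_congr_of_ne_zero (g' := id) fun j hj => ?_).trans
    (stdSimplex.map_id_apply t)
  exact min_eq_left (not_lt.1 fun hij => hj (h.1 j hij))

theorem IsSplit.map_maxMap {i : Fin (n + 1)} {t r : stdSimplex ℝ (Fin (n + 1))}
    (h : IsSplit i t r) : stdSimplex.map (maxMap i) r = r := by
  refine (stdSimplex.map_congr_of_ne_zero (g' := id) fun j hj => ?_).trans
    (stdSimplex.map_id_apply r)
  exact max_eq_left (not_lt.1 fun hij => hj (h.2 j hij))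

theorem IsSplit.map {i : Fin (m + 1)} {t r : stdSimplex ℝ (Fin (m + 1))} (h : IsSplit i t r)
    (χ : Fin (m + 1) →o Fin (n + 1)) :
    IsSplit (χ i) (stdSimplex.map χ t) (stdSimplex.map χ r) := by
  refine ⟨fun j hj => stdSimplex.map_apply_eq_zero _ _ _ fun k hk => h.1 k ?_,
    fun j hj => stdSimplex.map_apply_eq_zero _ _ _ fun k hk => h.2 k ?_⟩
  · exact not_le.1 fun hki => absurd (χ.monotone hki) (not_le.2 (hk ▸ hj))
  · exact not_le.1 fun hki => absurd (χ.monotone hki) (not_le.2 (hk ▸ hj))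

variable {f} {Z : Type*} [TopologicalSpace Z] {β : ClassifyingSpace (sliceCat f) → Z}
  {F : ∀ p, JoinPt f p → Z}

/-- The function on the join of the faces `0, …, i` and `i, …, n` of a simplex of `X` that is
obtained from a family of functions on join points. -/
noncomputable def prismValue (F : ∀ p, JoinPt f p → Z) (b : NerveSimplex X n) (i : Fin (n + 1))
    (t r : stdSimplex ℝ (Fin (n + 1))) (w : unitInterval) : Z :=
  F n (prismPt f b (minMap i) (maxMap i) ((minMap_le i _).trans (le_maxMap i _)) t r w)

theorem CompatibleFamily.prismPt_eq (hF : CompatibleFamily f β F) (b : NerveSimplex X n)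
    (φ : Fin (m + 1) →o Fin (n + 1)) (χ : Fin (q + 1) →o Fin (n + 1)) (i : Fin (n + 1))
    (h : φ (Fin.last m) ≤ i) (h' : i ≤ χ 0) (t : stdSimplex ℝ (Fin (m + 1)))
    (r : stdSimplex ℝ (Fin (q + 1))) (w : unitInterval) :
    F m (prismPt f b φ χ (h.trans h') t r w) =
      prismValue F b i (stdSimplex.map φ t) (stdSimplex.map χ r) w := by
  have hφ : φ = (minMap i).comp φ := OrderHom.ext _ _ (funext fun j =>
    (min_eq_left ((φ.monotone (Fin.le_last j)).trans h)).symm)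
  have hχ : χ = (maxMap i).comp χ := OrderHom.ext _ _ (funext fun j =>
    (max_eq_left (h'.trans (χ.monotone (Fin.zero_le j)))).symm)
  have h0 : minMap i (Fin.last n) ≤ maxMap i 0 := (minMap_le i _).trans (le_maxMap i _)
  have h1 : minMap i (Fin.last n) ≤ ((maxMap i).comp χ) 0 := (minMap_le i _).trans (le_maxMap i _)
  refine (congrArg (F m) ((prismPt_congr f rfl hφ hχ _
    ((minMap_le i _).trans (le_maxMap i _)) t r w).trans
    (reindex_prismPt f b (minMap i) ((maxMap i).comp χ) h1 (stdSimplex.map φ t) r w φ t).symm)).trans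
    ((hF.reindex _ _ _ _ _).trans (congrArg (F n) ?_))
  exact prismPt_comp_right f b (minMap i) (maxMap i) h0 (stdSimplex.map φ t) w χ r

theorem CompatibleFamily.prismValue_restrict (hF : CompatibleFamily f β F)
    (χ : Fin (m + 1) →o Fin (n + 1)) (b : NerveSimplex X n) {i : Fin (m + 1)}
    {t r : stdSimplex ℝ (Fin (m + 1))} (h : IsSplit i t r) (w : unitInterval) :
    prismValue F (b.restrict χ) i t r w =
      prismValue F b (χ i) (stdSimplex.map χ t) (stdSimplex.map χ r) w := by
  have h1 : χ (minMap i (Fin.last m)) ≤ χ i := χ.monotone (minMap_le i _)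
  have h2 : χ i ≤ χ (maxMap i 0) := χ.monotone (le_maxMap i _)
  refine (hF.prismPt_eq b (χ.comp (minMap i)) (χ.comp (maxMap i)) (χ i) h1 h2 t r w).trans ?_
  have e1 : stdSimplex.map (χ.comp (minMap i)) t = stdSimplex.map χ t := by
    conv_rhs => rw [← h.map_minMap, stdSimplex.map_comp_apply]
    rfl
  have e2 : stdSimplex.map (χ.comp (maxMap i)) r = stdSimplex.map χ r := by
    conv_rhs => rw [← h.map_maxMap, stdSimplex.map_comp_apply]
    rfl
  rw [e1, e2]

theorem CompatibleFamily.prismValue_zero (hF : CompatibleFamily f β F) {b : NerveSimplex X n}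
    {i : Fin (n + 1)} {t r : stdSimplex ℝ (Fin (n + 1))} :
    prismValue F b i t r 0 = β (prismPt f b (minMap i) (maxMap i)
      ((minMap_le i _).trans (le_maxMap i _)) t r 0).e :=
  hF.zero _ _ rfl

variable (S : SliceContraction f)

/-- The cone point over a point of a simplex of `Y`. -/
def apexPt (y : NerveSimplex Y n) (t : stdSimplex ℝ (Fin (n + 1))) : JoinPt f n :=
  ⟨y, S.s (y.obj (Fin.last n)), 1, t, S.proj_s _⟩

/-- Compatible families are compatible on the cone points. -/
theorem apexPt_restrict {Z : Type*} {F : ∀ p, JoinPt f p → Z}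
    (hs : ∀ p (z z' : JoinPt f p), z.Sim z' → F p z = F p z')
    (hr : ∀ m p (φ : Fin (m + 1) →o Fin (p + 1)) (z : JoinPt f p)
      (t : stdSimplex ℝ (Fin (m + 1))), F m (z.reindex φ t) = F p (z.withT (stdSimplex.map φ t)))
    (χ : Fin (m + 1) →o Fin (n + 1)) (y : NerveSimplex Y n) (t : stdSimplex ℝ (Fin (m + 1))) :
    F m (apexPt S (y.restrict χ) t) = F n (apexPt S y (stdSimplex.map χ t)) := by
  have h : (apexPt S (y.restrict χ) t).Sim ((apexPt S y (stdSimplex.map χ t)).reindex χ t) :=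
    ⟨rfl, rfl, rfl, Or.inl rfl⟩
  exact (hs m _ _ h).trans (hr m n χ _ t)

theorem continuous_apexPt {K : Type u} [TopologicalSpace K] {y : K → NerveSimplex Y n}
    {t : K → stdSimplex ℝ (Fin (n + 1))} (hy : Continuous y) (ht : Continuous t) :
    JoinPt.Cont fun k => apexPt S (y k) (t k) :=
  ⟨hy, S.continuous_s.comp ((NerveSimplex.continuous_obj _).comp hy), continuous_const, ht⟩

theorem CompatibleFamily.prismValue_one (hF : CompatibleFamily f β F) {b : NerveSimplex X n}
    {i : Fin (n + 1)} {t r : stdSimplex ℝ (Fin (n + 1))} (h : IsSplit i t r) :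
    prismValue F b i t r 1 = F n (apexPt S (b.push f) t) := by
  have := apexPt_restrict S hF.sim hF.reindex (minMap i) (b.push f) t
  rw [h.map_minMap] at this
  rw [← this]
  exact hF.sim _ _ _ ⟨rfl, rfl, rfl, Or.inl rfl⟩

theorem continuous_prismValue (hF : CompatibleFamily f β F) {K : Type u} [TopologicalSpace K]
    [CompactSpace K] [T2Space K] {b : K → NerveSimplex X n}
    {t r : K → stdSimplex ℝ (Fin (n + 1))} {w : K → unitInterval} (hb : Continuous b)
    (ht : Continuous t) (hr : Continuous r) (hw : Continuous w) (i : Fin (n + 1)) :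
    Continuous fun k => prismValue F (b k) i (t k) (r k) (w k) := by
  have hη : ∀ k, Y.tgt (f.mor ((b k).map _ _ ((minMap_le i (Fin.last n)).trans (le_maxMap i 0)))) =
      f.ob (((b k).restrict (maxMap i)).obj 0) := fun k => by
    rw [f.tgt_mor, (b k).tgt_map]
    rfl
  refine hF.cont n K _ ⟨?_, ?_, hw, ht⟩
  · exact (NerveSimplex.continuous_push f).comp ((NerveSimplex.continuous_restrict _).comp hb)
  · have h1 := continuous_sliceSimplex f (f.continuous_mor.comp
      ((NerveSimplex.continuous_map _ _ _).comp hb)) ((NerveSimplex.continuous_restrict _).comp hb)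
      hη
    exact continuous_classPt.comp (h1.prodMk hr)

end Prism

/-! ### The homotopy inverse and the two homotopies -/

section Homotopies

variable {X Y : CGHCategory.{u}} {f : CGHFunctor X Y} {m n : ℕ}

/-- Homotopies out of a classifying space, defined on the products of a simplex with `[0, 1]`. -/
theorem continuous_prod_classLift {C : CGHCategory.{u}} {Z : Type*} [TopologicalSpace Z]
    (φ : unitInterval → ∀ n, NerveSimplex C n → stdSimplex ℝ (Fin (n + 1)) → Z)
    (h : ∀ (w : unitInterval) (m n : ℕ) (θ : Fin (m + 1) →o Fin (n + 1)) (x : NerveSimplex C n)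
      (t : stdSimplex ℝ (Fin (m + 1))), φ w m (x.restrict θ) t = φ w n x (stdSimplex.map θ t))
    (hc : ∀ (n : ℕ) (K : Type u) [TopologicalSpace K] [CompactSpace K] [T2Space K]
      (w : K → unitInterval) (x : K → NerveSimplex C n) (t : K → stdSimplex ℝ (Fin (n + 1))),
      Continuous w → Continuous x → Continuous t → Continuous fun k => φ (w k) n (x k) (t k)) :
    Continuous fun q : unitInterval × ClassifyingSpace C => classLift (φ q.1) (h q.1) q.2 := by
  have key : ∀ n, Continuous fun q : (NerveSimplex C n × stdSimplex ℝ (Fin (n + 1))) × unitInterval =>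
      φ q.2 n q.1.1 q.1.2 := fun n => by
    have : Continuous fun q : NerveSimplex C n × (stdSimplex ℝ (Fin (n + 1)) × unitInterval) =>
        φ q.2.2 n q.1 q.2.1 :=
      continuous_prod_of_forall_compact fun K _ _ _ x l hx hl =>
        hc n K _ x _ (continuous_snd.comp hl) hx (continuous_fst.comp hl)
    exact this.comp ((continuous_fst.comp continuous_fst).prodMk
      ((continuous_snd.comp continuous_fst).prodMk continuous_snd))
  have key' : ∀ x : ClassifyingSpace C, Continuous fun w => classLift (φ w) (h w) x := fun x => by
    obtain ⟨n, y, t, rfl⟩ := exists_eq_classPt x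
    exact (key n).comp (continuous_const (y := (y, t)).prodMk continuous_id)
  let G : ClassifyingSpace C → C(unitInterval, Z) := fun x => ⟨_, key' x⟩
  have hG : Continuous G := continuous_of_comp_classPt fun n =>
    (ContinuousMap.curry ⟨_, key n⟩).continuous
  exact (ContinuousMap.continuous_uncurry_of_continuous ⟨G, hG⟩).comp continuous_swap

variable (R : EdgeRetraction Y) (S : SliceContraction f)

/-- The homotopy inverse of `Bf`: the restriction of `retractFamily` to the cone points. -/
noncomputable def homotopyInverse : C(ClassifyingSpace Y, ClassifyingSpace X) where
  toFun := classLift (fun n y t => retractFamily R S n (apexPt S y t)) fun _ _ χ y t =>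
    apexPt_restrict S (compatibleFamily_retractFamily R S).sim
      (compatibleFamily_retractFamily R S).reindex χ y t
  continuous_toFun := continuous_of_comp_classPt fun n =>
    continuous_prod_of_forall_compact fun K _ _ _ _ _ hy ht =>
      (compatibleFamily_retractFamily R S).cont n K _ (continuous_apexPt S hy ht)

/-- The homotopy `interpolate`, with its parameter changed from `[-∞, 0]` to `[0, 1]`. -/
noncomputable def interpolateUnit (w : unitInterval) (p : ℕ) (z : JoinPt f p) :
    ClassifyingSpace Y :=
  if w = 0 then joinFamily f p z else interpolate R S (1 - (w : ℝ)⁻¹) p z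

/-- Over simplices of a fixed dimension, the homotopy is constant near `0`. -/
theorem interpolateUnit_eq (w : unitInterval) (p : ℕ) (z : JoinPt f p) :
    interpolateUnit R S w p z = interpolate R S (1 - (max (w : ℝ) ((p : ℝ) + 2)⁻¹)⁻¹) p z := by
  have hp : (0 : ℝ) < (p : ℝ) + 2 := by positivity
  rcases le_total (w : ℝ) ((p : ℝ) + 2)⁻¹ with hw | hw
  · rw [max_eq_right hw, inv_inv, interpolate_of_le R S p (by linarith), interpolateUnit]
    split_ifs with h0
    · rfl
    · have hw0 : (0 : ℝ) < w := lt_of_le_of_ne w.2.1 fun h => h0 (Subtype.ext h.symm)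
      have := (le_inv_comm₀ hw0 hp).1 hw
      exact interpolate_of_le R S p (by linarith) z
  · rw [max_eq_left hw, interpolateUnit, if_neg]
    intro h0
    rw [h0] at hw
    exact absurd hw (not_le.2 (inv_pos.2 hp))

theorem interpolateUnit_apexPt_restrict (w : unitInterval) (χ : Fin (m + 1) →o Fin (n + 1))
    (y : NerveSimplex Y n) (t : stdSimplex ℝ (Fin (m + 1))) :
    interpolateUnit R S w m (apexPt S (y.restrict χ) t) =
      interpolateUnit R S w n (apexPt S y (stdSimplex.map χ t)) := by
  rw [interpolateUnit, interpolateUnit]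
  split_ifs
  · exact apexPt_restrict S (compatibleFamily_joinFamily f).sim
      (compatibleFamily_joinFamily f).reindex χ y t
  · exact apexPt_restrict S (fun p _ _ h => interpolate_sim R S _ p h)
      (interpolate_reindex R S _) χ y t

theorem homotopic_classifyingMap_comp_homotopyInverse :
    ((classifyingMap f).comp (homotopyInverse R S)).Homotopic (ContinuousMap.id _) := by
  refine ContinuousMap.Homotopic.symm ⟨⟨⟨_, continuous_prod_classLift
    (fun w n y t => interpolateUnit R S w n (apexPt S y t))
    (fun w m n χ y t => interpolateUnit_apexPt_restrict R S w χ y t) ?_⟩, ?_, ?_⟩⟩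
  · intro n K _ _ _ w y t hw hy ht
    simp only [interpolateUnit_eq]
    refine (interpolate_level R S n).1.cont K _ _ (continuous_const.sub (Continuous.inv₀ ?_ ?_))
      (continuous_apexPt S hy ht)
    · exact (continuous_subtype_val.comp hw).max continuous_const
    · intro k
      have : (0 : ℝ) < ((n : ℝ) + 2)⁻¹ := by positivity
      exact (lt_max_of_lt_right this).ne'
  · intro x
    obtain ⟨n, y, t, rfl⟩ := exists_eq_classPt x
    exact (if_pos rfl).trans (joinFamily_of_w_eq_one f _ rfl)
  · intro x
    obtain ⟨n, y, t, rfl⟩ := exists_eq_classPt x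
    refine (if_neg one_ne_zero).trans ?_
    rw [Set.Icc.coe_one, inv_one, sub_self]
    exact interpolate_of_nonneg R S le_rfl n _

/-- The homotopy from the identity of `BX` to the composite of `Bf` with its homotopy inverse, on
the product of a simplex with `[0, 1]`: the coordinates `c` are split as `w t + (1 - w) r`, with the
support of `t` preceding that of `r`. -/
noncomputable def splitValue (w : unitInterval) (n : ℕ) (b : NerveSimplex X n)
    (c : stdSimplex ℝ (Fin (n + 1))) : ClassifyingSpace X :=
  prismValue (retractFamily R S) b (exists_isSplit c w).choose
    (exists_isSplit c w).choose_spec.choose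
    (exists_isSplit c w).choose_spec.choose_spec.choose w

theorem prismValue_retractFamily_zero (b : NerveSimplex X n) {i : Fin (n + 1)}
    {t r : stdSimplex ℝ (Fin (n + 1))} (h : IsSplit i t r) :
    prismValue (retractFamily R S) b i t r 0 = classPt b r := by
  rw [(compatibleFamily_retractFamily R S).prismValue_zero]
  refine (classifyingMap_sliceForget_slicePt f _ _ _ _).trans ?_
  rw [classPt_restrict, h.map_maxMap]

/-- The value at a splitting depends only on the convex combination. -/
theorem prismValue_retractFamily_congr (b : NerveSimplex X n) {i i' : Fin (n + 1)}
    {t r t' r' : stdSimplex ℝ (Fin (n + 1))} (h : IsSplit i t r) (h' : IsSplit i' t' r')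
    {w : unitInterval} (hm : stdSimplex.mix w t r = stdSimplex.mix w t' r') :
    prismValue (retractFamily R S) b i t r w = prismValue (retractFamily R S) b i' t' r' w := by
  have hF := compatibleFamily_retractFamily R S
  by_cases h0 : w = 0
  · subst h0
    rw [prismValue_retractFamily_zero R S b h, prismValue_retractFamily_zero R S b h',
      h.right_unique h' hm zero_ne_one]
  by_cases h1 : w = 1
  · subst h1
    rw [hF.prismValue_one S h, hF.prismValue_one S h', h.left_unique h' hm h0]
  obtain rfl := h.left_unique h' hm h0
  obtain rfl := h.right_unique h' hm h1
  have key : ∀ {i i' : Fin (n + 1)}, i ≤ i' → IsSplit i t r → IsSplit i' t r →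
      prismValue (retractFamily R S) b i t r w = prismValue (retractFamily R S) b i' t r w := by
    intro i i' hii h h'
    have e1 := hF.prismPt_eq b (minMap i) (maxMap i') i (minMap_le i _)
      (hii.trans (le_maxMap i' _)) t r w
    have e2 := hF.prismPt_eq b (minMap i) (maxMap i') i' ((minMap_le i _).trans hii)
      (le_maxMap i' _) t r w
    rw [h.map_minMap, h'.map_maxMap] at e1 e2
    exact e1.symm.trans e2
  rcases le_total i i' with hi | hi
  · exact key hi h h'
  · exact (key hi h' h).symm

theorem splitValue_eq (w : unitInterval) (b : NerveSimplex X n) {i : Fin (n + 1)}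
    {t r c : stdSimplex ℝ (Fin (n + 1))} (h : IsSplit i t r) (hm : stdSimplex.mix w t r = c) :
    splitValue R S w n b c = prismValue (retractFamily R S) b i t r w :=
  have hc := (exists_isSplit c w).choose_spec.choose_spec.choose_spec
  prismValue_retractFamily_congr R S b hc.1 h (hc.2.trans hm.symm)

theorem splitValue_restrict (w : unitInterval) (χ : Fin (m + 1) →o Fin (n + 1))
    (b : NerveSimplex X n) (c : stdSimplex ℝ (Fin (m + 1))) :
    splitValue R S w m (b.restrict χ) c = splitValue R S w n b (stdSimplex.map χ c) := by
  obtain ⟨i, t, r, h, hm⟩ := exists_isSplit c w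
  rw [splitValue_eq R S w _ h hm, splitValue_eq R S w b (h.map χ)
    (by rw [← stdSimplex.map_mix, hm])]
  exact (compatibleFamily_retractFamily R S).prismValue_restrict χ b h w

theorem continuous_splitValue {K : Type u} [TopologicalSpace K] [CompactSpace K] [T2Space K]
    {w : K → unitInterval} {b : K → NerveSimplex X n} {c : K → stdSimplex ℝ (Fin (n + 1))}
    (hw : Continuous w) (hb : Continuous b) (hc : Continuous c) :
    Continuous fun k => splitValue R S (w k) n (b k) (c k) := by
  -- the space of splittings is compact, so that `K` carries the quotient topology
  let T : Fin (n + 1) → Set (K × stdSimplex ℝ (Fin (n + 1)) × stdSimplex ℝ (Fin (n + 1))) :=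
    fun i => {q | IsSplit i q.2.1 q.2.2 ∧ stdSimplex.mix (w q.1) q.2.1 q.2.2 = c q.1}
  have hT : ∀ i, IsClosed (T i) := fun i => by
    have ht : ∀ j, Continuous fun q : K × stdSimplex ℝ (Fin (n + 1)) ×
        stdSimplex ℝ (Fin (n + 1)) => q.2.1 j := fun j =>
      stdSimplex.continuous_apply (continuous_fst.comp continuous_snd) j
    have hr : ∀ j, Continuous fun q : K × stdSimplex ℝ (Fin (n + 1)) ×
        stdSimplex ℝ (Fin (n + 1)) => q.2.2 j := fun j =>
      stdSimplex.continuous_apply (continuous_snd.comp continuous_snd) j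
    refine IsClosed.and (IsClosed.and ?_ ?_) (isClosed_eq ?_ (hc.comp continuous_fst))
    · simp only [Set.ofPred_forall]
      exact isClosed_iInter fun j => isClosed_iInter fun _ =>
        isClosed_eq (ht j) continuous_const
    · simp only [Set.ofPred_forall]
      exact isClosed_iInter fun j => isClosed_iInter fun _ =>
        isClosed_eq (hr j) continuous_const
    · exact stdSimplex.continuous_mix (hw.comp continuous_fst)
        (continuous_fst.comp continuous_snd) (continuous_snd.comp continuous_snd)
  have hTc : ∀ i, CompactSpace (T i) := fun i => isCompact_iff_compactSpace.1 (hT i).isCompact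
  let π : (Σ i, T i) → K := fun q => q.2.1.1
  have hπ : Continuous π := continuous_sigma fun i => continuous_fst.comp continuous_subtype_val
  have hq : Topology.IsQuotientMap π := hπ.isClosedMap.isQuotientMap hπ fun k => by
    obtain ⟨i, t, r, h, hm⟩ := exists_isSplit (c k) (w k)
    exact ⟨⟨i, (k, t, r), h, hm⟩, rfl⟩
  refine hq.continuous_iff.2 (continuous_sigma fun i => ?_)
  have hv : Continuous fun q : T i => q.1 := continuous_subtype_val
  refine (continuous_prismValue (compatibleFamily_retractFamily R S) (K := T i)
    (b := fun q => b q.1.1) (t := fun q => q.1.2.1) (r := fun q => q.1.2.2) (w := fun q => w q.1.1)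
    (hb.comp (continuous_fst.comp hv)) (continuous_fst.comp (continuous_snd.comp hv))
    (continuous_snd.comp (continuous_snd.comp hv)) (hw.comp (continuous_fst.comp hv)) i).congr
    fun q => ?_
  exact (splitValue_eq R S _ _ q.2.1 q.2.2).symm

theorem homotopic_homotopyInverse_comp_classifyingMap :
    ((homotopyInverse R S).comp (classifyingMap f)).Homotopic (ContinuousMap.id _) := by
  refine ContinuousMap.Homotopic.symm ⟨⟨⟨_, continuous_prod_classLift
    (fun w n b c => splitValue R S w n b c)
    (fun w m n χ b c => splitValue_restrict R S w χ b c)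
    fun n K _ _ _ w b c hw hb hc => continuous_splitValue R S hw hb hc⟩, ?_, ?_⟩⟩
  · intro x
    obtain ⟨n, b, c, rfl⟩ := exists_eq_classPt x
    obtain ⟨i, t, r, h, hm⟩ := exists_isSplit c 0
    refine (splitValue_eq R S 0 b h hm).trans ((prismValue_retractFamily_zero R S b h).trans ?_)
    rw [← hm, stdSimplex.mix_zero]
    rfl
  · intro x
    obtain ⟨n, b, c, rfl⟩ := exists_eq_classPt x
    obtain ⟨i, t, r, h, hm⟩ := exists_isSplit c 1
    refine (splitValue_eq R S 1 b h hm).trans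
      (((compatibleFamily_retractFamily R S).prismValue_one S h).trans ?_)
    rw [← hm, stdSimplex.mix_one]
    rfl

end Homotopies

theorem theoremA {X Y : CGHCategory.{u}} (hX : X.WellPointed) (hY : Y.WellPointed)
    (f : CGHFunctor X Y) (hf : Shrinkable (sliceProjMap f)) :
    IsHomotopyEquivalence (classifyingMap f) := by
  obtain ⟨R⟩ := hY.nonempty_edgeRetraction
  obtain ⟨S⟩ := hf.nonempty_sliceContraction
  exact ⟨⟨classifyingMap f, homotopyInverse R S,
    homotopic_homotopyInverse_comp_classifyingMap R S,
    homotopic_classifyingMap_comp_homotopyInverse R S⟩, rfl⟩
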